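/- Let $\eta\in\mathbb C\setminus\{0\}$ and let $\xi_1,\dots,\xi_N\in\mathbb C$ satisfy $\xi_a\ne\xi_b$, $\xi_a\neq\xi_b\pm\eta$ for all $a\ne b$. Let $$R(\lambda)=\begin{pmatrix}\lambda+\eta&0&0&0\\0&\lambda&\eta&0\\0&\eta&\lambda&0\\0&0&0&\lambda+\eta\end{pmatrix},\qquad T_0(\lambda)=R_{0N}(\lambda-\xi_N)\cdots R_{01}(\lambda-\xi_1)=\begin{pmatrix}A(\lambda)&B(\lambda)\\C(\lambda)&D(\lambda)\end{pmatrix}_{[0]}$$ be the rational $R$-matrix and the monodromy matrix of the XXX spin-$\tfrac12$ chain, acting on $\mathcal H=(\mathbb C^2)^{\otimes N}$, with entries $T_{\epsilon,\epsilon'}(\lambda)$, $\epsilon,\epsilon'\in\{1,2\}$. Put $\bar T_{1,1}(\lambda)=D(\lambda+\eta)^{-1}C(\lambda+\eta)B(\lambda)$ and $\bar T_{\epsilon,\epsilon'}(\lambda)=T_{\epsilon,\epsilon'}(\lambda)$ otherwise. Let $a(z)=\prod_n(z-\xi_n+\eta)$, $d(z)=\prod_n(z-\xi_n)$ and, for $\mathbf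 h\in\{0,1\}^N$, $\xi_n^{(h_n)}=\xi_n-h_n\eta$, $d_{\mathbf h}(z)=\prod_n(z-\xi_n^{(h_n)})$; let $V(x_1,\dots,x_N)=\prod_{i<j}(x_j-x_i)$. A left SoV basis is a basis $\{\langle\mathbf h|\}_{\mathbf h\in\{0,1\}^N}$ of $\mathcal H^*$ such that, for all $\lambda$, $\langle\mathbf h|D(\lambda)=d_{\mathbf h}(\lambda)\langle\mathbf h|$ and $$\langle\mathbf h|C(\lambda)=\sum_{a}\delta_{h_a,0}\,d(\xi_a-\eta)\prod_{b\ne a}\frac{\lambda-\xi_b^{(h_b)}}{\xi_a^{(h_a)}-\xi_b^{(h_b)}}\langle \mathrm T_a^+\mathbf h|,\qquad \langle\mathbf h|B(\lambda)=-\sum_{a}\delta_{h_a,1}\,a(\xi_a)\prod_{b\ne a}\frac{\lambda-\xi_b^{(h_b)}}{\xi_a^{(h_a)}-\xi_b^{(h_b)}}\langle \mathrm T_a^-\mathbf h|,$$ where $\mathrm T_a^\pm$ changes $h_a$ into $h_a\pm1$. Let $Q(z)=\prod_{k=1}^R(z-q_k)$ with $q_k\notin\{\xi_n,\xi_n-\eta\}$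 for all $k,n$, and let $$\langle Q|=\sum_{\mathbf h}\prod_{n=1}^NQ(\xi_n^{(h_n)})\,V(\xi_1^{(h_1)},\dots,\xi_N^{(h_N)})\,\langle\mathbf h|$$ be the corresponding separate state. Let $m\ge0$, $\epsilon_1,\dots,\epsilon_{2m}\in\{1,2\}$, and $\lambda_1,\dots,\lambda_m\in\mathbb C$ with $\lambda_j\notin\{\xi_n,\xi_n-\eta,\xi_n-2\eta\}$ for all $j,n$. Then left SoV bases exist, contours as described below exist, and for every left SoV basis and every such choice of contours $$\begin{aligned} \langle Q|\,&\bar T_{\epsilon_2,\epsilon_1}(\lambda_1)\,\bar T_{\epsilon_4,\epsilon_3}(\lambda_2)\cdots\bar T_{\epsilon_{2m},\epsilon_{2m-1}}(\lambda_m) =\sum_{\mathbf h}\prod_{j=1}^md_{\mathbf h}(\lambda_j)\prod_{n=1}^NQ(\xi_n^{(h_n)})\\ &\times\prod_{j=m}^{1}\Bigg[\bigg(-\oint_{\Gamma_{2j}}\frac{dz_{2j}}{2\pi i(\lambda_j-z_{2j})}\frac{a(z_{2j})}{d_{\mathbf h}(z_{2j})}\frac{Q(z_{2j}-\eta)}{Q(z_{2j})}\prod_{k=1}^{j-1}\frac{z_{2j}-\lambda_k-\eta}{z_{2j}-\lambda_k}\bigg)^{2-\epsilon_{2j}}\\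 &\qquad\times\bigg(\oint_{\Gamma_{2j-1}}\frac{dz_{2j-1}}{2\pi i(\lambda_j-z_{2j-1})}\frac{d(z_{2j-1})}{d_{\mathbf h}(z_{2j-1})}\frac{Q(z_{2j-1}+\eta)}{Q(z_{2j-1})}\prod_{k=1}^{j-1}\frac{z_{2j-1}-\lambda_k+\eta}{z_{2j-1}-\lambda_k}\bigg)^{2-\epsilon_{2j-1}}\Bigg]\\ &\times\prod_{1\le j<k\le 2m}\Big(\frac{z_j-z_k}{z_j-z_k+(-1)^k\eta}\Big)^{(2-\epsilon_j)(2-\epsilon_k)}V(\xi_1^{(h_1)},\dots,\xi_N^{(h_N)})\,\langle\mathbf h| . \end{aligned}$$ Here an exponent $2-\epsilon_i=0$ means that the variable $z_i$ is absent, and the integrals are iterated, $z_{2m}$ being the outermost and $z_1$ the innermost variable; each contour is a finite family of closed curves and may depend on the outer variables. The contour $\Gamma_{2j}$ surrounds once counterclockwise (has winding number $1$ about) the points $\xi_n$, $1\le n\le N$, and the points $z_{2k-1}+\eta$, $k>j$; the contour $\Gamma_{2j-1}$ surrounds once counterclockwise the points $\xi_n-\eta$, $1\le n\le N$, and the points $z_{2k}-\eta$,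 $k\ge j$ (in both cases for the variables that are present); and they surround no other pole, which means precisely: there is a set $U\subset\mathbb C$ containing all $\xi_n$, with $U\cap(U-\eta)=\emptyset$ and with no $\lambda_j$ and no $q_k$ in $U\cup(U-\eta)$, such that every $\Gamma_{2j}$ lies in $U$ and has winding number $0$ about every point outside $U$, and every $\Gamma_{2j-1}$ lies in $U-\eta$ and has winding number $0$ about every point outside $U-\eta$. In particular, for $m=1$ this gives the action of a single operator $\bar T_{\epsilon_2,\epsilon_1}(\lambda)$ on $\langle Q|$, with cross factor $\big(\frac{z_1-z_2}{z_1-z_2+\eta}\big)^{(2-\epsilon_1)(2-\epsilon_2)}$. -/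

import Mathlib

namespace XXXChain

noncomputable section

open Matrix

/-- A spin configuration of the `N` sites; it labels the canonical basis of `(ℂ²)^{⊗N}`. The value
`0 : Fin 2` is the first canonical vector of `ℂ²`, the value `1 : Fin 2` the second one.
The same type is used for the labels `𝐡 ∈ {0,1}^N` of the SoV basis. -/
abbrev Config (N : ℕ) : Type := Fin N → Fin 2

/-- Operators on the quantum space `(ℂ²)^{⊗N}`. -/
abbrev Op (N : ℕ) : Type := Matrix (Config N) (Config N) ℂ

/-- Covectors on the quantum space, as row vectors; operators act on them from the right of the
row vector by `ᵥ*`. -/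
abbrev Bra (N : ℕ) : Type := Config N → ℂ

/-- The rational `R`-matrix on `ℂ² ⊗ ℂ²`, in the ordered basis `(1,1), (1,2), (2,1), (2,2)`. -/
def rMatrix (η l : ℂ) : Matrix (Fin 2 × Fin 2) (Fin 2 × Fin 2) ℂ :=
  (!![l + η, 0, 0, 0;
      0, l, η, 0;
      0, η, l, 0;
      0, 0, 0, l + η]).submatrix finProdFinEquiv finProdFinEquiv

/-- `R_{0n}(l)`: the `R`-matrix acting on the auxiliary space and on site `n`, written as a
`2 × 2` matrix (in the auxiliary space) of operators on the quantum space. -/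
def rSite {N : ℕ} (η : ℂ) (n : Fin N) (l : ℂ) : Matrix (Fin 2) (Fin 2) (Op N) :=
  fun α β => fun s t =>
    if ∀ k, k ≠ n → s k = t k then rMatrix η l (α, s n) (β, t n) else 0

/-- The monodromy matrix `T₀(l) = R_{0N}(l - ξ_N) ⋯ R_{01}(l - ξ_1)`. -/
def monodromy {N : ℕ} (ξ : Fin N → ℂ) (η l : ℂ) : Matrix (Fin 2) (Fin 2) (Op N) :=
  ((List.finRange N).reverse.map fun n => rSite η n (l - ξ n)).prod

def opB {N : ℕ} (ξ : Fin N → ℂ) (η l : ℂ) : Op N := monodromy ξ η l 0 1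

def opC {N : ℕ} (ξ : Fin N → ℂ) (η l : ℂ) : Op N := monodromy ξ η l 1 0

def opD {N : ℕ} (ξ : Fin N → ℂ) (η l : ℂ) : Op N := monodromy ξ η l 1 1

/-- The operators `T̄_{ε,ε'}(l)`; the indices `0, 1 : Fin 2` stand for `1, 2`. -/
def opBar {N : ℕ} (ξ : Fin N → ℂ) (η : ℂ) (ε ε' : Fin 2) (l : ℂ) : Op N :=
  if ε = 0 ∧ ε' = 0 then (opD ξ η (l + η))⁻¹ * opC ξ η (l + η) * opB ξ η l
  else monodromy ξ η l ε ε'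

/-- The product `T̄_{ε₂,ε₁}(λ₁) T̄_{ε₄,ε₃}(λ₂) ⋯ T̄_{ε_{2m},ε_{2m-1}}(λ_m)`. -/
def opBarProd {N : ℕ} (ξ : Fin N → ℂ) (η : ℂ) (m : ℕ) (ε : ℕ → Fin 2) (lam : ℕ → ℂ) : Op N :=
  ((List.range m).map fun j =>
    opBar ξ η (ε (2 * (j + 1))) (ε (2 * (j + 1) - 1)) (lam (j + 1))).prod

def funA {N : ℕ} (ξ : Fin N → ℂ) (η z : ℂ) : ℂ := ∏ n, (z - ξ n + η)

def funD {N : ℕ} (ξ : Fin N → ℂ) (z : ℂ) : ℂ := ∏ n, (z - ξ n)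

/-- `ξ_n^{(h_n)} = ξ_n - h_n η`. -/
def xiShift {N : ℕ} (ξ : Fin N → ℂ) (η : ℂ) (h : Config N) (n : Fin N) : ℂ :=
  ξ n - ((h n : ℕ) : ℂ) * η

/-- `d_𝐡(z) = ∏ₙ (z - ξ_n^{(h_n)})`. -/
def funDh {N : ℕ} (ξ : Fin N → ℂ) (η : ℂ) (h : Config N) (z : ℂ) : ℂ :=
  ∏ n, (z - xiShift ξ η h n)

/-- The Vandermonde product `∏_{i<j} (x_j - x_i)`. -/
def vdm {N : ℕ} (x : Fin N → ℂ) : ℂ := ∏ i, ∏ j ∈ Finset.Ioi i, (x j - x i)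

/-- `Q(z) = ∏ₖ (z - q_k)`. -/
def funQ {R : ℕ} (q : Fin R → ℂ) (z : ℂ) : ℂ := ∏ k, (z - q k)

/-- A left SoV basis: a basis `⟨𝐡|` of the space of covectors on which `D`, `C`, `B` act by the
separation-of-variables formulas. -/
structure IsLeftSoVBasis {N : ℕ} (ξ : Fin N → ℂ) (η : ℂ)
    (bra : Module.Basis (Config N) ℂ (Bra N)) : Prop where
  D_left : ∀ (h : Config N) (l : ℂ), bra h ᵥ* opD ξ η l = funDh ξ η h l • bra h
  C_left : ∀ (h : Config N) (l : ℂ), bra h ᵥ* opC ξ η l =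
    ∑ a, if h a = 0 then
      (funD ξ (ξ a - η) * ∏ b ∈ Finset.univ.erase a,
        (l - xiShift ξ η h b) / (xiShift ξ η h a - xiShift ξ η h b)) •
        bra (Function.update h a 1)
    else 0
  B_left : ∀ (h : Config N) (l : ℂ), bra h ᵥ* opB ξ η l =
    -∑ a, if h a = 1 then
      (funA ξ η (ξ a) * ∏ b ∈ Finset.univ.erase a,
        (l - xiShift ξ η h b) / (xiShift ξ η h a - xiShift ξ η h b)) •
        bra (Function.update h a 0)
    else 0

/-- The separate state `⟨Q| = ∑_𝐡 ∏ₙ Q(ξ_n^{(h_n)}) V(ξ_1^{(h_1)},…,ξ_N^{(h_N)}) ⟨𝐡|`. -/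
def separateState {N R : ℕ} (ξ : Fin N → ℂ) (η : ℂ) (q : Fin R → ℂ)
    (bra : Module.Basis (Config N) ℂ (Bra N)) : Bra N :=
  ∑ h, ((∏ n, funQ q (xiShift ξ η h n)) * vdm (xiShift ξ η h)) • bra h

/-- A closed, piecewise differentiable curve in `ℂ` with integrable derivative, parametrized by
`[0,1]`. -/
structure ClosedCurve where
  toFun : ℝ → ℂ
  continuousOn : ContinuousOn toFun (Set.Icc 0 1)
  closed : toFun 0 = toFun 1
  differentiableAt : ∃ s : Set ℝ, s.Finite ∧ ∀ t ∈ Set.Ioo (0 : ℝ) 1 \ s, DifferentiableAt ℝ toFun t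
  integrable_deriv : IntervalIntegrable (deriv toFun) MeasureTheory.volume 0 1

/-- A contour: a finite family of closed curves (for instance one circle around each point). -/
abbrev Contour : Type := List ClosedCurve

/-- The set of points of the contour. -/
def Contour.support (Γ : Contour) : Set ℂ :=
  {p | ∃ γ ∈ Γ, ∃ t ∈ Set.Icc (0 : ℝ) 1, γ.toFun t = p}

/-- The contour integral `∮_Γ f(z) dz`. -/
def Contour.integral (Γ : Contour) (f : ℂ → ℂ) : ℂ :=
  (Γ.map fun γ => ∫ t in (0 : ℝ)..1, f (γ.toFun t) * deriv γ.toFun t).sum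

/-- The contour avoids the point `p` and its index (winding number) with respect to `p` is `n`.
Index `1` means that `Γ` surrounds `p` once counterclockwise, index `0` that it does not
surround `p`. -/
def Contour.HasIndex (Γ : Contour) (p : ℂ) (n : ℤ) : Prop :=
  p ∉ Γ.support ∧ (2 * (Real.pi : ℂ) * Complex.I)⁻¹ * Γ.integral (fun z => (z - p)⁻¹) = n

/-- The factor of the integrand that depends on `z_{2j}` alone:
`-1/(2πi(λ_j - z)) · a(z)/d_𝐡(z) · Q(z-η)/Q(z) · ∏_{k<j} (z-λ_k-η)/(z-λ_k)`. -/
def evenFactor {N R : ℕ} (ξ : Fin N → ℂ) (η : ℂ) (q : Fin R → ℂ) (lam : ℕ → ℂ) (h : Config N)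
    (j : ℕ) (z : ℂ) : ℂ :=
  -(1 / (2 * (Real.pi : ℂ) * Complex.I * (lam j - z)) * (funA ξ η z / funDh ξ η h z) *
    (funQ q (z - η) / funQ q z) *
    ∏ k ∈ Finset.Ico 1 j, (z - lam k - η) / (z - lam k))

/-- The factor of the integrand that depends on `z_{2j-1}` alone:
`1/(2πi(λ_j - z)) · d(z)/d_𝐡(z) · Q(z+η)/Q(z) · ∏_{k<j} (z-λ_k+η)/(z-λ_k)`. -/
def oddFactor {N R : ℕ} (ξ : Fin N → ℂ) (η : ℂ) (q : Fin R → ℂ) (lam : ℕ → ℂ) (h : Config N)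
    (j : ℕ) (z : ℂ) : ℂ :=
  1 / (2 * (Real.pi : ℂ) * Complex.I * (lam j - z)) * (funD ξ z / funDh ξ η h z) *
    (funQ q (z + η) / funQ q z) *
    ∏ k ∈ Finset.Ico 1 j, (z - lam k + η) / (z - lam k)

/-- The factors `(z_j - z_k)/(z_j - z_k + (-1)^k η)`, over `1 ≤ j < k ≤ 2m` with both variables
present. The variable `z_i` is present when the index `ε_i` is `1`, that is `0 : Fin 2`. -/
def crossFactor (η : ℂ) (m : ℕ) (ε : ℕ → Fin 2) (z : ℕ → ℂ) : ℂ :=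
  ∏ k ∈ Finset.Icc 1 (2 * m), ∏ j ∈ Finset.Ico 1 k,
    if ε j = 0 ∧ ε k = 0 then (z j - z k) / (z j - z k + (-1) ^ k * η) else 1

/-- The full integrand, as a function of `z_1, …, z_{2m}`. -/
def integrand {N R : ℕ} (ξ : Fin N → ℂ) (η : ℂ) (q : Fin R → ℂ) (lam : ℕ → ℂ) (m : ℕ)
    (ε : ℕ → Fin 2) (h : Config N) (z : ℕ → ℂ) : ℂ :=
  (∏ j ∈ Finset.Icc 1 m,
    (if ε (2 * j) = 0 then evenFactor ξ η q lam h j (z (2 * j)) else 1) *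
    (if ε (2 * j - 1) = 0 then oddFactor ξ η q lam h j (z (2 * j - 1)) else 1)) *
  crossFactor η m ε z

/-- The iterated integral of `f` over the variables `z_i, z_{i-1}, …, z_1` that are present, `z_i`
being the outermost and `z_1` the innermost one. The contour of a variable may depend on the
values of the variables that are integrated outside of it: `Γ i z` is evaluated where the
coordinates of `z` with index larger than `i` are these values. -/
def iteratedIntegral (ε : ℕ → Fin 2) (Γ : ℕ → (ℕ → ℂ) → Contour) (f : (ℕ → ℂ) → ℂ) :
    ℕ → (ℕ → ℂ) → ℂ
  | 0, z => f z
  | i + 1, z =>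
    if ε (i + 1) = 0 then
      (Γ (i + 1) z).integral fun w => iteratedIntegral ε Γ f i (Function.update z (i + 1) w)
    else iteratedIntegral ε Γ f i z

/-- The contour `C` of `z_i`, for given values of the outer variables `z_k`, `i < k ≤ 2m`.
For even `i` it surrounds counterclockwise the points `ξ_n` and the points `z_k + η`, `k > i` odd;
for odd `i` it surrounds counterclockwise the points `ξ_n - η` and the points `z_k - η`, `k > i`
even. It lies in the region `U` (resp. `U - η`) and surrounds no point outside of this region. -/
def Surrounds {N : ℕ} (ξ : Fin N → ℂ) (η : ℂ) (m : ℕ) (ε : ℕ → Fin 2) (U : Set ℂ) (i : ℕ)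
    (z : ℕ → ℂ) (C : Contour) : Prop :=
  if Even i then
    (∀ n, C.HasIndex (ξ n) 1) ∧
    (∀ k ∈ Finset.Ioc i (2 * m), Odd k → ε k = 0 → C.HasIndex (z k + η) 1) ∧
    (∀ p ∉ U, C.HasIndex p 0)
  else
    (∀ n, C.HasIndex (ξ n - η) 1) ∧
    (∀ k ∈ Finset.Ioc i (2 * m), Even k → ε k = 0 → C.HasIndex (z k - η) 1) ∧
    (∀ p, p + η ∉ U → C.HasIndex p 0)

/-- All contours of `z_i, …, z_1` are as they have to be, whatever the values of the outer
variables on their own contours. -/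
def NestedSurrounds {N : ℕ} (ξ : Fin N → ℂ) (η : ℂ) (m : ℕ) (ε : ℕ → Fin 2) (U : Set ℂ)
    (Γ : ℕ → (ℕ → ℂ) → Contour) : ℕ → (ℕ → ℂ) → Prop
  | 0, _ => True
  | i + 1, z =>
    if ε (i + 1) = 0 then
      Surrounds ξ η m ε U (i + 1) z (Γ (i + 1) z) ∧
      ∀ w ∈ (Γ (i + 1) z).support,
        NestedSurrounds ξ η m ε U Γ i (Function.update z (i + 1) w)
    else NestedSurrounds ξ η m ε U Γ i z

/-- Admissible contours `Γ_1, …, Γ_{2m}`. The region `U` contains the `ξ_n`; it is disjoint from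
`U - η`, and neither `U` nor `U - η` contains a `λ_j` or a `q_k`. So the poles that the contours do
not have to surround (at the `λ_j`, at the `q_k`, at the `z_{2k} - η` in an even variable and at
the `z_{2k-1} + η` in an odd one, and the poles that appear once inner integrals are computed) all
lie outside the region of the contour, and are not surrounded. -/
structure IsContourSystem {N R : ℕ} (ξ : Fin N → ℂ) (η : ℂ) (q : Fin R → ℂ) (lam : ℕ → ℂ) (m : ℕ)
    (ε : ℕ → Fin 2) (U : Set ℂ) (Γ : ℕ → (ℕ → ℂ) → Contour) : Prop where
  xi_mem : ∀ n, ξ n ∈ U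
  disjoint_shift : ∀ p ∈ U, p + η ∉ U
  lam_notMem : ∀ j ∈ Finset.Icc 1 m, lam j ∉ U ∧ lam j + η ∉ U
  q_notMem : ∀ k, q k ∉ U ∧ q k + η ∉ U
  surrounds : NestedSurrounds ξ η m ε U Γ (2 * m) 0

/-- The coefficient of `⟨𝐡|` in the action of the product of operators on `⟨Q|`. -/
def actionCoeff {N R : ℕ} (ξ : Fin N → ℂ) (η : ℂ) (q : Fin R → ℂ) (lam : ℕ → ℂ) (m : ℕ)
    (ε : ℕ → Fin 2) (Γ : ℕ → (ℕ → ℂ) → Contour) (h : Config N) : ℂ :=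
  (∏ j ∈ Finset.Icc 1 m, funDh ξ η h (lam j)) * (∏ n, funQ q (xiShift ξ η h n)) *
    iteratedIntegral ε Γ (integrand ξ η q lam m ε h) (2 * m) 0 * vdm (xiShift ξ η h)

end

end XXXChain

namespace XXXChain

noncomputable section

open Polynomial

/-! ### Contour integrals -/

/-! Consider states ∑_𝐡 φ(𝐡) V(ξ^{(𝐡)}) ⟨𝐡|. In a left SoV basis D multiplies φ by d_𝐡, while B and
C change one h_a with a Lagrange coefficient. After reindexing the sum over 𝐡, the ratio of
Vandermonde products (`vdm_update`) turns this coefficient into the residue of 1/d_𝐡 at ξ_a^{(h_a)},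
up to explicit factors (`stateOf_vecMul_of_shift`). Hence each B adds a sum of residues over the
sites with h_a = 0, and each C, or D⁻¹C, one over the sites with h_a = 1.

On the integral side, the only poles of the outermost variable in its region are those of 1/d_𝐡. At
the residue ξ_a^{(h_a)}, its cross factors with the inner variables have one effect: they replace
d_𝐡 by the function of the configuration with h_a flipped (`singleFactor_flip`). What remains is the
same integral with one variable less (`iteratedIntegral_eq_sum_flip`). So integrals and coefficients
obey the same recursion (`weight_mul_cutIntegral_odd`, `weight_mul_cutIntegral_even`), and induction
on the number of operators gives the formula for concentric circles
(`separateState_vecMul_opBarProd`).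

For general contours the value has to be independent of the choice. All integrands are rational, so
winding numbers and algebra suffice. The class `RegularOn` is closed under divided differences, and
peeling off nodes one at a time shows that integrating out a variable yields a function that depends
on no contour and is again regular in the outer variables (`RegularOn.exists_residue`,
`exists_regularOn_iteratedIntegral`). To compare with circles in the same region, U must contain
discs about the ξ_n; this follows from continuity of the index (`Contour.HasIndex.mem_nhds`).

The SoV basis is built by applying operators C(ξ_a) to the all-up covector. The exchange relations
show that C(ξ_a) moves the zero ξ_a of the D-eigenvalue to ξ_a - η; the quantum determinant shows
that B undoes this step up to a nonzero factor; the D-eigenvalues separate the covectors. Finally B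
and C have degree less than N in λ, so their values at the N points ξ_n^{(h_n)} determine them. -/

theorem ClosedCurve.mem_support {Γ : Contour} {γ : ClosedCurve} (hγ : γ ∈ Γ) {t : ℝ}
    (ht : t ∈ Set.Icc (0 : ℝ) 1) : γ.toFun t ∈ Γ.support := ⟨γ, hγ, t, ht, rfl⟩

theorem ClosedCurve.intervalIntegrable {Γ : Contour} {γ : ClosedCurve} (hγ : γ ∈ Γ) {f : ℂ → ℂ}
    (hf : ContinuousOn f Γ.support) :
    IntervalIntegrable (fun t => f (γ.toFun t) * deriv γ.toFun t) MeasureTheory.volume 0 1 := by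
  refine γ.integrable_deriv.continuousOn_mul ?_
  rw [Set.uIcc_of_le zero_le_one]
  exact hf.comp γ.continuousOn fun t ht => ClosedCurve.mem_support hγ ht

theorem Contour.integral_congr {Γ : Contour} {f g : ℂ → ℂ} (h : ∀ z ∈ Γ.support, f z = g z) :
    Γ.integral f = Γ.integral g := by
  unfold Contour.integral
  refine congrArg List.sum (List.map_congr_left fun γ hγ => ?_)
  refine intervalIntegral.integral_congr fun t ht => ?_
  rw [Set.uIcc_of_le zero_le_one] at ht
  simp only [h _ (ClosedCurve.mem_support hγ ht)]

theorem Contour.integral_const_mul (Γ : Contour) (c : ℂ) (f : ℂ → ℂ) :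
    Γ.integral (fun z => c * f z) = c * Γ.integral f := by
  unfold Contour.integral
  rw [← List.sum_map_mul_left]
  refine congrArg List.sum (List.map_congr_left fun γ _ => ?_)
  simp only [mul_assoc, intervalIntegral.integral_const_mul]

theorem Contour.integral_add {Γ : Contour} {f g : ℂ → ℂ} (hf : ContinuousOn f Γ.support)
    (hg : ContinuousOn g Γ.support) :
    Γ.integral (fun z => f z + g z) = Γ.integral f + Γ.integral g := by
  unfold Contour.integral
  rw [← List.sum_map_add]
  refine congrArg List.sum (List.map_congr_left fun γ hγ => ?_)
  simp only [add_mul]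
  exact intervalIntegral.integral_add (ClosedCurve.intervalIntegrable hγ hf)
    (ClosedCurve.intervalIntegrable hγ hg)

theorem Contour.integral_zero (Γ : Contour) : Γ.integral (fun _ => 0) = 0 := by
  simpa using Γ.integral_const_mul 0 (fun _ => 0)

theorem Contour.integral_sum {ι : Type*} {Γ : Contour} (s : Finset ι) {f : ι → ℂ → ℂ}
    (hf : ∀ i ∈ s, ContinuousOn (f i) Γ.support) :
    Γ.integral (fun z => ∑ i ∈ s, f i z) = ∑ i ∈ s, Γ.integral (f i) := by
  classical
  induction s using Finset.induction_on with
  | empty => simpa using Γ.integral_zero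
  | insert a s ha ih =>
    simp only [Finset.sum_insert ha]
    rw [Contour.integral_add (hf a (Finset.mem_insert_self a s))
      (continuousOn_finsetSum s fun i hi => hf i (Finset.mem_insert_of_mem hi)),
      ih fun i hi => hf i (Finset.mem_insert_of_mem hi)]

/-- A function with a primitive along the contour has integral zero. -/
theorem Contour.integral_eq_zero_of_hasDerivAt {Γ : Contour} {F f : ℂ → ℂ}
    (hF : ∀ z ∈ Γ.support, HasDerivAt F (f z) z) (hf : ContinuousOn f Γ.support) :
    Γ.integral f = 0 := by
  unfold Contour.integral
  refine List.sum_eq_zero fun x hx => ?_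
  obtain ⟨γ, hγ, rfl⟩ := List.mem_map.1 hx
  obtain ⟨s, hs, hd⟩ := γ.differentiableAt
  have := MeasureTheory.integral_eq_of_hasDerivAt_off_countable (fun t => F (γ.toFun t))
    (fun t => f (γ.toFun t) * deriv γ.toFun t) (a := 0) (b := 1) hs.countable ?_ ?_
    (ClosedCurve.intervalIntegrable hγ hf)
  · rw [this, ← γ.closed, sub_self]
  · rw [Set.uIcc_of_le zero_le_one]
    exact ContinuousOn.comp (t := Γ.support)
      (fun z hz => (hF z hz).continuousAt.continuousWithinAt) γ.continuousOn
      fun t ht => ClosedCurve.mem_support hγ ht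
  · intro t ht
    rw [min_eq_left zero_le_one, max_eq_right zero_le_one] at ht
    exact (hF _ (ClosedCurve.mem_support hγ (Set.Ioo_subset_Icc_self ht.1))).comp t
      (hd t ht).hasDerivAt

theorem Contour.integral_eval (Γ : Contour) (P : ℂ[X]) : Γ.integral (fun z => P.eval z) = 0 := by
  induction P using Polynomial.induction_on' with
  | add p q hp hq =>
    simp only [eval_add]
    rw [Contour.integral_add p.continuousOn q.continuousOn, hp, hq, add_zero]
  | monomial n a =>
    refine Contour.integral_eq_zero_of_hasDerivAt
      (F := fun z => a * (z ^ (n + 1) / ((n + 1 : ℕ) : ℂ))) (fun z _ => ?_)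
      (Polynomial.continuousOn _)
    have h := (((hasDerivAt_id z).pow (n + 1)).div_const ((n + 1 : ℕ) : ℂ)).const_mul a
    have h0 : ((n + 1 : ℕ) : ℂ) ≠ 0 := Nat.cast_ne_zero.2 n.succ_ne_zero
    refine h.congr_deriv ?_
    simp only [eval_monomial, id, Nat.add_sub_cancel]
    field_simp

theorem Contour.HasIndex.sub_ne_zero {Γ : Contour} {p z : ℂ} {κ : ℤ} (h : Γ.HasIndex p κ)
    (hz : z ∈ Γ.support) : z - p ≠ 0 := fun e => h.1 (by rwa [← sub_eq_zero.1 e])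

theorem Contour.HasIndex.integral {Γ : Contour} {p : ℂ} {κ : ℤ} (h : Γ.HasIndex p κ) :
    Γ.integral (fun z => (z - p)⁻¹) = 2 * (Real.pi : ℂ) * Complex.I * κ := by
  rw [← h.2, ← mul_assoc, mul_inv_cancel₀ Complex.two_pi_I_ne_zero, one_mul]

theorem Contour.continuousOn_inv_prod {Γ : Contour} {s : Multiset ℂ}
    (hs : ∀ p ∈ s, p ∉ Γ.support) :
    ContinuousOn (fun z => ((s.map fun p => z - p).prod)⁻¹) Γ.support := by
  refine ContinuousOn.inv₀ (continuousOn_multiset_prod s fun p _ => by fun_prop) fun z hz => ?_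
  rw [Ne, Multiset.prod_eq_zero_iff, Multiset.mem_map]
  rintro ⟨p, hp, h⟩
  exact hs p hp (by rwa [← sub_eq_zero.1 h])

/-- A pole of order at least two has a single-valued primitive, so only simple poles feel the
winding number. -/
theorem Contour.integral_inv_pow {Γ : Contour} {p : ℂ} (hp : p ∉ Γ.support) (n : ℕ) :
    Γ.integral (fun z => ((z - p) ^ (n + 2))⁻¹) = 0 := by
  have h0 : ∀ z ∈ Γ.support, z - p ≠ 0 := fun z hz e => hp (by rwa [← sub_eq_zero.1 e])
  refine Contour.integral_eq_zero_of_hasDerivAt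
      (F := fun z => -(((n + 1 : ℕ) : ℂ))⁻¹ * ((z - p) ^ (n + 1))⁻¹) (fun z hz => ?_) ?_
  · have h := ((((hasDerivAt_id z).sub_const p).pow (n + 1)).inv
      (pow_ne_zero (n + 1) (h0 z hz))).const_mul (-(((n + 1 : ℕ) : ℂ))⁻¹)
    have h1 : ((n + 1 : ℕ) : ℂ) ≠ 0 := Nat.cast_ne_zero.2 n.succ_ne_zero
    have h2 := h0 z hz
    refine h.congr_deriv ?_
    simp only [id, Nat.add_sub_cancel, Pi.pow_apply]
    field_simp
    ring
  · exact ContinuousOn.inv₀ (by fun_prop) fun z hz => pow_ne_zero _ (h0 z hz)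

/-- The integral of `1 / ∏ (z - p)` over points `p` that all have the same index. -/
theorem Contour.integral_inv_prod {Γ : Contour} (κ : ℤ) (s : Multiset ℂ)
    (hs : ∀ p ∈ s, Γ.HasIndex p κ) :
    Γ.integral (fun z => ((s.map fun p => z - p).prod)⁻¹) =
      if s.card = 1 then 2 * (Real.pi : ℂ) * Complex.I * κ else 0 := by
  induction hn : s.card using Nat.strong_induction_on generalizing s with
  | _ n ih =>
  obtain rfl | ⟨p, t, rfl⟩ : s = 0 ∨ ∃ p t, s = p ::ₘ t := by
    rcases s.empty_or_exists_mem with h | ⟨p, hp⟩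
    · exact Or.inl h
    · exact Or.inr ⟨p, Multiset.exists_cons_of_mem hp⟩
  · simp only [Multiset.card_zero] at hn
    subst hn
    simpa using Γ.integral_eval 1
  -- If all points coincide, the integrand is a pure power of z - p; otherwise two distinct points
  -- allow a partial fraction step.
  by_cases hall : ∀ x ∈ t, x = p
  · rw [Multiset.eq_replicate_card.2 hall] at hn ⊢
    rcases ht : t.card with _ | k
    · simp only [ht, Multiset.replicate_zero, Multiset.card_cons, Multiset.card_zero] at hn
      subst hn
      simpa using (hs p (Multiset.mem_cons_self p t)).integral
    · simp only [ht, Multiset.card_cons, Multiset.card_replicate] at hn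
      rw [if_neg (by omega)]
      simp only [Multiset.map_cons, Multiset.map_replicate, Multiset.prod_cons,
        Multiset.prod_replicate, ← pow_succ']
      exact Contour.integral_inv_pow (hs p (Multiset.mem_cons_self p t)).1 k
  · push Not at hall
    obtain ⟨x, hx, hxp⟩ := hall
    obtain ⟨u, rfl⟩ := Multiset.exists_cons_of_mem hx
    simp only [Multiset.card_cons] at hn
    rw [if_neg (by omega)]
    have hp := hs p (Multiset.mem_cons_self _ _)
    have hx := hs x (Multiset.mem_cons_of_mem (Multiset.mem_cons_self _ _))
    have hu : ∀ y ∈ u, Γ.HasIndex y κ := fun y hy =>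
      hs y (Multiset.mem_cons_of_mem (Multiset.mem_cons_of_mem hy))
    have hpu : ∀ y ∈ p ::ₘ u, Γ.HasIndex y κ := by
      simpa [Multiset.mem_cons, or_imp, forall_and] using ⟨hp, hu⟩
    have hxu : ∀ y ∈ x ::ₘ u, Γ.HasIndex y κ := by
      simpa [Multiset.mem_cons, or_imp, forall_and] using ⟨hx, hu⟩
    have h1 := ih (n - 1) (by omega) (p ::ₘ u) hpu (by simp; omega)
    have h2 := ih (n - 1) (by omega) (x ::ₘ u) hxu (by simp; omega)
    -- Partial fractions in p and x. The two resulting products have the same number of points, all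
    -- of index κ, so by induction their integrals are equal and the difference cancels.
    have key : ∀ z ∈ Γ.support, (((p ::ₘ x ::ₘ u).map fun p => z - p).prod)⁻¹ =
        (p - x)⁻¹ * ((((p ::ₘ u).map fun p => z - p).prod)⁻¹ +
          -1 * (((x ::ₘ u).map fun p => z - p).prod)⁻¹) := by
      intro z hz
      have e1 := hp.sub_ne_zero hz
      have e2 := hx.sub_ne_zero hz
      have e3 : p - x ≠ 0 := sub_ne_zero.2 (Ne.symm hxp)
      simp only [Multiset.map_cons, Multiset.prod_cons, mul_inv]
      generalize ((u.map fun p => z - p).prod)⁻¹ = v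
      field_simp
      ring
    rw [Contour.integral_congr key, Contour.integral_const_mul, Contour.integral_add
      (Contour.continuousOn_inv_prod fun y hy => (hpu y hy).1)
      (continuousOn_const.fun_mul (Contour.continuousOn_inv_prod fun y hy => (hxu y hy).1)),
      Contour.integral_const_mul, h1, h2]
    ring

/-- Division of P by X - p leaves a constant remainder over the full product, whose integral
vanishes because all indices are 0, and a polynomial over one factor less. -/
theorem Contour.integral_eval_mul_inv_prod {Γ : Contour} (s : Multiset ℂ)
    (hs : ∀ p ∈ s, Γ.HasIndex p 0) (P : ℂ[X]) :
    Γ.integral (fun z => P.eval z * ((s.map fun p => z - p).prod)⁻¹) = 0 := by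
  induction s using Multiset.induction_on generalizing P with
  | empty => simpa using Γ.integral_eval P
  | cons p t ih =>
    have ht : ∀ y ∈ t, Γ.HasIndex y 0 := fun y hy => hs y (Multiset.mem_cons_of_mem hy)
    have hP : P = C (P.eval p) + (X - C p) * (P /ₘ (X - C p)) := by
      conv_lhs => rw [← modByMonic_add_div P (X - C p), modByMonic_X_sub_C_eq_C_eval]
    have key : ∀ z ∈ Γ.support, P.eval z * (((p ::ₘ t).map fun p => z - p).prod)⁻¹ =
        P.eval p * (((p ::ₘ t).map fun p => z - p).prod)⁻¹ +
          (P /ₘ (X - C p)).eval z * ((t.map fun p => z - p).prod)⁻¹ := by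
      intro z hz
      have e1 := (hs p (Multiset.mem_cons_self p t)).sub_ne_zero hz
      conv_lhs => rw [hP]
      simp only [Multiset.map_cons, Multiset.prod_cons, mul_inv, eval_add, eval_mul, eval_sub,
        eval_X, eval_C]
      field_simp
    rw [Contour.integral_congr key, Contour.integral_add
      (continuousOn_const.fun_mul (Contour.continuousOn_inv_prod fun y hy => (hs y hy).1))
      ((P /ₘ (X - C p)).continuousOn.fun_mul (Contour.continuousOn_inv_prod fun y hy => (ht y hy).1)),
      Contour.integral_const_mul, Contour.integral_inv_prod 0 _ hs, ih ht]
    simp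

/-- The integral of a rational function with no pole in the region of the contour. -/
theorem Contour.integral_rational {Γ : Contour} {W : Set ℂ} (hW : ∀ p ∉ W, Γ.HasIndex p 0)
    (P Q : ℂ[X]) (hQ : ∀ z ∈ W, Q.eval z ≠ 0) :
    Γ.integral (fun z => P.eval z / Q.eval z) = 0 := by
  -- Division by zero makes the integrand identically 0 when Q is the zero polynomial.
  by_cases hQ0 : Q = 0
  · rw [← Γ.integral_zero]
    refine Contour.integral_congr fun z _ => by simp [hQ0]
  have hQs : Q = C Q.leadingCoeff * (Q.roots.map fun p => X - C p).prod :=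
    (IsAlgClosed.splits Q).eq_prod_roots
  have hev : ∀ z, Q.eval z = Q.leadingCoeff * (Q.roots.map fun p => z - p).prod := by
    intro z
    conv_lhs => rw [hQs]
    simp [eval_multiset_prod]
  -- The roots of Q lie outside W, so the contour has index 0 about each of them.
  have := Contour.integral_eval_mul_inv_prod Q.roots (Γ := Γ)
    (fun p hp => hW p fun hpW => hQ p hpW (by simpa [hQ0] using hp)) P
  rw [← mul_zero (Q.leadingCoeff)⁻¹, ← this, ← Contour.integral_const_mul]
  refine Contour.integral_congr fun z _ => ?_
  rw [hev, div_eq_mul_inv, mul_inv]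
  ring

end

end XXXChain

namespace XXXChain

noncomputable section

open Polynomial

/-! ### Rational functions of several variables, regular on a domain -/

/-- The functions that are obtained from constants and coordinates by ring operations and by
inversion of functions without zero in `Ω`; only the values on `Ω` matter. -/
inductive RegularOn {ι : Type*} (Ω : Set (ι → ℂ)) : ((ι → ℂ) → ℂ) → Prop
  | const (c : ℂ) : RegularOn Ω fun _ => c
  | coord (i : ι) : RegularOn Ω fun z => z i
  | add {f g : (ι → ℂ) → ℂ} : RegularOn Ω f → RegularOn Ω g → RegularOn Ω fun z => f z + g z
  | mul {f g : (ι → ℂ) → ℂ} : RegularOn Ω f → RegularOn Ω g → RegularOn Ω fun z => f z * g z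
  | inv {f : (ι → ℂ) → ℂ} : RegularOn Ω f → (∀ z ∈ Ω, f z ≠ 0) → RegularOn Ω fun z => (f z)⁻¹
  | congr {f g : (ι → ℂ) → ℂ} : RegularOn Ω f → (∀ z ∈ Ω, f z = g z) → RegularOn Ω g

namespace RegularOn

variable {ι : Type*} {Ω Ω' : Set (ι → ℂ)} {f g : (ι → ℂ) → ℂ}

theorem neg (hf : RegularOn Ω f) : RegularOn Ω fun z => -f z :=
  ((RegularOn.const (-1)).mul hf).congr fun _ _ => by ring

theorem sub (hf : RegularOn Ω f) (hg : RegularOn Ω g) : RegularOn Ω fun z => f z - g z :=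
  (hf.add hg.neg).congr fun _ _ => by ring

theorem div (hf : RegularOn Ω f) (hg : RegularOn Ω g) (h : ∀ z ∈ Ω, g z ≠ 0) :
    RegularOn Ω fun z => f z / g z :=
  (hf.mul (hg.inv h)).congr fun _ _ => (div_eq_mul_inv _ _).symm

theorem prod {κ : Type*} (s : Finset κ) {F : κ → (ι → ℂ) → ℂ} (h : ∀ k ∈ s, RegularOn Ω (F k)) :
    RegularOn Ω fun z => ∏ k ∈ s, F k z := by
  classical
  induction s using Finset.induction_on with
  | empty => simpa using RegularOn.const 1
  | insert a s ha ih =>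
    simp only [Finset.prod_insert ha]
    exact (h a (Finset.mem_insert_self a s)).mul
      (ih fun k hk => h k (Finset.mem_insert_of_mem hk))

/-- Denominators do not vanish after the substitution because the substituted points lie in Ω. This
keeps residues regular in the remaining variables. -/
theorem comp_update [DecidableEq ι] (hf : RegularOn Ω f) {i : ι} {s : (ι → ℂ) → ℂ}
    (hs : RegularOn Ω' s) (hΩ : ∀ z ∈ Ω', Function.update z i (s z) ∈ Ω) :
    RegularOn Ω' fun z => f (Function.update z i (s z)) := by
  induction hf with
  | const c => exact .const c
  | coord j =>
    by_cases hj : j = i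
    · subst hj
      simpa using hs
    · simpa [Function.update_of_ne hj] using RegularOn.coord j
  | add _ _ h₁ h₂ => exact h₁.add h₂
  | mul _ _ h₁ h₂ => exact h₁.mul h₂
  | inv _ h0 h => exact h.inv fun z hz => h0 _ (hΩ z hz)
  | congr _ he h => exact h.congr fun z hz => he _ (hΩ z hz)

theorem mono (hf : RegularOn Ω f) (h : Ω' ⊆ Ω) : RegularOn Ω' f := by
  induction hf with
  | const c => exact .const c
  | coord j => exact .coord j
  | add _ _ h₁ h₂ => exact h₁.add h₂
  | mul _ _ h₁ h₂ => exact h₁.mul h₂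
  | inv _ h0 h' => exact h'.inv fun z hz => h0 _ (h hz)
  | congr _ he h' => exact h'.congr fun z hz => he _ (h hz)

/-- The divided difference with respect to one coordinate is regular. -/
theorem exists_divided_difference [DecidableEq ι] (hf : RegularOn Ω f) {i : ι} {s : (ι → ℂ) → ℂ}
    (hs : RegularOn Ω s) (hΩ : ∀ z ∈ Ω, Function.update z i (s z) ∈ Ω) :
    ∃ g, RegularOn Ω g ∧ ∀ z ∈ Ω, f z = f (Function.update z i (s z)) + (z i - s z) * g z := by
  induction hf with
  | const c => exact ⟨_, .const 0, fun z _ => by ring⟩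
  | coord j =>
    by_cases hj : j = i
    · subst hj
      exact ⟨_, .const 1, fun z _ => by simp⟩
    · exact ⟨_, .const 0, fun z _ => by simp [Function.update_of_ne hj]⟩
  | add _ _ h₁ h₂ =>
    obtain ⟨g₁, hg₁, e₁⟩ := h₁
    obtain ⟨g₂, hg₂, e₂⟩ := h₂
    refine ⟨_, hg₁.add hg₂, fun z hz => ?_⟩
    simp only
    rw [e₁ z hz, e₂ z hz]
    ring
  | @mul f g h₁' h₂' h₁ h₂ =>
    obtain ⟨g₁, hg₁, e₁⟩ := h₁
    obtain ⟨g₂, hg₂, e₂⟩ := h₂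
    -- The Leibniz rule: with a tilde for the substituted value, fg - f̃g̃ = f(g - g̃) + (f - f̃)g̃.
    refine ⟨_, (h₁'.mul hg₂).add (hg₁.mul (h₂'.comp_update hs hΩ)), fun z hz => ?_⟩
    simp only
    linear_combination g (Function.update z i (s z)) * e₁ z hz + f z * e₂ z hz
  | inv h' h0 h =>
    obtain ⟨g, hg, e⟩ := h
    -- The quotient rule: 1/f - 1/f̃ = -(f - f̃)/(f f̃).
    refine ⟨_, (hg.mul ((h'.inv h0).mul ((h'.comp_update hs hΩ).inv fun z hz =>
      h0 _ (hΩ z hz)))).neg, fun z hz => ?_⟩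
    have h1 := h0 z hz
    have h2 := h0 _ (hΩ z hz)
    have h3 := e z hz
    simp only
    field_simp
    linear_combination -h3
  | congr _ he h =>
    obtain ⟨g, hg, e⟩ := h
    exact ⟨g, hg, fun z hz => by rw [← he z hz, ← he _ (hΩ z hz), e z hz]⟩

/-- As a function of one coordinate, a regular function is a quotient of polynomials. -/
theorem exists_polynomial [DecidableEq ι] (hf : RegularOn Ω f) {i : ι} {z : ι → ℂ} {W : Set ℂ}
    (hΩ : ∀ w ∈ W, Function.update z i w ∈ Ω) :
    ∃ P Q : ℂ[X], ∀ w ∈ W, Q.eval w ≠ 0 ∧ f (Function.update z i w) = P.eval w / Q.eval w := by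
  induction hf with
  | const c => exact ⟨C c, 1, fun w _ => by simp⟩
  | coord j =>
    by_cases hj : j = i
    · subst hj
      exact ⟨X, 1, fun w _ => by simp⟩
    · exact ⟨C (z j), 1, fun w _ => by simp [Function.update_of_ne hj]⟩
  | add _ _ h₁ h₂ =>
    obtain ⟨P₁, Q₁, e₁⟩ := h₁
    obtain ⟨P₂, Q₂, e₂⟩ := h₂
    refine ⟨P₁ * Q₂ + Q₁ * P₂, Q₁ * Q₂, fun w hw => ?_⟩
    have h1 := e₁ w hw
    have h2 := e₂ w hw
    refine ⟨by simpa using ⟨h1.1, h2.1⟩, ?_⟩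
    simp only
    rw [h1.2, h2.2, div_add_div _ _ h1.1 h2.1]
    simp
  | mul _ _ h₁ h₂ =>
    obtain ⟨P₁, Q₁, e₁⟩ := h₁
    obtain ⟨P₂, Q₂, e₂⟩ := h₂
    refine ⟨P₁ * P₂, Q₁ * Q₂, fun w hw => ?_⟩
    have h1 := e₁ w hw
    have h2 := e₂ w hw
    refine ⟨by simpa using ⟨h1.1, h2.1⟩, ?_⟩
    simp only
    rw [h1.2, h2.2, div_mul_div_comm]
    simp
  | inv _ h0 h =>
    obtain ⟨P, Q, e⟩ := h
    refine ⟨Q, P, fun w hw => ?_⟩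
    have h1 := e w hw
    have h2 := h0 _ (hΩ w hw)
    simp only
    rw [h1.2] at h2 ⊢
    exact ⟨fun h => h2 (by simp [h]), by rw [inv_div]⟩
  | congr _ he h =>
    obtain ⟨P, Q, e⟩ := h
    exact ⟨P, Q, fun w hw => ⟨(e w hw).1, by rw [← he _ (hΩ w hw), (e w hw).2]⟩⟩

/-- Cauchy's theorem in algebraic form: in one coordinate the function is a quotient of polynomials
without pole in W, and the contour winds around nothing outside W. -/
theorem integral_eq_zero [DecidableEq ι] (hf : RegularOn Ω f) {i : ι} {z : ι → ℂ} {W : Set ℂ}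
    (hΩ : ∀ w ∈ W, Function.update z i w ∈ Ω) {Γ : Contour} (hΓ : ∀ p ∉ W, Γ.HasIndex p 0) :
    Γ.integral (fun w => f (Function.update z i w)) = 0 := by
  obtain ⟨P, Q, e⟩ := hf.exists_polynomial hΩ
  rw [← Contour.integral_rational hΓ P Q fun w hw => (e w hw).1]
  refine Contour.integral_congr fun w hw => (e w ?_).2
  by_contra h
  exact (hΓ w h).1 hw

theorem continuousOn [DecidableEq ι] (hf : RegularOn Ω f) {i : ι} {z : ι → ℂ} {W : Set ℂ}
    (hΩ : ∀ w ∈ W, Function.update z i w ∈ Ω) :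
    ContinuousOn (fun w => f (Function.update z i w)) W := by
  obtain ⟨P, Q, e⟩ := hf.exists_polynomial hΩ
  exact (P.continuousOn.div Q.continuousOn fun w hw => (e w hw).1).congr fun w hw => (e w hw).2

end RegularOn

theorem Contour.support_subset {Γ : Contour} {W : Set ℂ} (hΓ : ∀ p ∉ W, Γ.HasIndex p 0) :
    Γ.support ⊆ W := fun w hw => by
  by_contra h
  exact (hΓ w h).1 hw

/-- Cauchy's integral formula: the divided difference at p splits the integrand into a constant
times 1/(w - p) and a regular function, whose integral is 0. -/
theorem RegularOn.integral_div {ι : Type*} [DecidableEq ι] {Ω : Set (ι → ℂ)} {f : (ι → ℂ) → ℂ}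
    (hf : RegularOn Ω f) {i : ι} {z : ι → ℂ} {W : Set ℂ}
    (hΩ : ∀ w ∈ W, Function.update z i w ∈ Ω) {Γ : Contour} (hΓ : ∀ p ∉ W, Γ.HasIndex p 0)
    {p : ℂ} (hpW : p ∈ W) (hp : Γ.HasIndex p 1) :
    Γ.integral (fun w => f (Function.update z i w) / (w - p)) =
      2 * (Real.pi : ℂ) * Complex.I * f (Function.update z i p) := by
  have hsub := Contour.support_subset hΓ
  -- Ω need not be stable under setting the coordinate to p; the slice over W through z is.
  set Ω₁ : Set (ι → ℂ) := {y | ∃ w ∈ W, y = Function.update z i w}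
  have hmem : ∀ w ∈ W, Function.update z i w ∈ Ω₁ := fun w hw => ⟨w, hw, rfl⟩
  have hf₁ : RegularOn Ω₁ f := hf.mono <| by
    rintro _ ⟨w, hw, rfl⟩
    exact hΩ w hw
  obtain ⟨g, hg, e⟩ := hf₁.exists_divided_difference (i := i) (.const p) <| by
    rintro _ ⟨w, hw, rfl⟩
    rw [Function.update_idem]
    exact hmem p hpW
  have key : ∀ w ∈ Γ.support, f (Function.update z i w) / (w - p) =
      f (Function.update z i p) * (w - p)⁻¹ + g (Function.update z i w) := by
    intro w hw
    have h1 := e _ (hmem w (hsub hw))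
    have h2 := hp.sub_ne_zero hw
    rw [Function.update_idem, Function.update_self] at h1
    rw [h1]
    field_simp
  rw [Contour.integral_congr key, Contour.integral_add
    (continuousOn_const.fun_mul (ContinuousOn.fun_inv₀ (by fun_prop) fun w hw => hp.sub_ne_zero hw))
    ((hg.continuousOn hmem).mono hsub), Contour.integral_const_mul, hp.integral,
    hg.integral_eq_zero hmem hΓ]
  push_cast
  ring

/-- Integration of one coordinate over a contour that surrounds given nodes: the result does not
depend on the contour and is regular in the other coordinates. -/
theorem RegularOn.exists_residue {ι : Type*} [DecidableEq ι] {Ω Ω' : Set (ι → ℂ)} {i : ι}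
    {W : Set ℂ} (hΩ : ∀ z ∈ Ω', ∀ w ∈ W, Function.update z i w ∈ Ω) (hΩ' : Ω ⊆ Ω')
    (L : List ((ι → ℂ) → ℂ)) (hL : ∀ s ∈ L, RegularOn Ω' s ∧ (∀ z ∈ Ω', s z ∈ W) ∧
      ∀ z w, s (Function.update z i w) = s z) (f : (ι → ℂ) → ℂ) (hf : RegularOn Ω f) :
    ∃ F, RegularOn Ω' F ∧ ∀ z ∈ Ω', ∀ Γ : Contour, (∀ p ∉ W, Γ.HasIndex p 0) →
      (∀ s ∈ L, Γ.HasIndex (s z) 1) →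
      Γ.integral (fun w => f (Function.update z i w) *
        (((Multiset.ofList (L.map fun s => s z)).map fun p => w - p).prod)⁻¹) = F z := by
  induction L generalizing f with
  | nil =>
    refine ⟨_, .const 0, fun z hz Γ hΓ _ => ?_⟩
    simpa using hf.integral_eq_zero (hΩ z hz) hΓ
  | cons s L ih =>
    obtain ⟨hs, hsW, hsi⟩ := hL s List.mem_cons_self
    have hsub : ∀ z ∈ Ω', Function.update z i (s z) ∈ Ω := fun z hz => hΩ z hz _ (hsW z hz)
    -- Newton's scheme: f = f(s) + (w - s) g cancels the node s in the second term. Nodes are never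
    -- compared with each other, so they may coincide.
    obtain ⟨g, hg, e⟩ := hf.exists_divided_difference (hs.mono hΩ') fun z hz => hsub z (hΩ' hz)
    obtain ⟨G, hG, eG⟩ := ih (fun t ht => hL t (List.mem_cons_of_mem s ht)) g hg
    -- The integral of 1/∏(w - p) over nodes of index 1 is 2πi for a single node and 0 for more,
    -- hence the case distinction on the length of the remaining list.
    refine ⟨_, (((hf.comp_update hs hsub).mul
      (.const (if L.length = 0 then 2 * (Real.pi : ℂ) * Complex.I else 0))).add hG),
      fun z hz Γ hΓ hΓL => ?_⟩
    have hΓs := hΓL s List.mem_cons_self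
    have hΓL' : ∀ t ∈ L, Γ.HasIndex (t z) 1 := fun t ht => hΓL t (List.mem_cons_of_mem s ht)
    have hall : ∀ p ∈ Multiset.ofList ((s :: L).map fun s => s z), Γ.HasIndex p 1 := by
      intro p hp
      obtain ⟨t, ht, rfl⟩ := List.mem_map.1 (Multiset.mem_coe.1 hp)
      exact hΓL t ht
    have hall' : ∀ p ∈ Multiset.ofList (L.map fun s => s z), Γ.HasIndex p 1 := by
      intro p hp
      obtain ⟨t, ht, rfl⟩ := List.mem_map.1 (Multiset.mem_coe.1 hp)
      exact hΓL' t ht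
    have hsupp := Contour.support_subset hΓ
    have hone := Contour.integral_inv_prod 1 _ hall
    have key : ∀ w ∈ Γ.support, f (Function.update z i w) *
        (((Multiset.ofList ((s :: L).map fun s => s z)).map fun p => w - p).prod)⁻¹ =
        f (Function.update z i (s z)) *
          (((Multiset.ofList ((s :: L).map fun s => s z)).map fun p => w - p).prod)⁻¹ +
        g (Function.update z i w) *
          (((Multiset.ofList (L.map fun s => s z)).map fun p => w - p).prod)⁻¹ := by
      intro w hw
      have h1 := e _ (hΩ z hz w (hsupp hw))
      have h2 := hΓs.sub_ne_zero hw
      rw [hsi, Function.update_idem, Function.update_self] at h1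
      rw [h1, List.map_cons, ← Multiset.cons_coe, Multiset.map_cons, Multiset.prod_cons, mul_inv]
      field_simp
    rw [Contour.integral_congr key, Contour.integral_add
      (continuousOn_const.fun_mul (Contour.continuousOn_inv_prod fun y hy => (hall y hy).1))
      (((hg.continuousOn (hΩ z hz)).mono hsupp).fun_mul
        (Contour.continuousOn_inv_prod fun y hy => (hall' y hy).1)),
      Contour.integral_const_mul, hone, eG z hz Γ hΓ hΓL']
    simp

end

end XXXChain

namespace XXXChain

noncomputable section

/-! ### The integrand as a product over the variables -/

/-- The region of the variable `z_k`: `U` for even `k`, `U - η` for odd `k`. -/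
def region (η : ℂ) (U : Set ℂ) (k : ℕ) : Set ℂ := {p | (if Even k then p else p + η) ∈ U}

/-- The values of the variables `z_k`, `i < k`, that lie in their regions. -/
def outerDomain (η : ℂ) (m : ℕ) (ε : ℕ → Fin 2) (U : Set ℂ) (i : ℕ) : Set (ℕ → ℂ) :=
  {z | ∀ k ∈ Finset.Ioc i (2 * m), ε k = 0 → z k ∈ region η U k}

/-- The conditions on the region `U` in a contour system. -/
structure IsRegion {N R : ℕ} (ξ : Fin N → ℂ) (η : ℂ) (q : Fin R → ℂ) (lam : ℕ → ℂ) (m : ℕ)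
    (U : Set ℂ) : Prop where
  xi_mem : ∀ n, ξ n ∈ U
  disjoint_shift : ∀ p ∈ U, p + η ∉ U
  lam_notMem : ∀ j ∈ Finset.Icc 1 m, lam j ∉ U ∧ lam j + η ∉ U
  q_notMem : ∀ k, q k ∉ U ∧ q k + η ∉ U

/-- The factor of the integrand that depends on `z_i` alone. -/
def singleFactor {N R : ℕ} (ξ : Fin N → ℂ) (η : ℂ) (q : Fin R → ℂ) (lam : ℕ → ℂ) (h : Config N)
    (i : ℕ) (z : ℂ) : ℂ :=
  if Even i then evenFactor ξ η q lam h (i / 2) z else oddFactor ξ η q lam h ((i + 1) / 2) z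

/-- The factors of the integrand that depend on `z_j` and on variables outside of it. -/
def variableFactor {N R : ℕ} (ξ : Fin N → ℂ) (η : ℂ) (q : Fin R → ℂ) (lam : ℕ → ℂ) (m : ℕ)
    (ε : ℕ → Fin 2) (h : Config N) (j : ℕ) (z : ℕ → ℂ) : ℂ :=
  if ε j = 0 then
    singleFactor ξ η q lam h j (z j) * ∏ k ∈ Finset.Ioc j (2 * m),
      if ε k = 0 then (z j - z k) / (z j - z k + (-1) ^ k * η) else 1
  else 1

/-- The product of the factors that depend on one of the variables `z_1, …, z_i`. -/
def innerIntegrand {N R : ℕ} (ξ : Fin N → ℂ) (η : ℂ) (q : Fin R → ℂ) (lam : ℕ → ℂ) (m : ℕ)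
    (ε : ℕ → Fin 2) (h : Config N) (i : ℕ) (z : ℕ → ℂ) : ℂ :=
  ∏ j ∈ Finset.Icc 1 i, variableFactor ξ η q lam m ε h j z

theorem prod_Icc_two_mul (m : ℕ) (f : ℕ → ℂ) :
    ∏ i ∈ Finset.Icc 1 (2 * m), f i = ∏ j ∈ Finset.Icc 1 m, f (2 * j) * f (2 * j - 1) := by
  induction m with
  | zero => simp
  | succ m ih =>
    rw [Finset.prod_Icc_succ_top (by omega), ← ih, show 2 * (m + 1) = 2 * m + 1 + 1 by ring,
      Finset.prod_Icc_succ_top (by omega), Finset.prod_Icc_succ_top (by omega)]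
    simp only [Nat.add_sub_cancel]
    ring

/-- Each cross factor is attributed to its variable of smaller index, the inner one. Thus a factor
of z_j depends on z_j and outer variables only, which suits iterated integration. -/
theorem integrand_eq_innerIntegrand {N R : ℕ} (ξ : Fin N → ℂ) (η : ℂ) (q : Fin R → ℂ)
    (lam : ℕ → ℂ) (m : ℕ) (ε : ℕ → Fin 2) (h : Config N) :
    integrand ξ η q lam m ε h = innerIntegrand ξ η q lam m ε h (2 * m) := by
  funext z
  have h1 : ∏ j ∈ Finset.Icc 1 m,
      (if ε (2 * j) = 0 then evenFactor ξ η q lam h j (z (2 * j)) else 1) *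
      (if ε (2 * j - 1) = 0 then oddFactor ξ η q lam h j (z (2 * j - 1)) else 1) =
      ∏ i ∈ Finset.Icc 1 (2 * m),
        if ε i = 0 then singleFactor ξ η q lam h i (z i) else 1 := by
    rw [prod_Icc_two_mul]
    refine Finset.prod_congr rfl fun j hj => ?_
    have hj := (Finset.mem_Icc.1 hj).1
    have e1 : Even (2 * j) := even_two_mul j
    have e2 : ¬ Even (2 * j - 1) := by
      rw [Nat.not_even_iff_odd]
      exact ⟨j - 1, by omega⟩
    have e3 : (2 * j - 1 + 1) / 2 = j := by omega
    have e4 : 2 * j / 2 = j := by omega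
    simp only [singleFactor, e1, e2, e3, e4, if_true, if_false]
  have h2 : crossFactor η m ε z = ∏ j ∈ Finset.Icc 1 (2 * m), ∏ k ∈ Finset.Ioc j (2 * m),
      if ε j = 0 ∧ ε k = 0 then (z j - z k) / (z j - z k + (-1) ^ k * η) else 1 := by
    unfold crossFactor
    refine Finset.prod_comm' fun k j => ?_
    simp only [Finset.mem_Icc, Finset.mem_Ico, Finset.mem_Ioc]
    omega
  unfold integrand innerIntegrand
  rw [h1, h2, ← Finset.prod_mul_distrib]
  refine Finset.prod_congr rfl fun j _ => ?_
  unfold variableFactor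
  by_cases hj : ε j = 0
  · simp [hj]
  · simp [hj]

theorem innerIntegrand_succ {N R : ℕ} (ξ : Fin N → ℂ) (η : ℂ) (q : Fin R → ℂ)
    (lam : ℕ → ℂ) (m : ℕ) (ε : ℕ → Fin 2) (h : Config N) (i : ℕ) :
    innerIntegrand ξ η q lam m ε h (i + 1) = fun z =>
      variableFactor ξ η q lam m ε h (i + 1) z * innerIntegrand ξ η q lam m ε h i z := by
  funext z
  unfold innerIntegrand
  rw [Finset.prod_Icc_succ_top (by omega), mul_comm]

/-! ### Iterated integrals -/

theorem iteratedIntegral_mul (ε : ℕ → Fin 2) (Γ : ℕ → (ℕ → ℂ) → Contour) (c f : (ℕ → ℂ) → ℂ)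
    (i : ℕ) (hc : ∀ z, ∀ j ≤ i, ∀ w, c (Function.update z j w) = c z) (z : ℕ → ℂ) :
    iteratedIntegral ε Γ (fun z => c z * f z) i z = c z * iteratedIntegral ε Γ f i z := by
  induction i generalizing z with
  | zero => rfl
  | succ i ih =>
    have hc' : ∀ z, ∀ j ≤ i, ∀ w, c (Function.update z j w) = c z :=
      fun z j hj => hc z j (by omega)
    unfold iteratedIntegral
    split_ifs with h0
    · simp only [ih hc', hc _ (i + 1) le_rfl, Contour.integral_const_mul]
    · exact ih hc' z

theorem variableFactor_update {N R : ℕ} (ξ : Fin N → ℂ) (η : ℂ) (q : Fin R → ℂ) (lam : ℕ → ℂ)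
    (m : ℕ) (ε : ℕ → Fin 2) (h : Config N) {i j : ℕ} (hj : j < i) (z : ℕ → ℂ) (w : ℂ) :
    variableFactor ξ η q lam m ε h i (Function.update z j w) =
      variableFactor ξ η q lam m ε h i z := by
  unfold variableFactor
  rw [Function.update_of_ne (by omega)]
  split_ifs with h0
  · refine congrArg _ (Finset.prod_congr rfl fun k hk => ?_)
    rw [Function.update_of_ne (by have := (Finset.mem_Ioc.1 hk).1; omega)]
  · rfl

/-- The factor attributed to the outermost integrated variable contains no inner variable, so it can
be taken out of the inner integrals. -/
theorem iteratedIntegral_innerIntegrand_succ {N R : ℕ} (ξ : Fin N → ℂ) (η : ℂ) (q : Fin R → ℂ)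
    (lam : ℕ → ℂ) (m : ℕ) (ε : ℕ → Fin 2) (h : Config N) (Γ : ℕ → (ℕ → ℂ) → Contour) {i : ℕ}
    (hi : ε (i + 1) = 0) (z : ℕ → ℂ) :
    iteratedIntegral ε Γ (innerIntegrand ξ η q lam m ε h (i + 1)) (i + 1) z =
      (Γ (i + 1) z).integral fun w =>
        variableFactor ξ η q lam m ε h (i + 1) (Function.update z (i + 1) w) *
          iteratedIntegral ε Γ (innerIntegrand ξ η q lam m ε h i) i
            (Function.update z (i + 1) w) := by
  rw [iteratedIntegral, if_pos hi, innerIntegrand_succ]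
  refine Contour.integral_congr fun w _ => ?_
  exact iteratedIntegral_mul _ _ _ _ _
    (fun z j hj w => variableFactor_update ξ η q lam m ε h (by omega) z w) _

theorem iteratedIntegral_innerIntegrand_of_absent {N R : ℕ} (ξ : Fin N → ℂ) (η : ℂ)
    (q : Fin R → ℂ) (lam : ℕ → ℂ) (m : ℕ) (ε : ℕ → Fin 2) (h : Config N)
    (Γ : ℕ → (ℕ → ℂ) → Contour) {i : ℕ} (hi : ε (i + 1) ≠ 0) (z : ℕ → ℂ) :
    iteratedIntegral ε Γ (innerIntegrand ξ η q lam m ε h (i + 1)) (i + 1) z =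
      iteratedIntegral ε Γ (innerIntegrand ξ η q lam m ε h i) i z := by
  rw [iteratedIntegral, if_neg hi, innerIntegrand_succ]
  simp only [variableFactor, if_neg hi, one_mul]

/-! ### Poles of the factors -/

/-- The points that the contour of `z_j` surrounds, as functions of the outer variables. -/
def IsNode {N : ℕ} (ξ : Fin N → ℂ) (η : ℂ) (m : ℕ) (ε : ℕ → Fin 2) (j : ℕ)
    (s : (ℕ → ℂ) → ℂ) : Prop :=
  (∃ n, s = fun _ => if Even j then ξ n else ξ n - η) ∨
  ∃ k ∈ Finset.Ioc j (2 * m), ε k = 0 ∧ (Even k ↔ ¬ Even j) ∧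
    s = fun z => if Even j then z k + η else z k - η

/-- `c` is a regular function divided by a product of `z_j - s`, for nodes `s`. -/
def HasNodes {N : ℕ} (ξ : Fin N → ℂ) (η : ℂ) (m : ℕ) (ε : ℕ → Fin 2) (Ω : Set (ℕ → ℂ)) (j : ℕ)
    (c : (ℕ → ℂ) → ℂ) : Prop :=
  ∃ (e : (ℕ → ℂ) → ℂ) (L : List ((ℕ → ℂ) → ℂ)), (∀ s ∈ L, IsNode ξ η m ε j s) ∧
    RegularOn Ω e ∧ ∀ z ∈ Ω, c z =
      e z * (((Multiset.ofList (L.map fun s => s z)).map fun p => z j - p).prod)⁻¹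

section Nodes

variable {N R : ℕ} {ξ : Fin N → ℂ} {η : ℂ} {q : Fin R → ℂ} {lam : ℕ → ℂ} {m : ℕ}
  {ε : ℕ → Fin 2} {Ω : Set (ℕ → ℂ)} {U : Set ℂ} {i j : ℕ} {c d : (ℕ → ℂ) → ℂ}

theorem RegularOn.hasNodes (hc : RegularOn Ω c) : HasNodes ξ η m ε Ω j c :=
  ⟨c, [], by simp, hc, by simp⟩

theorem IsNode.hasNodes_inv {s : (ℕ → ℂ) → ℂ} (hs : IsNode ξ η m ε j s) :
    HasNodes ξ η m ε Ω j fun z => (z j - s z)⁻¹ :=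
  ⟨_, [s], by simpa using hs, .const 1, by simp⟩

theorem HasNodes.mul (hc : HasNodes ξ η m ε Ω j c) (hd : HasNodes ξ η m ε Ω j d) :
    HasNodes ξ η m ε Ω j fun z => c z * d z := by
  obtain ⟨e₁, L₁, hL₁, he₁, h₁⟩ := hc
  obtain ⟨e₂, L₂, hL₂, he₂, h₂⟩ := hd
  refine ⟨_, L₁ ++ L₂, fun s hs => ?_, he₁.mul he₂, fun z hz => ?_⟩
  · rcases List.mem_append.1 hs with hs | hs
    exacts [hL₁ s hs, hL₂ s hs]
  · simp only
    rw [h₁ z hz, h₂ z hz, List.map_append, ← Multiset.coe_add, Multiset.map_add,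
      Multiset.prod_add, mul_inv]
    ring

theorem HasNodes.congr (hc : HasNodes ξ η m ε Ω j c) (h : ∀ z ∈ Ω, c z = d z) :
    HasNodes ξ η m ε Ω j d := by
  obtain ⟨e₁, L₁, hL₁, he₁, h₁⟩ := hc
  exact ⟨e₁, L₁, hL₁, he₁, fun z hz => by rw [← h z hz, h₁ z hz]⟩

theorem HasNodes.prod {κ : Type*} (s : Finset κ) {F : κ → (ℕ → ℂ) → ℂ}
    (h : ∀ k ∈ s, HasNodes ξ η m ε Ω j (F k)) :
    HasNodes ξ η m ε Ω j fun z => ∏ k ∈ s, F k z := by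
  classical
  induction s using Finset.induction_on with
  | empty => simpa using (RegularOn.const 1).hasNodes
  | insert a s ha ih =>
    simp only [Finset.prod_insert ha]
    exact (h a (Finset.mem_insert_self a s)).mul
      (ih fun k hk => h k (Finset.mem_insert_of_mem hk))

theorem update_mem_outerDomain {z : ℕ → ℂ} (hz : z ∈ outerDomain η m ε U (i + 1)) {w : ℂ}
    (hw : w ∈ region η U (i + 1)) :
    Function.update z (i + 1) w ∈ outerDomain η m ε U i := by
  intro k hk h0
  by_cases hki : k = i + 1
  · subst hki
    simpa using hw
  · rw [Function.update_of_ne hki]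
    refine hz k ?_ h0
    rw [Finset.mem_Ioc] at hk ⊢
    omega

theorem outerDomain_mono : outerDomain η m ε U i ⊆ outerDomain η m ε U (i + 1) := by
  intro z hz k hk h0
  refine hz k ?_ h0
  rw [Finset.mem_Ioc] at hk ⊢
  omega

theorem outerDomain_subset_of_absent (h0 : ε (i + 1) ≠ 0) :
    outerDomain η m ε U (i + 1) ⊆ outerDomain η m ε U i := by
  intro z hz k hk hk0
  refine hz k ?_ hk0
  have : k ≠ i + 1 := fun h => h0 (h ▸ hk0)
  rw [Finset.mem_Ioc] at hk ⊢
  omega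

theorem IsNode.regularOn {s : (ℕ → ℂ) → ℂ} (hs : IsNode ξ η m ε j s) : RegularOn Ω s := by
  rcases hs with ⟨n, rfl⟩ | ⟨k, -, -, -, rfl⟩
  · exact .const _
  · split_ifs
    · exact (RegularOn.coord k).add (.const η)
    · exact (RegularOn.coord k).sub (.const η)

theorem IsNode.mem_region (hU : IsRegion ξ η q lam m U) {s : (ℕ → ℂ) → ℂ}
    (hs : IsNode ξ η m ε j s) {z : ℕ → ℂ} (hz : z ∈ outerDomain η m ε U j) :
    s z ∈ region η U j := by
  rcases hs with ⟨n, rfl⟩ | ⟨k, hk, h0, hp, rfl⟩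
  · have := hU.xi_mem n
    by_cases hj : Even j <;> simpa [region, hj] using this
  · have := hz k hk h0
    by_cases hj : Even j <;> simpa [region, hj, hp] using this

theorem IsNode.update {s : (ℕ → ℂ) → ℂ} (hs : IsNode ξ η m ε j s) (z : ℕ → ℂ) (w : ℂ) :
    s (Function.update z j w) = s z := by
  rcases hs with ⟨n, rfl⟩ | ⟨k, hk, -, -, rfl⟩
  · rfl
  · simp only [Function.update_of_ne (show k ≠ j by have := (Finset.mem_Ioc.1 hk).1; omega)]

theorem Surrounds.hasIndex_node {z : ℕ → ℂ} {C : Contour} (hC : Surrounds ξ η m ε U j z C)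
    {s : (ℕ → ℂ) → ℂ} (hs : IsNode ξ η m ε j s) : C.HasIndex (s z) 1 := by
  unfold Surrounds at hC
  rcases hs with ⟨n, rfl⟩ | ⟨k, hk, h0, hp, rfl⟩
  · by_cases hj : Even j
    · simpa [hj] using (if_pos hj ▸ hC).1 n
    · simpa [hj] using (if_neg hj ▸ hC).1 n
  · by_cases hj : Even j
    · have hk' : Odd k := by rw [← Nat.not_even_iff_odd, hp]; simpa using hj
      simpa [hj] using (if_pos hj ▸ hC).2.1 k hk hk' h0
    · simpa [hj] using (if_neg hj ▸ hC).2.1 k hk (hp.2 hj) h0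

theorem Surrounds.hasIndex_of_notMem {z : ℕ → ℂ} {C : Contour}
    (hC : Surrounds ξ η m ε U j z C) {p : ℂ} (hp : p ∉ region η U j) : C.HasIndex p 0 := by
  unfold Surrounds at hC
  by_cases hj : Even j
  · exact (if_pos hj ▸ hC).2.2 p (by simpa [region, hj] using hp)
  · exact (if_neg hj ▸ hC).2.2 p (by simpa [region, hj] using hp)

theorem ne_of_mem_of_notMem {z p : ℂ} {W : Set ℂ} (hz : z ∈ W) (hp : p ∉ W) : z - p ≠ 0 :=
  fun h => hp (by rwa [← sub_eq_zero.1 h])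

theorem fin_two_eq_one {a : Fin 2} (h : a ≠ 0) : a = 1 := by omega

/-- The value h_n selects ξ_n or ξ_n - η, and since U and U - η are disjoint, the region of z_j
contains exactly one of these two. So a zero of d_𝐡 is either a point to be surrounded or harmless.
-/
theorem isNode_or_xiShift_notMem (hU : IsRegion ξ η q lam m U) (h : Config N) (j : ℕ)
    (n : Fin N) :
    IsNode ξ η m ε j (fun _ => xiShift ξ η h n) ∨ xiShift ξ η h n ∉ region η U j := by
  have h1 := hU.xi_mem n
  have h2 := hU.disjoint_shift (ξ n) h1
  have h3 : ξ n - η ∉ U := fun h => hU.disjoint_shift _ h (by simpa using h1)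
  by_cases hj : Even j
  · by_cases hn : h n = 0
    · exact Or.inl (Or.inl ⟨n, by simp [xiShift, hn, hj]⟩)
    · exact Or.inr (by simpa [xiShift, fin_two_eq_one hn, hj, region] using h3)
  · by_cases hn : h n = 0
    · exact Or.inr (by simpa [xiShift, hn, hj, region] using h2)
    · exact Or.inl (Or.inl ⟨n, by simp [xiShift, fin_two_eq_one hn, hj]⟩)

theorem IsRegion.lam_notMem_region (hU : IsRegion ξ η q lam m U) {k : ℕ}
    (hk : k ∈ Finset.Icc 1 m) (j : ℕ) : lam k ∉ region η U j := by
  have := hU.lam_notMem k hk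
  by_cases hj : Even j
  · simpa [region, hj] using this.1
  · simpa [region, hj] using this.2

theorem IsRegion.q_notMem_region (hU : IsRegion ξ η q lam m U) (k : Fin R) (j : ℕ) :
    q k ∉ region η U j := by
  have := hU.q_notMem k
  by_cases hj : Even j
  · simpa [region, hj] using this.1
  · simpa [region, hj] using this.2

end Nodes

/-- The part of `singleFactor` that is regular in the region of the contour. -/
def restFactor {R : ℕ} (η : ℂ) (q : Fin R → ℂ) (lam : ℕ → ℂ) (i : ℕ) (z : ℂ) : ℂ :=
  if Even i then
    -(1 / (2 * (Real.pi : ℂ) * Complex.I * (lam (i / 2) - z)) * (funQ q (z - η) / funQ q z) *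
      ∏ k ∈ Finset.Ico 1 (i / 2), (z - lam k - η) / (z - lam k))
  else
    1 / (2 * (Real.pi : ℂ) * Complex.I * (lam ((i + 1) / 2) - z)) * (funQ q (z + η) / funQ q z) *
      ∏ k ∈ Finset.Ico 1 ((i + 1) / 2), (z - lam k + η) / (z - lam k)

/-- The numerator `a(z)` or `d(z)` of `singleFactor`. -/
def numFactor {N : ℕ} (ξ : Fin N → ℂ) (η : ℂ) (i : ℕ) (z : ℂ) : ℂ :=
  if Even i then funA ξ η z else funD ξ z

theorem singleFactor_eq {N R : ℕ} (ξ : Fin N → ℂ) (η : ℂ) (q : Fin R → ℂ) (lam : ℕ → ℂ)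
    (h : Config N) (i : ℕ) (z : ℂ) : singleFactor ξ η q lam h i z =
      restFactor η q lam i z * numFactor ξ η i z * (funDh ξ η h z)⁻¹ := by
  unfold singleFactor restFactor numFactor evenFactor oddFactor
  split_ifs <;> ring

section Factors

variable {N R : ℕ} {ξ : Fin N → ℂ} {η : ℂ} {q : Fin R → ℂ} {lam : ℕ → ℂ} {m : ℕ}
  {ε : ℕ → Fin 2} {Ω : Set (ℕ → ℂ)} {U : Set ℂ} {i j : ℕ}

theorem regularOn_funQ (c : ℂ) (j : ℕ) : RegularOn Ω fun z => funQ q (z j + c) :=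
  RegularOn.prod _ fun _ _ => ((RegularOn.coord j).add (.const c)).sub (.const _)

theorem regularOn_numFactor (j : ℕ) : RegularOn Ω fun z => numFactor ξ η j (z j) := by
  unfold numFactor
  split_ifs
  · exact RegularOn.prod _ fun n _ => ((RegularOn.coord j).sub (.const _)).add (.const η)
  · exact RegularOn.prod _ fun n _ => (RegularOn.coord j).sub (.const _)

/-- The only possible poles are at the λ_k and q_k, which both regions avoid. The bound on j keeps
the indices of the λ_k in the range 1, …, m. -/
theorem regularOn_restFactor (hU : IsRegion ξ η q lam m U) (hj : j ∈ Finset.Icc 1 (2 * m))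
    (hΩ : ∀ z ∈ Ω, z j ∈ region η U j) : RegularOn Ω fun z => restFactor η q lam j (z j) := by
  rw [Finset.mem_Icc] at hj
  have hlam : ∀ k ∈ Finset.Icc 1 m, RegularOn Ω fun z => (z j - lam k)⁻¹ := fun k hk =>
    ((RegularOn.coord j).sub (.const _)).inv fun z hz =>
      ne_of_mem_of_notMem (hΩ z hz) (hU.lam_notMem_region hk j)
  have hden : RegularOn Ω fun z => (funQ q (z j))⁻¹ := by
    refine RegularOn.inv (by simpa using regularOn_funQ (q := q) 0 j) fun z hz => ?_
    exact Finset.prod_ne_zero_iff.2 fun k _ =>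
      ne_of_mem_of_notMem (hΩ z hz) (hU.q_notMem_region k j)
  have hpole : ∀ k ∈ Finset.Icc 1 m, RegularOn Ω fun z =>
      1 / (2 * (Real.pi : ℂ) * Complex.I * (lam k - z j)) := fun k hk =>
    ((RegularOn.const (-(2 * (Real.pi : ℂ) * Complex.I)⁻¹)).mul (hlam k hk)).congr fun z _ => by
      rw [one_div, ← neg_sub (z j) (lam k), mul_neg, inv_neg, mul_inv (_ * Complex.I)]
      ring
  have hprod : ∀ (l : ℕ) (c : ℂ), l ≤ m → RegularOn Ω fun z =>
      ∏ k ∈ Finset.Ico 1 l, (z j - lam k + c) / (z j - lam k) := fun l c hl =>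
    RegularOn.prod _ fun k hk => by
      simp only [div_eq_mul_inv]
      rw [Finset.mem_Ico] at hk
      exact (((RegularOn.coord j).sub (.const _)).add (.const c)).mul
        (hlam k (Finset.mem_Icc.2 (by omega)))
  unfold restFactor
  split_ifs with he
  · obtain ⟨l, hl⟩ := he
    simp only [div_eq_mul_inv (funQ q _), sub_eq_add_neg _ η]
    exact (((hpole _ (Finset.mem_Icc.2 (by omega))).mul ((regularOn_funQ (-η) j).mul hden)).mul
      (hprod _ (-η) (by omega))).neg
  · simp only [div_eq_mul_inv (funQ q _)]
    exact ((hpole _ (Finset.mem_Icc.2 (by omega))).mul ((regularOn_funQ η j).mul hden)).mul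
      (hprod _ η (by omega))

theorem hasNodes_singleFactor (hU : IsRegion ξ η q lam m U) (hj : j ∈ Finset.Icc 1 (2 * m))
    (hΩ : ∀ z ∈ Ω, z j ∈ region η U j) (h : Config N) :
    HasNodes ξ η m ε Ω j fun z => singleFactor ξ η q lam h j (z j) := by
  simp only [singleFactor_eq]
  refine ((regularOn_restFactor hU hj hΩ).mul (regularOn_numFactor j)).hasNodes.mul ?_
  simp only [funDh, ← Finset.prod_inv_distrib]
  refine HasNodes.prod _ fun n _ => ?_
  rcases isNode_or_xiShift_notMem (ε := ε) hU h j n with hn | hn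
  · exact hn.hasNodes_inv
  · exact (((RegularOn.coord j).sub (.const _)).inv fun z hz =>
      ne_of_mem_of_notMem (hΩ z hz) hn).hasNodes

/-- For opposite parities the denominator vanishes exactly at a prescribed node z_k ± η. For equal
parities a zero would put two points differing by η into U, which is excluded. -/
theorem hasNodes_cross (hU : IsRegion ξ η q lam m U) (hΩj : ∀ z ∈ Ω, z j ∈ region η U j) {k : ℕ}
    (hk : k ∈ Finset.Ioc j (2 * m)) (h0 : ε k = 0) (hΩk : ∀ z ∈ Ω, z k ∈ region η U k) :
    HasNodes ξ η m ε Ω j fun z => (z j - z k) / (z j - z k + (-1) ^ k * η) := by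
  simp only [div_eq_mul_inv]
  refine (((RegularOn.coord j).sub (.coord k)).hasNodes).mul ?_
  have hreg : RegularOn Ω fun z => z j - z k + (-1) ^ k * η :=
    ((RegularOn.coord j).sub (.coord k)).add (.const _)
  by_cases hj : Even j
  · by_cases hk' : Even k
    · refine (hreg.inv fun z hz hzero => ?_).hasNodes
      have h1 : z j ∈ U := by simpa [region, hj] using hΩj z hz
      have h2 : z k ∈ U := by simpa [region, hk'] using hΩk z hz
      rw [hk'.neg_one_pow] at hzero
      exact hU.disjoint_shift _ h1 (by convert h2 using 1; linear_combination hzero)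
    · refine (IsNode.hasNodes_inv (s := fun z => if Even j then z k + η else z k - η)
        (Or.inr ⟨k, hk, h0, by tauto, rfl⟩)).congr fun z _ => ?_
      rw [(Nat.not_even_iff_odd.1 hk').neg_one_pow, if_pos hj]
      congr 1
      ring
  · by_cases hk' : Even k
    · refine (IsNode.hasNodes_inv (s := fun z => if Even j then z k + η else z k - η)
        (Or.inr ⟨k, hk, h0, by tauto, rfl⟩)).congr fun z _ => ?_
      rw [hk'.neg_one_pow, if_neg hj]
      congr 1
      ring
    · refine (hreg.inv fun z hz hzero => ?_).hasNodes
      have h1 : z j + η ∈ U := by simpa [region, hj] using hΩj z hz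
      have h2 : z k + η ∈ U := by simpa [region, hk'] using hΩk z hz
      rw [(Nat.not_even_iff_odd.1 hk').neg_one_pow] at hzero
      exact hU.disjoint_shift _ h2 (by convert h1 using 1; linear_combination -hzero)

theorem hasNodes_variableFactor (hU : IsRegion ξ η q lam m U) (hi : i + 1 ≤ 2 * m)
    (h0 : ε (i + 1) = 0) (h : Config N) :
    HasNodes ξ η m ε (outerDomain η m ε U i) (i + 1) (variableFactor ξ η q lam m ε h (i + 1)) := by
  have hΩ : ∀ z ∈ outerDomain η m ε U i, z (i + 1) ∈ region η U (i + 1) := fun z hz =>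
    hz (i + 1) (Finset.mem_Ioc.2 (by omega)) h0
  have : variableFactor ξ η q lam m ε h (i + 1) = fun z =>
      singleFactor ξ η q lam h (i + 1) (z (i + 1)) * ∏ k ∈ Finset.Ioc (i + 1) (2 * m),
        if ε k = 0 then (z (i + 1) - z k) / (z (i + 1) - z k + (-1) ^ k * η) else 1 := by
    funext z
    rw [variableFactor, if_pos h0]
  rw [this]
  refine (hasNodes_singleFactor hU (Finset.mem_Icc.2 (by omega)) hΩ h).mul
    (HasNodes.prod _ fun k hk => ?_)
  by_cases hk0 : ε k = 0
  · simp only [if_pos hk0]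
    refine hasNodes_cross hU hΩ hk hk0 fun z hz => hz k ?_ hk0
    rw [Finset.mem_Ioc] at hk ⊢
    omega
  · simp only [if_neg hk0]
    exact (RegularOn.const 1).hasNodes

/-- The inner iterated integral does not depend on the choice of the contours, and is a regular
function of the outer variables. -/
theorem exists_regularOn_iteratedIntegral (hU : IsRegion ξ η q lam m U) (h : Config N)
    (hi : i ≤ 2 * m) :
    ∃ F, RegularOn (outerDomain η m ε U i) F ∧ ∀ z ∈ outerDomain η m ε U i,
      ∀ Γ, NestedSurrounds ξ η m ε U Γ i z →
        iteratedIntegral ε Γ (innerIntegrand ξ η q lam m ε h i) i z = F z := by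
  induction i with
  | zero => exact ⟨_, .const 1, fun z _ Γ _ => by simp [iteratedIntegral, innerIntegrand]⟩
  | succ i ih =>
    obtain ⟨F, hF, hFe⟩ := ih (by omega)
    by_cases h0 : ε (i + 1) = 0
    · obtain ⟨e, L, hL, he, hc⟩ := hasNodes_variableFactor hU hi h0 h
      -- By induction the inner integral `F` is regular also in z_{i+1}, so the poles to be
      -- surrounded are those of the factor of z_{i+1} alone.
      obtain ⟨G, hG, hGe⟩ := RegularOn.exists_residue (i := i + 1) (W := region η U (i + 1))
        (fun z hz w hw => update_mem_outerDomain hz hw) outerDomain_mono L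
        (fun s hs => ⟨(hL s hs).regularOn, fun z hz => (hL s hs).mem_region hU hz,
          (hL s hs).update⟩) _ (he.mul hF)
      refine ⟨G, hG, fun z hz Γ hΓ => ?_⟩
      rw [NestedSurrounds, if_pos h0] at hΓ
      rw [iteratedIntegral_innerIntegrand_succ _ _ _ _ _ _ _ _ h0,
        ← hGe z hz (Γ (i + 1) z) (fun p hp => hΓ.1.hasIndex_of_notMem hp)
          fun s hs => hΓ.1.hasIndex_node (hL s hs)]
      refine Contour.integral_congr fun w hw => ?_
      have hmem := update_mem_outerDomain hz
        (Contour.support_subset (fun p hp => hΓ.1.hasIndex_of_notMem hp) hw)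
      rw [hFe _ hmem Γ (hΓ.2 w hw), hc _ hmem,
        List.map_congr_left (g := fun s => s z) fun s hs => (hL s hs).update z w,
        Function.update_self]
      ring
    · have hsub := outerDomain_subset_of_absent (η := η) (m := m) (U := U) h0
      refine ⟨F, hF.mono hsub, fun z hz Γ hΓ => ?_⟩
      rw [NestedSurrounds, if_neg h0] at hΓ
      rw [iteratedIntegral_innerIntegrand_of_absent _ _ _ _ _ _ _ _ h0, hFe z (hsub hz) Γ hΓ]

end Factors

end

end XXXChain

namespace XXXChain

noncomputable section

open Filter Topology

/-! ### Circles -/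

theorem hasDerivAt_circleMap_two_pi_mul (c : ℂ) (r t : ℝ) :
    HasDerivAt (fun t : ℝ => circleMap c r (2 * Real.pi * t))
      ((2 * Real.pi) • deriv (circleMap c r) (2 * Real.pi * t)) t := by
  have h := (differentiable_circleMap c r (2 * Real.pi * t)).hasDerivAt.scomp t
    ((hasDerivAt_id t).const_mul (2 * Real.pi))
  exact h.congr_deriv (by simp)

/-- The counterclockwise circle. -/
def circleCurve (c : ℂ) (r : ℝ) : ClosedCurve where
  toFun t := circleMap c r (2 * Real.pi * t)
  continuousOn := ((continuous_circleMap c r).comp (by fun_prop)).continuousOn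
  closed := by
    have := periodic_circleMap c r 0
    simpa using this.symm
  differentiableAt :=
    ⟨∅, Set.finite_empty, fun t _ => (hasDerivAt_circleMap_two_pi_mul c r t).differentiableAt⟩
  integrable_deriv := by
    refine Continuous.intervalIntegrable ?_ 0 1
    have : deriv (fun t : ℝ => circleMap c r (2 * Real.pi * t)) =
        fun t => (2 * Real.pi) • (circleMap 0 r (2 * Real.pi * t) * Complex.I) := by
      funext t
      rw [(hasDerivAt_circleMap_two_pi_mul c r t).deriv, deriv_circleMap]
    rw [this]
    have := continuous_circleMap 0 r
    fun_prop

theorem integral_circleCurve (c : ℂ) (r : ℝ) (f : ℂ → ℂ) :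
    ∫ t in (0 : ℝ)..1, f ((circleCurve c r).toFun t) * deriv (circleCurve c r).toFun t =
      ∮ z in C(c, r), f z := by
  have h := intervalIntegral.smul_integral_comp_mul_left (a := 0) (b := 1)
    (fun θ => deriv (circleMap c r) θ • f (circleMap c r θ)) (2 * Real.pi)
  rw [mul_zero, mul_one] at h
  rw [circleIntegral, ← h, ← intervalIntegral.integral_smul]
  refine intervalIntegral.integral_congr fun t _ => ?_
  have h2 : deriv (circleCurve c r).toFun t = _ := (hasDerivAt_circleMap_two_pi_mul c r t).deriv
  simp only [h2, smul_eq_mul, Complex.real_smul]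
  simp only [circleCurve]
  ring

theorem circleIntegral_sub_inv_of_lt_dist {c p : ℂ} {r : ℝ} (hr : 0 ≤ r) (hp : r < dist p c) :
    (∮ z in C(c, r), (z - p)⁻¹) = 0 := by
  have h0 : ∀ z ∈ Metric.closedBall c r, z - p ≠ 0 := by
    intro z hz h
    rw [← sub_eq_zero.1 h] at hp
    exact absurd (Metric.mem_closedBall.1 hz) (not_le.2 hp)
  refine Complex.circleIntegral_eq_zero_of_differentiable_on_off_countable hr
    Set.countable_empty (ContinuousOn.inv₀ (by fun_prop) h0) fun z hz => ?_
  exact DifferentiableAt.inv (by fun_prop) (h0 z (Metric.ball_subset_closedBall hz.1))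

/-- The shift that maps the region of `z_k` to `U`. -/
def toRegion (η : ℂ) (k : ℕ) (p : ℂ) : ℂ := if Even k then p else p + η

/-- Concentric circles about the points `ξ_n` (even index) or `ξ_n - η` (odd index), whose radii
decrease with the index. -/
def circleContour {N : ℕ} (ξ : Fin N → ℂ) (η : ℂ) (ρ : ℝ) (i : ℕ) : Contour :=
  (List.finRange N).map fun n =>
    -- The offset 2 keeps every radius strictly below ρ, also for index 0.
    circleCurve (if Even i then ξ n else ξ n - η) (ρ / ((i : ℝ) + 2))

section Circles

variable {N R : ℕ} {ξ : Fin N → ℂ} {η : ℂ} {q : Fin R → ℂ} {lam : ℕ → ℂ} {m : ℕ}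
  {ε : ℕ → Fin 2} {U : Set ℂ} {ρ : ℝ}

theorem dist_center (i : ℕ) (p : ℂ) (n : Fin N) :
    dist p (if Even i then ξ n else ξ n - η) = dist (toRegion η i p) (ξ n) := by
  unfold toRegion
  split_ifs
  · rfl
  · rw [dist_eq_norm, dist_eq_norm]
    congr 1
    ring

theorem dist_of_mem_support_circleContour (hρ : 0 < ρ) {i : ℕ} {p : ℂ}
    (hp : p ∈ (circleContour ξ η ρ i).support) :
    ∃ n, dist (toRegion η i p) (ξ n) = ρ / ((i : ℝ) + 2) := by
  obtain ⟨γ, hγ, t, -, rfl⟩ := hp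
  obtain ⟨n, -, rfl⟩ := List.mem_map.1 hγ
  refine ⟨n, ?_⟩
  rw [← dist_center]
  exact Metric.mem_sphere.1 (circleMap_mem_sphere _ (by positivity) _)

theorem integral_circleContour (i : ℕ) (f : ℂ → ℂ) : (circleContour ξ η ρ i).integral f =
    ∑ n, ∮ z in C(if Even i then ξ n else ξ n - η, ρ / ((i : ℝ) + 2)), f z := by
  rw [Fin.sum_univ_def, Contour.integral, circleContour, List.map_map]
  refine congrArg List.sum (List.map_congr_left fun n _ => ?_)
  exact integral_circleCurve _ _ f

theorem hasIndex_zero_circleContour (hρ : 0 < ρ) {i : ℕ} {p : ℂ}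
    (hp : ∀ n, ρ / ((i : ℝ) + 2) < dist (toRegion η i p) (ξ n)) :
    (circleContour ξ η ρ i).HasIndex p 0 := by
  refine ⟨fun h => ?_, ?_⟩
  · obtain ⟨n, hn⟩ := dist_of_mem_support_circleContour hρ h
    exact absurd hn (hp n).ne'
  · rw [integral_circleContour, Finset.sum_eq_zero, mul_zero, Int.cast_zero]
    intro n _
    exact circleIntegral_sub_inv_of_lt_dist (by positivity) (by rw [dist_center]; exact hp n)

/-- The discs are separated, so a point inside one circle is outside all the others and only one
circle contributes. -/
theorem hasIndex_one_circleContour (hρ : 0 < ρ) (hsep : ∀ a b, a ≠ b → 2 * ρ ≤ dist (ξ a) (ξ b))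
    {i : ℕ} {p : ℂ} {n : Fin N} (hp : dist (toRegion η i p) (ξ n) < ρ / ((i : ℝ) + 2)) :
    (circleContour ξ η ρ i).HasIndex p 1 := by
  have hr : ρ / ((i : ℝ) + 2) ≤ ρ := div_le_self hρ.le (by linarith [i.cast_nonneg (α := ℝ)])
  have hne : ∀ a, a ≠ n → ρ / ((i : ℝ) + 2) < dist (toRegion η i p) (ξ a) := by
    intro a ha
    have h1 := hsep a n ha
    have h2 := dist_triangle_left (ξ a) (ξ n) (toRegion η i p)
    linarith
  refine ⟨fun h => ?_, ?_⟩
  · obtain ⟨a, ha⟩ := dist_of_mem_support_circleContour hρ h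
    by_cases han : a = n
    · subst han
      exact absurd ha hp.ne
    · exact absurd ha (hne a han).ne'
  · rw [integral_circleContour, Finset.sum_eq_single n]
    · rw [circleIntegral.integral_sub_inv_of_mem_ball
        (by rw [Metric.mem_ball, dist_center]; exact hp), inv_mul_cancel₀ Complex.two_pi_I_ne_zero,
        Int.cast_one]
    · intro a _ ha
      exact circleIntegral_sub_inv_of_lt_dist (by positivity) (by rw [dist_center]; exact hne a ha)
    · simp

/-- Concentric circles are nested as required as soon as the outer variables lie in the closed
discs of their own circles. -/
theorem nestedSurrounds_circleContour (hρ : 0 < ρ)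
    (hsep : ∀ a b, a ≠ b → 2 * ρ ≤ dist (ξ a) (ξ b)) (hball : ∀ n, Metric.ball (ξ n) ρ ⊆ U)
    (i : ℕ) (z : ℕ → ℂ) (hz : ∀ k ∈ Finset.Ioc i (2 * m), ε k = 0 →
      ∃ n, dist (toRegion η k (z k)) (ξ n) ≤ ρ / ((k : ℝ) + 2)) :
    NestedSurrounds ξ η m ε U (fun i _ => circleContour ξ η ρ i) i z := by
  induction i generalizing z with
  | zero => trivial
  | succ i ih =>
    unfold NestedSurrounds
    split_ifs with h0
    · refine ⟨?_, fun w hw => ih _ fun k hk hk0 => ?_⟩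
      · have hr0 : 0 < ρ / (((i + 1 : ℕ) : ℝ) + 2) := by positivity
        have hr : ρ / (((i + 1 : ℕ) : ℝ) + 2) < ρ :=
          div_lt_self hρ (by linarith [(i + 1).cast_nonneg (α := ℝ)])
        have hout : ∀ p, toRegion η (i + 1) p ∉ U →
            (circleContour ξ η ρ (i + 1)).HasIndex p 0 := by
          intro p hp
          refine hasIndex_zero_circleContour hρ fun n => ?_
          by_contra hlt
          exact hp (hball n (Metric.mem_ball.2 (by linarith)))
        have hin : ∀ k ∈ Finset.Ioc (i + 1) (2 * m), ε k = 0 → ∀ p,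
            toRegion η (i + 1) p = toRegion η k (z k) →
            (circleContour ξ η ρ (i + 1)).HasIndex p 1 := by
          intro k hk hk0 p hp
          obtain ⟨n, hn⟩ := hz k hk hk0
          refine hasIndex_one_circleContour hρ hsep (n := n) ?_
          rw [hp]
          -- An outer variable has a larger index, hence a strictly smaller radius; after the shift
          -- by ±η it is strictly inside the present circle.
          refine hn.trans_lt (div_lt_div_of_pos_left hρ (by positivity) ?_)
          have : ((i + 1 : ℕ) : ℝ) < k := Nat.cast_lt.2 (Finset.mem_Ioc.1 hk).1
          linarith
        unfold Surrounds
        split_ifs with hi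
        · refine ⟨fun n => hasIndex_one_circleContour hρ hsep (n := n) ?_,
            fun k hk hko hk0 => hin k hk hk0 _ ?_, fun p hp => hout p ?_⟩
          · simpa [toRegion, hi] using hr0
          · simp [toRegion, hi, Nat.not_even_iff_odd.2 hko]
          · simpa [toRegion, hi] using hp
        · refine ⟨fun n => hasIndex_one_circleContour hρ hsep (n := n) ?_,
            fun k hk hko hk0 => hin k hk hk0 _ ?_, fun p hp => hout p ?_⟩
          · simpa [toRegion, hi] using hr0
          · simp [toRegion, hi, hko]
          · simpa [toRegion, hi] using hp
      · by_cases hki : k = i + 1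
        · subst hki
          rw [Function.update_self]
          obtain ⟨n, hn⟩ := dist_of_mem_support_circleContour hρ hw
          exact ⟨n, hn.le⟩
        · rw [Function.update_of_ne hki]
          refine hz k ?_ hk0
          rw [Finset.mem_Ioc] at hk ⊢
          omega
    · refine ih z fun k hk hk0 => hz k ?_ hk0
      have : k ≠ i + 1 := fun h => h0 (h ▸ hk0)
      rw [Finset.mem_Ioc] at hk ⊢
      omega

/-! ### Small radii and existence of an admissible region -/

theorem eventually_mul_le {c : ℝ} (hc : 0 < c) : ∀ᶠ ρ in 𝓝[>] (0 : ℝ), 2 * ρ ≤ c := by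
  have : Tendsto (fun ρ : ℝ => 2 * ρ) (𝓝[>] 0) (𝓝 0) := by
    have : Tendsto (fun ρ : ℝ => 2 * ρ) (𝓝 0) (𝓝 (2 * 0)) := tendsto_id.const_mul 2
    rw [mul_zero] at this
    exact this.mono_left nhdsWithin_le_nhds
  filter_upwards [this.eventually (gt_mem_nhds hc)] with ρ hρ using hρ.le

theorem eventually_separated (hξ : Function.Injective ξ) :
    ∀ᶠ ρ in 𝓝[>] (0 : ℝ), ∀ a b, a ≠ b → 2 * ρ ≤ dist (ξ a) (ξ b) := by
  simp only [eventually_all]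
  exact fun a b hab => eventually_mul_le (dist_pos.2 (hξ.ne hab))

/-- The union of small discs about the points `ξ_n` is an admissible region. -/
theorem exists_isRegion (hη : η ≠ 0)
    (hξ : ∀ a b, a ≠ b → ξ a ≠ ξ b ∧ ξ a ≠ ξ b + η ∧ ξ a ≠ ξ b - η)
    (hq : ∀ k n, q k ≠ ξ n ∧ q k ≠ ξ n - η)
    (hlam : ∀ j ∈ Finset.Icc 1 m, ∀ n,
      lam j ≠ ξ n ∧ lam j ≠ ξ n - η ∧ lam j ≠ ξ n - 2 * η) :
    ∃ U, IsRegion ξ η q lam m U ∧ ∀ n, U ∈ 𝓝 (ξ n) := by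
  -- This gives disjointness of U and U - η: if p and p + η were both in U, some ξ_a + η and ξ_b
  -- would be at distance less than 2ρ. The case a = b uses η ≠ 0.
  have e1 : ∀ᶠ ρ in 𝓝[>] (0 : ℝ), ∀ a b, 2 * ρ ≤ dist (ξ a + η) (ξ b) := by
    simp only [eventually_all]
    intro a b
    refine eventually_mul_le (dist_pos.2 fun h => ?_)
    by_cases hab : a = b
    · subst hab
      exact hη (by simpa using h)
    · exact (hξ a b hab).2.2 (by rw [← h]; ring)
  have e2 : ∀ᶠ ρ in 𝓝[>] (0 : ℝ), ∀ j : Finset.Icc 1 m, ∀ n,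
      2 * ρ ≤ dist (lam j) (ξ n) ∧ 2 * ρ ≤ dist (lam j + η) (ξ n) := by
    simp only [eventually_all, eventually_and]
    intro j n
    have := hlam j j.2 n
    exact ⟨eventually_mul_le (dist_pos.2 this.1), eventually_mul_le (dist_pos.2 fun h =>
      this.2.1 (by rw [← h]; ring))⟩
  have e3 : ∀ᶠ ρ in 𝓝[>] (0 : ℝ), ∀ k n,
      2 * ρ ≤ dist (q k) (ξ n) ∧ 2 * ρ ≤ dist (q k + η) (ξ n) := by
    simp only [eventually_all, eventually_and]
    intro k n
    have := hq k n
    exact ⟨eventually_mul_le (dist_pos.2 this.1), eventually_mul_le (dist_pos.2 fun h =>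
      this.2 (by rw [← h]; ring))⟩
  obtain ⟨ρ, h1, h2, h3, hρ⟩ := (e1.and (e2.and (e3.and self_mem_nhdsWithin))).exists
  replace hρ : 0 < ρ := hρ
  have hout : ∀ p, (∀ n, 2 * ρ ≤ dist p (ξ n)) → p ∉ ⋃ n, Metric.ball (ξ n) ρ := by
    intro p hp hmem
    obtain ⟨n, hn⟩ := Set.mem_iUnion.1 hmem
    have := hp n
    have := Metric.mem_ball.1 hn
    linarith
  refine ⟨⋃ n, Metric.ball (ξ n) ρ, ⟨fun n => Set.mem_iUnion.2 ⟨n, Metric.mem_ball_self hρ⟩,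
    fun p hp hp' => ?_, fun j hj => ⟨hout _ fun n => (h2 ⟨j, hj⟩ n).1,
      hout _ fun n => (h2 ⟨j, hj⟩ n).2⟩, fun k => ⟨hout _ fun n => (h3 k n).1,
      hout _ fun n => (h3 k n).2⟩⟩,
    fun n => mem_of_superset (Metric.ball_mem_nhds _ hρ)
      (Set.subset_iUnion (fun n => Metric.ball (ξ n) ρ) n)⟩
  obtain ⟨a, ha⟩ := Set.mem_iUnion.1 hp
  obtain ⟨b, hb⟩ := Set.mem_iUnion.1 hp'
  rw [Metric.mem_ball] at ha hb
  have := h1 a b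
  have h4 := dist_triangle_left (ξ a + η) (ξ b) (p + η)
  rw [dist_add_right] at h4
  linarith

theorem eventually_ball_subset (hU : ∀ n, U ∈ 𝓝 (ξ n)) :
    ∀ᶠ ρ in 𝓝[>] (0 : ℝ), ∀ n, Metric.ball (ξ n) ρ ⊆ U := by
  simp only [eventually_all]
  intro n
  obtain ⟨δ, hδ, hsub⟩ := Metric.mem_nhds_iff.1 (hU n)
  filter_upwards [eventually_mul_le hδ, self_mem_nhdsWithin] with ρ h hρ
  exact (Metric.ball_subset_ball (by have : 0 < ρ := hρ; linarith)).trans hsub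

theorem exists_radius (hξ : Function.Injective ξ) (hU : ∀ n, U ∈ 𝓝 (ξ n)) :
    ∃ ρ > 0, (∀ a b, a ≠ b → 2 * ρ ≤ dist (ξ a) (ξ b)) ∧ ∀ n, Metric.ball (ξ n) ρ ⊆ U := by
  obtain ⟨ρ, h1, h2, hρ⟩ := ((eventually_separated hξ).and
    ((eventually_ball_subset hU).and self_mem_nhdsWithin)).exists
  exact ⟨ρ, hρ, h1, h2⟩

end Circles

/-! ### Continuity of the index -/

/-- Dominated convergence: the image of the curve is compact and misses p, so for x near p the
kernel is bounded by a constant and the integrand by a multiple of |γ'|. -/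
theorem ClosedCurve.continuousAt_integral (γ : ClosedCurve) {p : ℂ}
    (hp : ∀ t ∈ Set.Icc (0 : ℝ) 1, γ.toFun t ≠ p) :
    ContinuousAt (fun x => ∫ t in (0 : ℝ)..1, (γ.toFun t - x)⁻¹ * deriv γ.toFun t) p := by
  have hcl : IsClosed (γ.toFun '' Set.Icc 0 1) :=
    (isCompact_Icc.image_of_continuousOn γ.continuousOn).isClosed
  have hnot : p ∉ γ.toFun '' Set.Icc 0 1 := by
    rintro ⟨t, ht, h⟩
    exact hp t ht h
  obtain ⟨δ, hδ, hsub⟩ := Metric.mem_nhds_iff.1 (hcl.isOpen_compl.mem_nhds hnot)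
  have hdist : ∀ x ∈ Metric.ball p (δ / 2), ∀ t ∈ Set.Icc (0 : ℝ) 1,
      δ / 2 ≤ ‖γ.toFun t - x‖ := by
    intro x hx t ht
    by_contra hlt
    push Not at hlt
    rw [← dist_eq_norm] at hlt
    refine hsub (a := γ.toFun t) (Metric.mem_ball.2 ?_) ⟨t, ht, rfl⟩
    have := dist_triangle (γ.toFun t) x p
    have := Metric.mem_ball.1 hx
    linarith
  have hball : Metric.ball p (δ / 2) ∈ 𝓝 p := Metric.ball_mem_nhds p (half_pos hδ)
  have hIcc : ∀ t, t ∈ Set.uIoc (0 : ℝ) 1 → t ∈ Set.Icc (0 : ℝ) 1 := by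
    intro t ht
    rw [Set.uIoc_of_le zero_le_one] at ht
    exact Set.Ioc_subset_Icc_self ht
  refine intervalIntegral.continuousAt_of_dominated_interval
    (bound := fun t => (δ / 2)⁻¹ * ‖deriv γ.toFun t‖) ?_ ?_ ?_ ?_
  · filter_upwards [hball] with x hx
    refine (γ.integrable_deriv.continuousOn_mul (g := fun t => (γ.toFun t - x)⁻¹)
      ?_).def'.aestronglyMeasurable
    rw [Set.uIcc_of_le zero_le_one]
    refine ContinuousOn.inv₀ (γ.continuousOn.sub continuousOn_const) fun t ht h => ?_
    have := hdist x hx t ht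
    rw [h, norm_zero] at this
    linarith
  · filter_upwards [hball] with x hx
    refine Eventually.of_forall fun t ht => ?_
    rw [norm_mul, norm_inv]
    exact mul_le_mul_of_nonneg_right (inv_anti₀ (half_pos hδ) (hdist x hx t (hIcc t ht)))
      (norm_nonneg _)
  · exact γ.integrable_deriv.norm.const_mul _
  · refine Eventually.of_forall fun t ht => ?_
    refine ContinuousAt.mul (ContinuousAt.inv₀ (by fun_prop) ?_) continuousAt_const
    exact sub_ne_zero.2 (hp t (hIcc t ht))

theorem Contour.continuousAt_integral {Γ : Contour} {p : ℂ} (hp : p ∉ Γ.support) :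
    ContinuousAt (fun x => Γ.integral fun z => (z - x)⁻¹) p := by
  induction Γ with
  | nil =>
    simp only [Contour.integral, List.map_nil, List.sum_nil]
    exact continuousAt_const
  | cons γ Γ ih =>
    simp only [Contour.integral, List.map_cons, List.sum_cons]
    refine (γ.continuousAt_integral fun t ht h => hp ⟨γ, List.mem_cons_self, t, ht, h⟩).add
      (ih fun h => hp ?_)
    obtain ⟨γ', hγ', t, ht, e⟩ := h
    exact ⟨γ', List.mem_cons_of_mem _ hγ', t, ht, e⟩

/-- The index integral is continuous off the contour and nonzero at p, hence nonzero near p, while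
it vanishes outside W. This makes up for U not being assumed open in a contour system. -/
theorem Contour.HasIndex.mem_nhds {Γ : Contour} {p : ℂ} {W : Set ℂ} (hp : Γ.HasIndex p 1)
    (hW : ∀ x ∉ W, Γ.HasIndex x 0) : W ∈ 𝓝 p := by
  have h := (Contour.continuousAt_integral hp.1).eventually_ne (y := 0)
    (by rw [hp.integral]; simp [Complex.I_ne_zero, Real.pi_ne_zero])
  filter_upwards [h] with x hx
  by_contra hxW
  exact hx (by rw [(hW x hxW).integral]; simp)

end

end XXXChain

namespace XXXChain

noncomputable section

open Filter Topology

/-! ### The outermost integral -/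

section Outermost

variable {N R : ℕ} {ξ : Fin N → ℂ} {η : ℂ} {q : Fin R → ℂ} {lam : ℕ → ℂ} {m : ℕ}
  {ε : ℕ → Fin 2} {U : Set ℂ} {ρ : ℝ}

theorem iteratedIntegral_innerIntegrand_of_forall_absent (Γ : ℕ → (ℕ → ℂ) → Contour)
    (h : Config N) {i k : ℕ} (hik : i ≤ k) (h0 : ∀ l ∈ Finset.Ioc i k, ε l ≠ 0) (z : ℕ → ℂ) :
    iteratedIntegral ε Γ (innerIntegrand ξ η q lam m ε h k) k z =
      iteratedIntegral ε Γ (innerIntegrand ξ η q lam m ε h i) i z := by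
  induction k, hik using Nat.le_induction with
  | base => rfl
  | succ k hik ih =>
    rw [iteratedIntegral_innerIntegrand_of_absent _ _ _ _ _ _ _ _
      (h0 (k + 1) (Finset.mem_Ioc.2 (by omega)))]
    refine ih fun l hl => h0 l ?_
    rw [Finset.mem_Ioc] at hl ⊢
    omega

/-- Change of an outer variable in an iterated integral over fixed contours. -/
theorem iteratedIntegral_congr {ε' : ℕ → Fin 2} (G : ℕ → Contour) {f f' : (ℕ → ℂ) → ℂ}
    {i M : ℕ} (hM : i < M) (x y : ℂ) (hε : ∀ j ≤ i, ε j = ε' j)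
    (hf : ∀ z, z M = x → (∀ j ∈ Finset.Icc 1 i, ε j = 0 → z j ∈ (G j).support) →
      f z = f' (Function.update z M y)) {l : ℕ} (hl : l ≤ i) {z : ℕ → ℂ} (hzM : z M = x)
    (hz : ∀ j ∈ Finset.Ioc l i, ε j = 0 → z j ∈ (G j).support) :
    iteratedIntegral ε (fun i _ => G i) f l z =
      iteratedIntegral ε' (fun i _ => G i) f' l (Function.update z M y) := by
  induction l generalizing z with
  | zero => exact hf z hzM fun j hj => hz j (by simpa [Nat.lt_iff_add_one_le] using hj)
  | succ l ih =>
    unfold iteratedIntegral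
    rw [← hε (l + 1) hl]
    split_ifs with h0
    · refine Contour.integral_congr fun w hw => ?_
      rw [Function.update_comm (by omega)]
      refine ih (by omega) (by rw [Function.update_of_ne (by omega), hzM]) fun j hj hj0 => ?_
      by_cases hjl : j = l + 1
      · subst hjl
        simpa using hw
      · rw [Function.update_of_ne hjl]
        refine hz j ?_ hj0
        rw [Finset.mem_Ioc] at hj ⊢
        omega
    · refine ih (by omega) hzM fun j hj hj0 => hz j ?_ hj0
      have : j ≠ l + 1 := fun h => h0 (h ▸ hj0)
      rw [Finset.mem_Ioc] at hj ⊢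
      omega

/-! ### Residues at the zeros of d_𝐡 -/

theorem toRegion_xiShift {h : Config N} {j : ℕ} {n : Fin N}
    (hn : h n = if Even j then 0 else 1) : toRegion η j (xiShift ξ η h n) = ξ n := by
  by_cases hj : Even j
  · simp [toRegion, xiShift, hn, hj]
  · simp [toRegion, xiShift, hn, hj]

theorem xiShift_notMem_region (hU : IsRegion ξ η q lam m U) {h : Config N} {j : ℕ} {n : Fin N}
    (hn : h n ≠ if Even j then 0 else 1) : xiShift ξ η h n ∉ region η U j := by
  have h1 := hU.xi_mem n
  by_cases hj : Even j
  · rw [if_pos hj] at hn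
    have h3 : ξ n - η ∉ U := fun h => hU.disjoint_shift _ h (by simpa using h1)
    simpa [xiShift, fin_two_eq_one hn, hj, region] using h3
  · rw [if_neg hj] at hn
    have hn0 : h n = 0 := by omega
    simpa [xiShift, hn0, hj, region] using hU.disjoint_shift (ξ n) h1

theorem hasIndex_circleContour_of_notMem (hρ : 0 < ρ) (hball : ∀ n, Metric.ball (ξ n) ρ ⊆ U)
    {j : ℕ} {p : ℂ} (hp : p ∉ region η U j) : (circleContour ξ η ρ j).HasIndex p 0 := by
  refine hasIndex_zero_circleContour hρ fun n => ?_
  by_contra hlt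
  have hr : ρ / ((j : ℝ) + 2) < ρ := div_lt_self hρ (by linarith [j.cast_nonneg (α := ℝ)])
  exact hp (hball n (Metric.mem_ball.2 (by rw [toRegion] at hlt; linarith)))

theorem hasIndex_circleContour_xiShift (hρ : 0 < ρ)
    (hsep : ∀ a b, a ≠ b → 2 * ρ ≤ dist (ξ a) (ξ b)) {h : Config N} {j : ℕ} {n : Fin N}
    (hn : h n = if Even j then 0 else 1) :
    (circleContour ξ η ρ j).HasIndex (xiShift ξ η h n) 1 := by
  refine hasIndex_one_circleContour hρ hsep (n := n) ?_
  rw [toRegion_xiShift hn, dist_self]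
  positivity

theorem xiShift_notMem_support (hU : IsRegion ξ η q lam m U) (hρ : 0 < ρ)
    (hsep : ∀ a b, a ≠ b → 2 * ρ ≤ dist (ξ a) (ξ b)) (hball : ∀ n, Metric.ball (ξ n) ρ ⊆ U)
    (h : Config N) (j : ℕ) (n : Fin N) :
    xiShift ξ η h n ∉ (circleContour ξ η ρ j).support := by
  by_cases hn : h n = if Even j then 0 else 1
  · exact (hasIndex_circleContour_xiShift hρ hsep hn).1
  · exact (hasIndex_circleContour_of_notMem hρ hball (xiShift_notMem_region hU hn)).1

theorem xiShift_update_of_ne (h : Config N) {a b : Fin N} (hb : b ≠ a) (e : Fin 2) :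
    xiShift ξ η (Function.update h a e) b = xiShift ξ η h b := by
  rw [xiShift, xiShift, Function.update_of_ne hb]

theorem funDh_eq_mul (h : Config N) (a : Fin N) (w : ℂ) : funDh ξ η h w =
    (w - xiShift ξ η h a) * ∏ b ∈ Finset.univ.erase a, (w - xiShift ξ η h b) :=
  (Finset.mul_prod_erase _ _ (Finset.mem_univ a)).symm

theorem prod_erase_xiShift_update (h : Config N) (a : Fin N) (e : Fin 2) (f : ℂ → ℂ) :
    ∏ b ∈ Finset.univ.erase a, f (xiShift ξ η (Function.update h a e) b) =
      ∏ b ∈ Finset.univ.erase a, f (xiShift ξ η h b) :=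
  Finset.prod_congr rfl fun b hb => by rw [xiShift_update_of_ne h (Finset.ne_of_mem_erase hb)]

/-- The configuration after evaluation of the residue of the variable `z_i` at the site `a`. -/
def flip (i : ℕ) (h : Config N) (a : Fin N) : Config N :=
  Function.update h a (if Even i then 1 else 0)

/-- The left-hand quotient is the cross factor at z_M = ξ_a^{(h_a)}. Its numerator cancels the zero
of d_𝐡 at ξ_a^{(h_a)} and its denominator supplies the zero of the flipped configuration: η is
subtracted from it for even M and added for odd M. -/
theorem singleFactor_flip {h : Config N} {M : ℕ} {a : Fin N}
    (ha : h a = if Even M then 0 else 1) (j : ℕ) {w : ℂ} (hw : w - xiShift ξ η h a ≠ 0) :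
    singleFactor ξ η q lam h j w *
      ((w - xiShift ξ η h a) / (w - xiShift ξ η h a + (-1) ^ M * η)) =
      singleFactor ξ η q lam (flip M h a) j w := by
  have hx : w - xiShift ξ η (flip M h a) a = w - xiShift ξ η h a + (-1) ^ M * η := by
    by_cases hM : Even M
    · rw [hM.neg_one_pow]
      simp [flip, xiShift, ha, hM]
      ring
    · rw [(Nat.not_even_iff_odd.1 hM).neg_one_pow]
      simp [flip, xiShift, ha, hM]
      ring
  rw [singleFactor_eq, singleFactor_eq, funDh_eq_mul h a, funDh_eq_mul (flip M h a) a, hx, flip,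
    prod_erase_xiShift_update h a _ fun x => w - x, mul_inv, mul_inv]
  field_simp

/-- Once z_M is evaluated at the residue, its cross factors with all inner variables are absorbed
into the flip. The variable is then declared absent, and its value, no longer seen, is reset to 0.
-/
theorem innerIntegrand_flip (hU : IsRegion ξ η q lam m U) (hρ : 0 < ρ)
    (hsep : ∀ a b, a ≠ b → 2 * ρ ≤ dist (ξ a) (ξ b)) (hball : ∀ n, Metric.ball (ξ n) ρ ⊆ U)
    {i M : ℕ} (hi : i < M) (hM : M ≤ 2 * m) (hM0 : ε M = 0) {h : Config N} {a : Fin N}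
    (ha : h a = if Even M then 0 else 1) {z : ℕ → ℂ} (hzM : z M = xiShift ξ η h a)
    (hz : ∀ j ∈ Finset.Icc 1 i, ε j = 0 → z j ∈ (circleContour ξ η ρ j).support) :
    innerIntegrand ξ η q lam m ε h i z =
      innerIntegrand ξ η q lam m (Function.update ε M 1) (flip M h a) i
        (Function.update z M 0) := by
  refine Finset.prod_congr rfl fun j hj => ?_
  have hj' := Finset.mem_Icc.1 hj
  unfold variableFactor
  rw [Function.update_of_ne (show j ≠ M by omega)]
  by_cases hj0 : ε j = 0
  · rw [if_pos hj0, if_pos hj0, Function.update_of_ne (show j ≠ M by omega)]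
    have hw : z j - xiShift ξ η h a ≠ 0 := fun he =>
      xiShift_notMem_support hU hρ hsep hball h j a (by rw [← sub_eq_zero.1 he]; exact hz j hj hj0)
    rw [← singleFactor_flip ha j hw, mul_assoc]
    congr 1
    have hmem : M ∈ Finset.Ioc j (2 * m) := Finset.mem_Ioc.2 (by omega)
    rw [← Finset.mul_prod_erase _ _ hmem, ← Finset.mul_prod_erase _ _ hmem, if_pos hM0, hzM,
      Function.update_self, if_neg (by decide), one_mul]
    congr 1
    refine Finset.prod_congr rfl fun k hk => ?_
    have hk := Finset.ne_of_mem_erase hk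
    rw [Function.update_of_ne hk, Function.update_of_ne hk]
  · rw [if_neg hj0, if_neg hj0]

theorem xiShift_injective
    (hξ : ∀ a b, a ≠ b → ξ a ≠ ξ b ∧ ξ a ≠ ξ b + η ∧ ξ a ≠ ξ b - η) (h : Config N) :
    Function.Injective (xiShift ξ η h) := by
  intro a b hab
  by_contra hne
  obtain ⟨h1, h2, h3⟩ := hξ a b hne
  unfold xiShift at hab
  have hcases : ∀ n, h n = 0 ∨ h n = 1 := fun n => by omega
  rcases hcases a with ha | ha <;> rcases hcases b with hb | hb <;>
    simp [ha, hb] at hab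
  · exact h1 hab
  · exact h3 hab
  · exact h2 (by linear_combination hab)
  · exact h1 hab

/-- Partial fractions, read off from Lagrange interpolation of the constant 1. For N = 0 the left
side is 1 and the sum is empty, so a site is needed. -/
theorem inv_funDh_eq_sum {h : Config N} (hinj : Function.Injective (xiShift ξ η h))
    {w : ℂ} (hN : Nonempty (Fin N)) (hw : ∀ b, w - xiShift ξ η h b ≠ 0) :
    (funDh ξ η h w)⁻¹ = ∑ b, (∏ c ∈ Finset.univ.erase b,
      (xiShift ξ η h b - xiShift ξ η h c))⁻¹ * (w - xiShift ξ η h b)⁻¹ := by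
  have h1 := Lagrange.eval_interpolate_not_at_node (s := Finset.univ) (v := xiShift ξ η h)
    (fun _ => (1 : ℂ)) (x := w) fun i _ => sub_ne_zero.1 (hw i)
  have h2 : Lagrange.interpolate Finset.univ (xiShift ξ η h) (fun _ => (1 : ℂ)) = 1 :=
    Lagrange.interpolate_one hinj.injOn Finset.univ_nonempty
  have h3 : funDh ξ η h w ≠ 0 := Finset.prod_ne_zero_iff.2 fun b _ => hw b
  rw [h2, Polynomial.eval_one, Lagrange.eval_nodal] at h1
  refine (eq_inv_of_mul_eq_one_right h1.symm).symm.trans ?_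
  exact Finset.sum_congr rfl fun b _ => by
    rw [Lagrange.nodalWeight, mul_one, Finset.prod_inv_distrib]

/-- Evaluation of the outermost integral by residues: each residue is an iterated integral of the
same kind, with one variable less and with a flipped configuration. -/
theorem iteratedIntegral_eq_sum_flip (hU : IsRegion ξ η q lam m U)
    (hξ : ∀ a b, a ≠ b → ξ a ≠ ξ b ∧ ξ a ≠ ξ b + η ∧ ξ a ≠ ξ b - η) (hρ : 0 < ρ)
    (hsep : ∀ a b, a ≠ b → 2 * ρ ≤ dist (ξ a) (ξ b)) (hball : ∀ n, Metric.ball (ξ n) ρ ⊆ U)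
    {i : ℕ} (hi : i + 1 ≤ 2 * m) (hi0 : ε (i + 1) = 0)
    (habs : ∀ k ∈ Finset.Ioc (i + 1) (2 * m), ε k ≠ 0) (h : Config N) :
    iteratedIntegral ε (fun i _ => circleContour ξ η ρ i)
        (innerIntegrand ξ η q lam m ε h (2 * m)) (2 * m) 0 =
      ∑ a, if h a = (if Even (i + 1) then 0 else 1) then
        2 * (Real.pi : ℂ) * Complex.I * restFactor η q lam (i + 1) (xiShift ξ η h a) *
          numFactor ξ η (i + 1) (xiShift ξ η h a) *
          (∏ b ∈ Finset.univ.erase a, (xiShift ξ η h a - xiShift ξ η h b))⁻¹ *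
          iteratedIntegral (Function.update ε (i + 1) 1) (fun i _ => circleContour ξ η ρ i)
            (innerIntegrand ξ η q lam m (Function.update ε (i + 1) 1) (flip (i + 1) h a) (2 * m))
            (2 * m) 0
      else 0 := by
  set x := xiShift ξ η h with hx
  have hinj : Function.Injective x := xiShift_injective hξ h
  obtain ⟨F, hF, hFe⟩ := exists_regularOn_iteratedIntegral (ε := ε) (i := i) hU h (by omega)
  -- No variable outside z_{i+1} is present, so there is no condition on the base point.
  have h0dom : (0 : ℕ → ℂ) ∈ outerDomain η m ε U (i + 1) := fun k hk h0 => absurd h0 (habs k hk)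
  have hdom : ∀ w ∈ region η U (i + 1),
      Function.update (0 : ℕ → ℂ) (i + 1) w ∈ outerDomain η m ε U i := fun w hw =>
    update_mem_outerDomain h0dom hw
  have hout : ∀ p ∉ region η U (i + 1), (circleContour ξ η ρ (i + 1)).HasIndex p 0 :=
    fun p hp => hasIndex_circleContour_of_notMem hρ hball hp
  have hsupp := Contour.support_subset hout
  have hcoord : ∀ z ∈ outerDomain η m ε U i, z (i + 1) ∈ region η U (i + 1) := fun z hz =>
    hz (i + 1) (Finset.mem_Ioc.2 (by omega)) hi0
  set G : (ℕ → ℂ) → ℂ := fun z =>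
    restFactor η q lam (i + 1) (z (i + 1)) * numFactor ξ η (i + 1) (z (i + 1)) * F z with hGdef
  have hG : RegularOn (outerDomain η m ε U i) G :=
    ((regularOn_restFactor hU (Finset.mem_Icc.2 (by omega)) hcoord).mul
      (regularOn_numFactor (i + 1))).mul hF
  have hnest : ∀ w, (∃ n, dist (toRegion η (i + 1) w) (ξ n) ≤ ρ / (((i + 1 : ℕ) : ℝ) + 2)) →
      NestedSurrounds ξ η m ε U (fun i _ => circleContour ξ η ρ i) i
        (Function.update 0 (i + 1) w) := by
    intro w hw
    refine nestedSurrounds_circleContour hρ hsep hball i _ fun k hk hk0 => ?_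
    by_cases hki : k = i + 1
    · subst hki
      simpa using hw
    · refine absurd hk0 (habs k ?_)
      rw [Finset.mem_Ioc] at hk ⊢
      omega
  -- There are no outer cross factors left. Replacing the inner integral by the regular function `F`
  -- and expanding 1/d_𝐡 in partial fractions leaves one simple pole per term.
  have key : ∀ w ∈ (circleContour ξ η ρ (i + 1)).support,
      variableFactor ξ η q lam m ε h (i + 1) (Function.update 0 (i + 1) w) *
        iteratedIntegral ε (fun i _ => circleContour ξ η ρ i)
          (innerIntegrand ξ η q lam m ε h i) i (Function.update 0 (i + 1) w) =
      ∑ b, (∏ c ∈ Finset.univ.erase b, (x b - x c))⁻¹ *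
        (G (Function.update 0 (i + 1) w) / (w - x b)) := by
    intro w hw
    -- A point on the contour also provides the site required by the partial fraction expansion.
    obtain ⟨n, hn⟩ := dist_of_mem_support_circleContour hρ hw
    have hwx : ∀ b, w - x b ≠ 0 := fun b he =>
      xiShift_notMem_support hU hρ hsep hball h (i + 1) b (by
        rw [← hx, ← sub_eq_zero.1 he]; exact hw)
    rw [hFe _ (hdom w (hsupp hw)) _ (hnest w ⟨n, hn.le⟩), variableFactor, if_pos hi0,
      Finset.prod_eq_one fun k hk => if_neg (habs k hk), mul_one, Function.update_self,
      singleFactor_eq, inv_funDh_eq_sum hinj ⟨n⟩ hwx, Finset.mul_sum, Finset.sum_mul]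
    refine Finset.sum_congr rfl fun b _ => ?_
    simp only [hGdef, Function.update_self]
    ring
  rw [iteratedIntegral_innerIntegrand_of_forall_absent _ h hi habs,
    iteratedIntegral_innerIntegrand_succ _ _ _ _ _ _ _ _ hi0, Contour.integral_congr key,
    Contour.integral_sum]
  · refine Finset.sum_congr rfl fun a _ => ?_
    rw [Contour.integral_const_mul]
    by_cases ha : h a = if Even (i + 1) then 0 else 1
    · rw [if_pos ha]
      have hmem : x a ∈ region η U (i + 1) := by
        have : toRegion η (i + 1) (x a) ∈ U := by
          rw [hx, toRegion_xiShift ha]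
          exact hU.xi_mem a
        exact this
      rw [hG.integral_div hdom hout hmem (hasIndex_circleContour_xiShift hρ hsep ha)]
      simp only [hGdef, Function.update_self]
      -- The residue point is the centre of a circle, so the inner circles are still correctly
      -- nested and `F` there is again an iterated integral over them.
      rw [← hFe _ (hdom _ hmem) _ (hnest (x a) ⟨a, by
        rw [hx, toRegion_xiShift ha, dist_self]; positivity⟩)]
      have habs' : ∀ k ∈ Finset.Ioc i (2 * m), Function.update ε (i + 1) 1 k ≠ 0 := by
        intro k hk
        by_cases hki : k = i + 1
        · subst hki
          simp
        · rw [Function.update_of_ne hki]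
          refine habs k ?_
          rw [Finset.mem_Ioc] at hk ⊢
          omega
      rw [iteratedIntegral_innerIntegrand_of_forall_absent _ _ (by omega) habs',
        iteratedIntegral_congr (ε' := Function.update ε (i + 1) 1) (circleContour ξ η ρ)
          (Nat.lt_succ_self i) (x a) 0
          (f' := innerIntegrand ξ η q lam m (Function.update ε (i + 1) 1) (flip (i + 1) h a) i)
          (fun j hj => (Function.update_of_ne (by omega) _ _).symm)
          (fun z hzM hz => innerIntegrand_flip hU hρ hsep hball (Nat.lt_succ_self i) hi hi0 ha
            hzM hz) le_rfl (Function.update_self _ _ _) (by simp),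
        Function.update_idem,
        show Function.update (0 : ℕ → ℂ) i.succ 0 = 0 from Function.update_eq_self _ _]
      ring
    · rw [if_neg ha]
      -- With the other value of h_a the pole lies outside the region, and the term is regular.
      have hnot := xiShift_notMem_region hU ha
      have hreg : RegularOn (outerDomain η m ε U i) fun z => G z / (z (i + 1) - x a) :=
        hG.div ((RegularOn.coord (i + 1)).sub (.const _)) fun z hz =>
          ne_of_mem_of_notMem (hcoord z hz) hnot
      have := hreg.integral_eq_zero hdom hout
      simp only [Function.update_self] at this
      rw [this, mul_zero]
  · intro b _
    refine continuousOn_const.fun_mul (((hG.continuousOn hdom).mono hsupp).div (by fun_prop) ?_)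
    intro w hw he
    exact xiShift_notMem_support hU hρ hsep hball h (i + 1) b (by
        rw [← hx, ← sub_eq_zero.1 he]; exact hw)

end Outermost

end

end XXXChain

namespace XXXChain

noncomputable section

open Matrix

/-! ### Exchange relations -/

/-- The relation `R₁₂(u) X₁ Y₂ = Y₂ X₁ R₁₂(u)` for the rational `R`-matrix, in components. -/
def IsRTT {S : Type*} [Ring S] [Algebra ℂ S] (u η : ℂ) (X Y : Matrix (Fin 2) (Fin 2) S) : Prop :=
  ∀ i j k l, u • (X i j * Y k l) + η • (X k j * Y i l) =
    u • (Y k l * X i j) + η • (Y k j * X i l)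

/-- Commutation of the entries at different sites groups the unprimed and the primed factors; R is
then moved through the two groups one after the other. -/
theorem IsRTT.mul {S : Type*} [Ring S] [Algebra ℂ S] {u η : ℂ}
    {X Y X' Y' : Matrix (Fin 2) (Fin 2) S} (h : IsRTT u η X Y) (h' : IsRTT u η X' Y')
    (hc : ∀ i j k l, Commute (X' i j) (Y k l)) (hc' : ∀ i j k l, Commute (Y' i j) (X k l)) :
    IsRTT u η (X * X') (Y * Y') := by
  intro i j k l
  have e1 : ∀ i j k l, (X * X') i j * (Y * Y') k l =
      ∑ p, ∑ r, X i p * Y k r * (X' p j * Y' r l) := by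
    intro i j k l
    simp only [Matrix.mul_apply, Finset.sum_mul_sum]
    refine Finset.sum_congr rfl fun p _ => Finset.sum_congr rfl fun r _ => ?_
    rw [mul_assoc, ← mul_assoc (X' p j), (hc p j k r).eq]
    simp only [mul_assoc]
  have e2 : ∀ i j k l, (Y * Y') k l * (X * X') i j =
      ∑ p, ∑ r, Y k r * X i p * (Y' r l * X' p j) := by
    intro i j k l
    rw [Finset.sum_comm]
    simp only [Matrix.mul_apply, Finset.sum_mul_sum]
    refine Finset.sum_congr rfl fun p _ => Finset.sum_congr rfl fun r _ => ?_
    rw [mul_assoc, ← mul_assoc (Y' p l), (hc' p l i r).eq]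
    simp only [mul_assoc]
  rw [e1, e1, e2, e2]
  calc _ = ∑ p, ∑ r, (u • (X i p * Y k r) + η • (X k p * Y i r)) * (X' p j * Y' r l) := by
        simp only [Finset.smul_sum, add_mul, smul_mul_assoc, Finset.sum_add_distrib]
    _ = ∑ p, ∑ r, (u • (Y k r * X i p) + η • (Y k p * X i r)) * (X' p j * Y' r l) := by
        simp only [h i _ k _]
    _ = ∑ p, ∑ r, Y k r * X i p * (u • (X' p j * Y' r l) + η • (X' r j * Y' p l)) := by
        simp only [add_mul, mul_add, smul_mul_assoc, mul_smul_comm, Finset.sum_add_distrib]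
        congr 1
        rw [Finset.sum_comm]
    _ = ∑ p, ∑ r, Y k r * X i p * (u • (Y' r l * X' p j) + η • (Y' r j * X' p l)) := by
        simp only [h' _ j _ l]
    _ = _ := by
        simp only [Finset.smul_sum, mul_add, mul_smul_comm, Finset.sum_add_distrib]

/-- The antisymmetric tensor. -/
def antisymm (i j : Fin 2) : ℂ := ((j : ℕ) : ℂ) - ((i : ℕ) : ℂ)

/-- The quantum determinant of the pair `X`, `Y` is `κ`. -/
def IsQuantumDet {S : Type*} [Ring S] [Algebra ℂ S] (κ : ℂ) (X Y : Matrix (Fin 2) (Fin 2) S) :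
    Prop :=
  ∀ a b, ∑ i, ∑ j, antisymm i j • (X a i * Y b j) = algebraMap ℂ S (κ * antisymm a b)

/-- Contracting the primed factors with the antisymmetric tensor reproduces this tensor times κ',
which is then contracted with the unprimed factors. -/
theorem IsQuantumDet.mul {S : Type*} [Ring S] [Algebra ℂ S] {κ κ' : ℂ}
    {X Y X' Y' : Matrix (Fin 2) (Fin 2) S} (h : IsQuantumDet κ X Y) (h' : IsQuantumDet κ' X' Y')
    (hc : ∀ i j k l, Commute (X' i j) (Y k l)) :
    IsQuantumDet (κ' * κ) (X * X') (Y * Y') := by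
  intro a b
  have e1 : ∀ i j, (X * X') a i * (Y * Y') b j =
      ∑ p, ∑ r, X a p * Y b r * (X' p i * Y' r j) := by
    intro i j
    simp only [Matrix.mul_apply, Finset.sum_mul_sum]
    refine Finset.sum_congr rfl fun p _ => Finset.sum_congr rfl fun r _ => ?_
    rw [mul_assoc, ← mul_assoc (X' p i), (hc p i b r).eq]
    simp only [mul_assoc]
  have e2 : ∑ i, ∑ j, antisymm i j • ((X * X') a i * (Y * Y') b j) =
      ∑ p, ∑ r, X a p * Y b r * ∑ i, ∑ j, antisymm i j • (X' p i * Y' r j) := by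
    simp only [e1, Fin.sum_univ_two, smul_add, mul_add, mul_smul_comm]
    abel
  rw [e2]
  simp only [h' _ _]
  rw [mul_assoc, map_mul, ← h a b, Finset.mul_sum]
  refine Finset.sum_congr rfl fun p _ => ?_
  rw [Finset.mul_sum]
  refine Finset.sum_congr rfl fun r _ => ?_
  rw [map_mul, ← mul_assoc, ← Algebra.commutes κ', mul_assoc, ← Algebra.commutes (antisymm p r),
    Algebra.smul_def]

/-! ### Operators at one site -/

variable {N : ℕ}

/-- The matrix unit `E_{ab}` at the site `n`. -/
def siteUnit (n : Fin N) (a b : Fin 2) : Op N := fun s t =>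
  if (∀ k, k ≠ n → s k = t k) ∧ s n = a ∧ t n = b then 1 else 0

theorem siteUnit_mulVec (n : Fin N) (a b : Fin 2) (v : Config N → ℂ) (s : Config N) :
    (siteUnit n a b *ᵥ v) s = if s n = a then v (Function.update s n b) else 0 := by
  rw [Matrix.mulVec, dotProduct, Finset.sum_eq_single (Function.update s n b)]
  · have h1 : ∀ k, k ≠ n → s k = Function.update s n b k := fun k hk => by
      rw [Function.update_of_ne hk]
    by_cases ha : s n = a
    · rw [siteUnit, if_pos ⟨h1, ha, Function.update_self _ _ _⟩, if_pos ha, one_mul]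
    · simp [siteUnit, ha]
  · intro t _ ht
    rw [siteUnit, if_neg, zero_mul]
    rintro ⟨h1, -, h2⟩
    refine ht (funext fun k => ?_)
    by_cases hk : k = n
    · subst hk
      simpa using h2
    · rw [Function.update_of_ne hk, h1 k hk]
  · simp

theorem siteUnit_mul_siteUnit (n : Fin N) (a b c d : Fin 2) :
    siteUnit n a b * siteUnit n c d = if b = c then siteUnit n a d else 0 := by
  refine Matrix.ext_iff_mulVec.2 fun v => funext fun s => ?_
  rw [← Matrix.mulVec_mulVec, siteUnit_mulVec, siteUnit_mulVec, Function.update_self,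
    Function.update_idem]
  by_cases hbc : b = c
  · simp [hbc, siteUnit_mulVec]
  · simp [hbc]

theorem siteUnit_commute {n n' : Fin N} (h : n ≠ n') (a b c d : Fin 2) :
    Commute (siteUnit n a b) (siteUnit n' c d) := by
  refine Matrix.ext_iff_mulVec.2 fun v => funext fun s => ?_
  simp only [← Matrix.mulVec_mulVec, siteUnit_mulVec, Function.update_of_ne h,
    Function.update_of_ne h.symm]
  rw [Function.update_comm h]
  split_ifs <;> rfl

theorem siteUnit_add (n : Fin N) : siteUnit n 0 0 + siteUnit n 1 1 = 1 := by
  refine Matrix.ext_iff_mulVec.2 fun v => funext fun s => ?_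
  rw [Matrix.add_mulVec, Pi.add_apply, siteUnit_mulVec, siteUnit_mulVec, Matrix.one_mulVec]
  by_cases hs : s n = 0
  · rw [if_pos hs, if_neg (by rw [hs]; decide), ← hs, Function.update_eq_self, add_zero]
  · have hs1 := fin_two_eq_one hs
    rw [if_neg hs, if_pos hs1, ← hs1, Function.update_eq_self, zero_add]

theorem rMatrix_apply (η l : ℂ) (a b c d : Fin 2) : rMatrix η l (a, b) (c, d) =
    (if a = c ∧ b = d then l else 0) + if a = d ∧ b = c then η else 0 := by
  fin_cases a <;> fin_cases b <;> fin_cases c <;> fin_cases d <;>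
    simp [rMatrix, finProdFinEquiv]

/-- R(λ) = λ + ηP, where the permutation P is ∑ E_{ab} ⊗ E_{ba}; this explains the transposed
indices of the matrix unit. -/
theorem rSite_apply (η : ℂ) (n : Fin N) (l : ℂ) (a b : Fin 2) :
    rSite η n l a b = (if a = b then l else 0) • (1 : Op N) + η • siteUnit n b a := by
  ext s t
  simp only [rSite, rMatrix_apply, Matrix.add_apply, Matrix.smul_apply, siteUnit, smul_eq_mul,
    Matrix.one_apply]
  by_cases hoff : ∀ k, k ≠ n → s k = t k
  · have hst : s = t ↔ s n = t n := by
      refine ⟨fun h => by rw [h], fun h => funext fun k => ?_⟩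
      by_cases hk : k = n
      · rw [hk, h]
      · exact hoff k hk
    rw [if_pos hoff]
    congr 1
    · by_cases hab : a = b <;> by_cases h1 : s n = t n <;> simp [hab, h1, hst]
    · have : (a = t n ∧ s n = b) ↔ ((∀ k, k ≠ n → s k = t k) ∧ s n = b ∧ t n = a) := by
        constructor
        · rintro ⟨h1, h2⟩
          exact ⟨hoff, h2, h1.symm⟩
        · rintro ⟨-, h2, h1⟩
          exact ⟨h1.symm, h2⟩
      simp only [this, mul_ite, mul_one, mul_zero]
  · have hst : s ≠ t := fun h => hoff fun k _ => by rw [h]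
    have h2 : ¬((∀ k, k ≠ n → s k = t k) ∧ s n = b ∧ t n = a) := fun h => hoff h.1
    rw [if_neg hoff, if_neg hst, if_neg h2]
    simp

theorem isRTT_rSite (η : ℂ) (n : Fin N) (l l' : ℂ) :
    IsRTT (l - l') η (rSite η n l) (rSite η n l') := by
  intro i j k r
  simp only [rSite_apply, mul_add, add_mul, smul_mul_smul_comm, one_mul, mul_one,
    siteUnit_mul_siteUnit]
  fin_cases i <;> fin_cases j <;> fin_cases k <;> fin_cases r <;> simp <;> module

theorem isQuantumDet_rSite (η : ℂ) (n : Fin N) (l : ℂ) :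
    IsQuantumDet (l * (l + 2 * η)) (rSite η n (l + η)) (rSite η n l) := by
  intro a b
  simp only [rSite_apply, mul_add, add_mul, smul_mul_smul_comm,
    siteUnit_mul_siteUnit, Fin.sum_univ_two, antisymm, Algebra.algebraMap_eq_smul_one,
    ← siteUnit_add n]
  fin_cases a <;> fin_cases b <;> simp <;> module

/-! ### The monodromy matrix of a list of sites -/

/-- The product of the local matrices over a list of sites. -/
def listMonodromy (ξ : Fin N → ℂ) (η : ℂ) (L : List (Fin N)) (l : ℂ) :
    Matrix (Fin 2) (Fin 2) (Op N) :=
  (L.map fun n => rSite η n (l - ξ n)).prod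

theorem listMonodromy_cons (ξ : Fin N → ℂ) (η : ℂ) (n : Fin N) (L : List (Fin N)) (l : ℂ) :
    listMonodromy ξ η (n :: L) l = rSite η n (l - ξ n) * listMonodromy ξ η L l := by
  simp [listMonodromy]

theorem listMonodromy_commute_siteUnit (ξ : Fin N → ℂ) (η : ℂ) {n : Fin N} {L : List (Fin N)}
    (hn : n ∉ L) (l : ℂ) (i j a b : Fin 2) :
    Commute (listMonodromy ξ η L l i j) (siteUnit n a b) := by
  induction L generalizing i j with
  | nil =>
    simp only [listMonodromy, List.map_nil, List.prod_nil, Matrix.one_apply]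
    split_ifs
    · exact Commute.one_left _
    · exact Commute.zero_left _
  | cons k L ih =>
    rw [List.mem_cons, not_or] at hn
    rw [listMonodromy_cons, Matrix.mul_apply]
    refine Commute.sum_left _ _ _ fun p _ => Commute.mul_left ?_ (ih hn.2 p j)
    rw [rSite_apply]
    exact ((Commute.one_left _).smul_left _).add_left
      ((siteUnit_commute (Ne.symm hn.1) _ _ _ _).smul_left _)

theorem listMonodromy_commute_rSite (ξ : Fin N → ℂ) (η : ℂ) {n : Fin N} {L : List (Fin N)}
    (hn : n ∉ L) (l l' : ℂ) (i j a b : Fin 2) :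
    Commute (listMonodromy ξ η L l i j) (rSite η n l' a b) := by
  rw [rSite_apply]
  exact ((Commute.one_right _).smul_right _).add_right
    ((listMonodromy_commute_siteUnit ξ η hn l i j _ _).smul_right _)

theorem isRTT_listMonodromy (ξ : Fin N → ℂ) (η : ℂ) {L : List (Fin N)} (hL : L.Nodup) (l l' : ℂ) :
    IsRTT (l - l') η (listMonodromy ξ η L l) (listMonodromy ξ η L l') := by
  induction L with
  | nil =>
    intro i j k r
    simp only [listMonodromy, List.map_nil, List.prod_nil, Matrix.one_apply]
    fin_cases i <;> fin_cases j <;> fin_cases k <;> fin_cases r <;> simp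
  | cons n L ih =>
    rw [List.nodup_cons] at hL
    rw [listMonodromy_cons, listMonodromy_cons]
    refine IsRTT.mul ?_ (ih hL.2)
      (fun i j k r => listMonodromy_commute_rSite ξ η hL.1 _ _ _ _ _ _)
      (fun i j k r => listMonodromy_commute_rSite ξ η hL.1 _ _ _ _ _ _)
    simpa using isRTT_rSite η n (l - ξ n) (l' - ξ n)

theorem isQuantumDet_listMonodromy (ξ : Fin N → ℂ) (η : ℂ) {L : List (Fin N)} (hL : L.Nodup)
    (l : ℂ) : IsQuantumDet ((L.map fun n => (l - ξ n) * (l - ξ n + 2 * η)).prod)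
      (listMonodromy ξ η L (l + η)) (listMonodromy ξ η L l) := by
  induction L with
  | nil =>
    intro a b
    simp only [listMonodromy, List.map_nil, List.prod_nil, Matrix.one_apply]
    fin_cases a <;> fin_cases b <;> simp [antisymm, Algebra.smul_def]
  | cons n L ih =>
    rw [List.nodup_cons] at hL
    rw [listMonodromy_cons, listMonodromy_cons, List.map_cons, List.prod_cons, mul_comm]
    refine IsQuantumDet.mul ?_ (ih hL.2)
      (fun i j k r => listMonodromy_commute_rSite ξ η hL.1 _ _ _ _ _ _)
    have := isQuantumDet_rSite η n (l - ξ n)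
    rwa [show l - ξ n + η = l + η - ξ n by ring] at this

theorem monodromy_eq_listMonodromy (ξ : Fin N → ℂ) (η l : ℂ) :
    monodromy ξ η l = listMonodromy ξ η (List.finRange N).reverse l := rfl

theorem nodup_finRange_reverse : (List.finRange N).reverse.Nodup :=
  List.nodup_reverse.2 (List.nodup_finRange N)

theorem isRTT_monodromy (ξ : Fin N → ℂ) (η l l' : ℂ) :
    IsRTT (l - l') η (monodromy ξ η l) (monodromy ξ η l') :=
  isRTT_listMonodromy ξ η nodup_finRange_reverse l l'

theorem opD_mul_opC (ξ : Fin N → ℂ) (η l l' : ℂ) :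
    (l - l' + η) • (opD ξ η l * opC ξ η l') =
      (l - l') • (opC ξ η l' * opD ξ η l) + η • (opD ξ η l' * opC ξ η l) := by
  rw [add_smul]
  exact isRTT_monodromy ξ η l l' 1 1 1 0

theorem opB_mul_opD (ξ : Fin N → ℂ) (η l l' : ℂ) :
    (l - l') • (opB ξ η l * opD ξ η l') + η • (opD ξ η l * opB ξ η l') =
      (l - l' + η) • (opD ξ η l' * opB ξ η l) := by
  rw [add_smul]
  exact isRTT_monodromy ξ η l l' 0 1 1 1

/-- The exchange relation gives the commutator times l - l' + η. If this number vanishes, the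
relation with l and l' interchanged has the factor 2η instead. -/
theorem opC_commute {η : ℂ} (hη : η ≠ 0) (ξ : Fin N → ℂ) (l l' : ℂ) :
    Commute (opC ξ η l) (opC ξ η l') := by
  have key : ∀ l l', (l - l' + η) • (opC ξ η l * opC ξ η l') =
      (l - l' + η) • (opC ξ η l' * opC ξ η l) := fun l l' => by
    rw [add_smul, add_smul]
    exact isRTT_monodromy ξ η l l' 1 0 1 0
  by_cases h : l - l' + η = 0
  · have h' : l' - l + η ≠ 0 := by
      intro h2
      have : 2 * η = 0 := by linear_combination h + h2
      simp [hη] at this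
    exact (smul_right_injective _ h' (key l' l)).symm
  · exact smul_right_injective _ h (key l l')

/-- An off-diagonal component of the quantum determinant relation. Wherever D(l + η) is a zero on
the covector, it makes CB a scalar. -/
theorem opC_mul_opB (ξ : Fin N → ℂ) (η l : ℂ) :
    opC ξ η (l + η) * opB ξ η l = opD ξ η (l + η) * monodromy ξ η l 0 0 -
      (funD ξ l * funA ξ η (l + η)) • (1 : Op N) := by
  have h := isQuantumDet_listMonodromy ξ η nodup_finRange_reverse l 1 0
  have hκ : ((List.finRange N).reverse.map fun n => (l - ξ n) * (l - ξ n + 2 * η)).prod =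
      funD ξ l * funA ξ η (l + η) := by
    rw [List.map_reverse, List.prod_reverse, ← Fin.prod_univ_def, Finset.prod_mul_distrib]
    congr 1
    exact Finset.prod_congr rfl fun n _ => by ring
  rw [hκ] at h
  simp only [Fin.sum_univ_two, antisymm, Algebra.algebraMap_eq_smul_one] at h
  simp only [← monodromy_eq_listMonodromy] at h
  simp only [opC, opB, opD]
  simp at h
  rw [← sub_eq_add_neg, sub_eq_iff_eq_add] at h
  rw [h, neg_add_eq_sub]

end

end XXXChain

namespace XXXChain

noncomputable section

open Matrix Polynomial

variable {N : ℕ}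

/-! ### The reference covector -/

/-- The reference covector, with all spins up. -/
def upBra (N : ℕ) : Bra N := Pi.single 0 1

theorem upBra_siteUnit (n : Fin N) (b : Fin 2) : upBra N ᵥ* siteUnit n 1 b = 0 := by
  rw [upBra, Matrix.single_one_vecMul]
  funext t
  simp [siteUnit, Matrix.row]

theorem upBra_siteUnit_zero (n : Fin N) : upBra N ᵥ* siteUnit n 0 0 = upBra N := by
  have h := congrArg (upBra N ᵥ* ·) (siteUnit_add n)
  simpa [Matrix.vecMul_add, upBra_siteUnit] using h

/-- The two claims are proved together: in the recursion for the lower diagonal entry, the spin flip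
at site n commutes with the remaining sites, and the covector meets the upper right entry first,
which kills it. -/
theorem upBra_listMonodromy (ξ : Fin N → ℂ) (η : ℂ) {L : List (Fin N)} (hL : L.Nodup) (l : ℂ) :
    upBra N ᵥ* listMonodromy ξ η L l 0 1 = 0 ∧
    upBra N ᵥ* listMonodromy ξ η L l 1 1 = (L.map fun n => l - ξ n).prod • upBra N := by
  induction L with
  | nil => simp [listMonodromy]
  | cons n L ih =>
    rw [List.nodup_cons] at hL
    obtain ⟨h0, h1⟩ := ih hL.2
    rw [listMonodromy_cons, Matrix.mul_apply, Matrix.mul_apply, Fin.sum_univ_two,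
      Fin.sum_univ_two, Matrix.vecMul_add, Matrix.vecMul_add]
    simp only [← Matrix.vecMul_vecMul]
    simp only [rSite_apply, Matrix.vecMul_add, Matrix.vecMul_smul, Matrix.vecMul_one,
      upBra_siteUnit, upBra_siteUnit_zero]
    have hcomm : upBra N ᵥ* siteUnit n 0 1 ᵥ* listMonodromy ξ η L l 0 1 = 0 := by
      rw [Matrix.vecMul_vecMul, ← (listMonodromy_commute_siteUnit ξ η hL.1 l 0 1 0 1).eq,
        ← Matrix.vecMul_vecMul, h0, Matrix.zero_vecMul]
    constructor
    · simp [Matrix.add_vecMul, Matrix.smul_vecMul, h0]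
    · simp [Matrix.smul_vecMul, h1, hcomm, smul_smul]

theorem upBra_opD (ξ : Fin N → ℂ) (η l : ℂ) : upBra N ᵥ* opD ξ η l = funD ξ l • upBra N := by
  rw [opD, monodromy_eq_listMonodromy, (upBra_listMonodromy ξ η nodup_finRange_reverse l).2,
    List.map_reverse, List.prod_reverse, ← Fin.prod_univ_def]
  rfl

/-! ### Polynomial dependence on the spectral parameter -/

/-- `f` is a polynomial function of degree less than `n`. -/
def IsPolyLT (n : ℕ) (f : ℂ → ℂ) : Prop := ∃ p : ℂ[X], p.degree < n ∧ ∀ l, f l = p.eval l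

theorem IsPolyLT.zero (n : ℕ) : IsPolyLT n fun _ => 0 :=
  ⟨0, by simp [bot_lt_iff_ne_bot], by simp⟩

theorem IsPolyLT.add {n : ℕ} {f g : ℂ → ℂ} (hf : IsPolyLT n f) (hg : IsPolyLT n g) :
    IsPolyLT n fun l => f l + g l := by
  obtain ⟨p, hp, hfp⟩ := hf
  obtain ⟨r, hr, hgr⟩ := hg
  exact ⟨p + r, (degree_add_le p r).trans_lt (max_lt hp hr), fun l => by simp [hfp, hgr]⟩

theorem IsPolyLT.const_mul {n : ℕ} {f : ℂ → ℂ} (hf : IsPolyLT n f) (c : ℂ) :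
    IsPolyLT n fun l => c * f l := by
  obtain ⟨p, hp, hfp⟩ := hf
  refine ⟨C c * p, ?_, fun l => by simp [hfp]⟩
  by_cases hc : c = 0
  · simp [hc, bot_lt_iff_ne_bot]
  · rwa [degree_C_mul hc]

theorem IsPolyLT.sum {ι : Type*} {n : ℕ} (s : Finset ι) {f : ι → ℂ → ℂ}
    (hf : ∀ i ∈ s, IsPolyLT n (f i)) : IsPolyLT n fun l => ∑ i ∈ s, f i l := by
  classical
  induction s using Finset.induction_on with
  | empty => simpa using IsPolyLT.zero n
  | insert a s ha ih =>
    simp only [Finset.sum_insert ha]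
    exact (hf a (Finset.mem_insert_self a s)).add
      (ih fun i hi => hf i (Finset.mem_insert_of_mem hi))

theorem IsPolyLT.mono {n k : ℕ} {f : ℂ → ℂ} (hf : IsPolyLT n f) (h : n ≤ k) : IsPolyLT k f := by
  obtain ⟨p, hp, hfp⟩ := hf
  exact ⟨p, hp.trans_le (Nat.cast_le.2 h), hfp⟩

theorem IsPolyLT.sub_mul {n : ℕ} {f : ℂ → ℂ} (hf : IsPolyLT n f) (c : ℂ) :
    IsPolyLT (n + 1) fun l => (l - c) * f l := by
  obtain ⟨p, hp, hfp⟩ := hf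
  refine ⟨(X - C c) * p, ?_, fun l => by simp [hfp]⟩
  by_cases h0 : p = 0
  · simp [h0, bot_lt_iff_ne_bot]
  · rw [degree_mul, degree_X_sub_C, degree_eq_natDegree h0]
    rw [degree_eq_natDegree h0, Nat.cast_lt] at hp
    rw [← Nat.cast_one, ← Nat.cast_add, Nat.cast_lt]
    omega

theorem IsPolyLT.continuous {n : ℕ} {f : ℂ → ℂ} (hf : IsPolyLT n f) : Continuous f := by
  obtain ⟨p, -, hfp⟩ := hf
  rw [funext hfp]
  exact p.continuous

/-- Lagrange interpolation. -/
theorem IsPolyLT.eq_sum {f : ℂ → ℂ} (hf : IsPolyLT N f) {x : Fin N → ℂ}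
    (hx : Function.Injective x) (l : ℂ) :
    f l = ∑ a, (∏ b ∈ Finset.univ.erase a, (l - x b) / (x a - x b)) * f (x a) := by
  obtain ⟨p, hp, hfp⟩ := hf
  have h := Lagrange.eq_interpolate (s := Finset.univ) (v := x) (f := p) hx.injOn
    (by simpa using hp)
  rw [hfp l]
  conv_lhs => rw [h]
  rw [Lagrange.interpolate_apply, eval_finsetSum]
  refine Finset.sum_congr rfl fun a _ => ?_
  rw [eval_mul, eval_C, hfp, mul_comm, Lagrange.basis, eval_prod]
  congr 1
  refine Finset.prod_congr rfl fun b _ => ?_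
  simp [Lagrange.basisDivisor, div_eq_inv_mul]

/-- In each local factor λ appears only on the auxiliary diagonal, so an off-diagonal entry loses at
least one power of λ. -/
theorem isPolyLT_listMonodromy (ξ : Fin N → ℂ) (η : ℂ) (L : List (Fin N)) (i j : Fin 2)
    (s t : Config N) :
    IsPolyLT (L.length + if i = j then 1 else 0) fun l => listMonodromy ξ η L l i j s t := by
  induction L generalizing i j s t with
  | nil =>
    simp only [listMonodromy, List.map_nil, List.prod_nil, Matrix.one_apply]
    by_cases hij : i = j
    · simp only [if_pos hij]
      exact ⟨C ((1 : Op N) s t), degree_C_le.trans_lt (by simp), by simp⟩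
    · simp only [if_neg hij]
      exact IsPolyLT.zero _
  | cons n L ih =>
    have key : ∀ l, listMonodromy ξ η (n :: L) l i j s t =
        (l - ξ n) * listMonodromy ξ η L l i j s t +
        ∑ k, ∑ u, (η * siteUnit n k i s u) * listMonodromy ξ η L l k j u t := by
      intro l
      rw [listMonodromy_cons, Matrix.mul_apply, Matrix.sum_apply]
      simp only [rSite_apply, add_mul, Matrix.add_apply, Finset.sum_add_distrib,
        Matrix.smul_apply, smul_eq_mul, ite_mul, zero_mul, Matrix.mul_apply, mul_assoc]
      congr 1
      rw [Finset.sum_eq_single i (fun k _ hk => by simp [hk.symm]) (by simp)]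
      simp [Matrix.one_apply]
    simp only [key, List.length_cons]
    refine IsPolyLT.add ?_ (IsPolyLT.sum _ fun k _ => IsPolyLT.sum _ fun u _ =>
      ((ih k j u t).const_mul _).mono ?_)
    · exact ((ih i j s t).sub_mul (ξ n)).mono (by omega)
    · split_ifs <;> omega

theorem isPolyLT_vecMul {n : ℕ} {T : ℂ → Op N} (hT : ∀ s t, IsPolyLT n fun l => T l s t)
    (v : Bra N) (t : Config N) : IsPolyLT n fun l => (v ᵥ* T l) t :=
  IsPolyLT.sum _ fun s _ => (hT s t).const_mul (v s)

theorem isPolyLT_opB (ξ : Fin N → ℂ) (η : ℂ) (s t : Config N) :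
    IsPolyLT N fun l => opB ξ η l s t := by
  simp only [opB, monodromy_eq_listMonodromy]
  simpa using isPolyLT_listMonodromy ξ η (List.finRange N).reverse 0 1 s t

theorem isPolyLT_opC (ξ : Fin N → ℂ) (η : ℂ) (s t : Config N) :
    IsPolyLT N fun l => opC ξ η l s t := by
  simp only [opC, monodromy_eq_listMonodromy]
  simpa using isPolyLT_listMonodromy ξ η (List.finRange N).reverse 1 0 s t

theorem continuous_vecMul_opD (ξ : Fin N → ℂ) (η : ℂ) (v : Bra N) :
    Continuous fun l => v ᵥ* opD ξ η l := by
  refine continuous_pi fun t => IsPolyLT.continuous (n := N + 1)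
    (isPolyLT_vecMul (fun s t => ?_) v t)
  simp only [opD, monodromy_eq_listMonodromy]
  simpa using isPolyLT_listMonodromy ξ η (List.finRange N).reverse 1 1 s t

/-! ### Ladder operators for the eigencovectors of `D` -/

/-- The factor l - μ cancels for l ≠ μ, and continuity covers the remaining point. -/
theorem eq_of_sub_smul_eq {f g : ℂ → Bra N} (hf : Continuous f) (hg : Continuous g) {μ : ℂ}
    (h : ∀ l, (l - μ) • f l = (l - μ) • g l) : f = g := by
  refine hf.ext_on (dense_compl_singleton μ) hg fun l hl => ?_
  exact smul_right_injective _ (sub_ne_zero.2 hl) (h l)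

/-- At a zero μ of the D-eigenvalue the term with D(μ) in the exchange relation drops out, so C(μ)
lowers this zero to μ - η and leaves the rest of the eigenvalue unchanged. -/
theorem vecMul_opC_vecMul_opD {ξ : Fin N → ℂ} {η : ℂ} {v : Bra N} {μ : ℂ} {g : ℂ → ℂ}
    (hg : Continuous g) (hv : ∀ l, v ᵥ* opD ξ η l = ((l - μ) * g l) • v) (l : ℂ) :
    v ᵥ* opC ξ η μ ᵥ* opD ξ η l = ((l - μ + η) * g l) • (v ᵥ* opC ξ η μ) := by
  refine congrFun (eq_of_sub_smul_eq (μ := μ) (continuous_vecMul_opD ξ η _)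
    (g := fun l => ((l - μ + η) * g l) • (v ᵥ* opC ξ η μ)) (by fun_prop) fun l => ?_) l
  have h := congrArg (v ᵥ* ·) (opD_mul_opC ξ η l μ)
  simp only [Matrix.vecMul_add, Matrix.vecMul_smul, ← Matrix.vecMul_vecMul, hv,
    Matrix.smul_vecMul, sub_self, zero_mul, zero_smul, Matrix.zero_vecMul,
    smul_zero, add_zero] at h
  rw [← h, smul_smul, smul_smul]
  congr 1
  ring

/-- By the same mechanism B(μ) raises the zero μ to μ + η. -/
theorem vecMul_opB_vecMul_opD {ξ : Fin N → ℂ} {η : ℂ} {v : Bra N} {μ : ℂ} {g : ℂ → ℂ}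
    (hg : Continuous g) (hv : ∀ l, v ᵥ* opD ξ η l = ((l - μ) * g l) • v) (l : ℂ) :
    v ᵥ* opB ξ η μ ᵥ* opD ξ η l = ((l - μ - η) * g l) • (v ᵥ* opB ξ η μ) := by
  refine congrFun (eq_of_sub_smul_eq (μ := μ) (continuous_vecMul_opD ξ η _)
    (g := fun l => ((l - μ - η) * g l) • (v ᵥ* opB ξ η μ)) (by fun_prop) fun l => ?_) l
  have h := congrArg (v ᵥ* ·) (opB_mul_opD ξ η μ l)
  simp only [Matrix.vecMul_add, Matrix.vecMul_smul, ← Matrix.vecMul_vecMul, hv,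
    Matrix.smul_vecMul, sub_self, zero_mul, zero_smul, Matrix.zero_vecMul,
    smul_zero, add_zero] at h
  rw [← neg_sub μ l, neg_smul, h, smul_smul, ← neg_smul, smul_smul]
  congr 1
  ring

end

end XXXChain

namespace XXXChain

noncomputable section

open Matrix

/-! ### The SoV basis -/

section SoVBasis

variable {N : ℕ} {ξ : Fin N → ℂ} {η : ℂ}

/-- The configuration with value `1` on the set `S`. -/
def indicatorConfig (S : Finset (Fin N)) : Config N := fun a => if a ∈ S then 1 else 0

theorem indicatorConfig_filter (h : Config N) :
    indicatorConfig (Finset.univ.filter fun a => h a = 1) = h := by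
  funext a
  by_cases ha : h a = 1
  · simp [indicatorConfig, ha]
  · have : h a = 0 := by omega
    simp [indicatorConfig, this]

theorem indicatorConfig_insert (S : Finset (Fin N)) (a : Fin N) :
    indicatorConfig (insert a S) = Function.update (indicatorConfig S) a 1 := by
  funext b
  by_cases hb : b = a
  · subst hb
    simp [indicatorConfig]
  · simp [indicatorConfig, hb]

/-- Induction on configurations, by changing one value from `0` to `1`. -/
theorem Config.induction {P : Config N → Prop} (h0 : P 0)
    (hs : ∀ h a, h a = 0 → P h → P (Function.update h a 1)) (h : Config N) : P h := by
  rw [← indicatorConfig_filter h]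
  generalize Finset.univ.filter (fun a => h a = 1) = S
  induction S using Finset.induction_on with
  | empty => exact h0
  | insert a S ha ih =>
    rw [indicatorConfig_insert]
    exact hs _ a (by simp [indicatorConfig, ha]) ih

theorem funD_ne_zero (hη : η ≠ 0)
    (hξ : ∀ a b, a ≠ b → ξ a ≠ ξ b ∧ ξ a ≠ ξ b + η ∧ ξ a ≠ ξ b - η) (a : Fin N) :
    funD ξ (ξ a - η) ≠ 0 := by
  refine Finset.prod_ne_zero_iff.2 fun b _ h => ?_
  by_cases hab : a = b
  · subst hab
    exact hη (by linear_combination -h)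
  · exact (hξ a b hab).2.1 (by linear_combination h)

theorem funA_ne_zero (hη : η ≠ 0)
    (hξ : ∀ a b, a ≠ b → ξ a ≠ ξ b ∧ ξ a ≠ ξ b + η ∧ ξ a ≠ ξ b - η) (a : Fin N) :
    funA ξ η (ξ a) ≠ 0 := by
  refine Finset.prod_ne_zero_iff.2 fun b _ h => ?_
  by_cases hab : a = b
  · subst hab
    exact hη (by linear_combination h)
  · exact (hξ a b hab).2.2 (by linear_combination h)

/-- The factor of the SoV covector at the site `a`. -/
def sovFactor (ξ : Fin N → ℂ) (η : ℂ) (h : Config N) (a : Fin N) : Op N :=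
  if h a = 1 then (funD ξ (ξ a - η))⁻¹ • opC ξ η (ξ a) else 1

theorem sovFactor_pairwise_commute (hη : η ≠ 0) (ξ : Fin N → ℂ) (h : Config N) :
    ((Finset.univ : Finset (Fin N)) : Set (Fin N)).Pairwise
      (Function.onFun Commute (sovFactor ξ η h)) := by
  intro a _ b _ _
  change Commute (sovFactor ξ η h a) (sovFactor ξ η h b)
  unfold sovFactor
  split_ifs
  · exact ((opC_commute hη ξ _ _).smul_left _).smul_right _
  · exact Commute.one_right _
  · exact Commute.one_left _
  · exact Commute.one_left _

/-- The SoV covectors, obtained from the reference covector by the action of `C(ξ_a)`. -/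
def sovBra (hη : η ≠ 0) (ξ : Fin N → ℂ) (h : Config N) : Bra N :=
  upBra N ᵥ* Finset.univ.noncommProd (sovFactor ξ η h)
    (sovFactor_pairwise_commute hη ξ h)

theorem sovBra_zero (hη : η ≠ 0) (ξ : Fin N → ℂ) : sovBra hη ξ 0 = upBra N := by
  unfold sovBra
  rw [Finset.noncommProd_eq_pow_card _ _ _ 1, one_pow, Matrix.vecMul_one]
  intro a _
  simp [sovFactor]

theorem sovBra_update (hη : η ≠ 0)
    (hξ : ∀ a b, a ≠ b → ξ a ≠ ξ b ∧ ξ a ≠ ξ b + η ∧ ξ a ≠ ξ b - η) {h : Config N} {a : Fin N}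
    (ha : h a = 0) : sovBra hη ξ h ᵥ* opC ξ η (ξ a) =
      funD ξ (ξ a - η) • sovBra hη ξ (Function.update h a 1) := by
  unfold sovBra
  rw [← Finset.noncommProd_erase_mul _ (Finset.mem_univ a),
    ← Finset.noncommProd_erase_mul _ (Finset.mem_univ a)]
  have h1 : sovFactor ξ η h a = 1 := by simp [sovFactor, ha]
  have h2 : sovFactor ξ η (Function.update h a 1) a =
      (funD ξ (ξ a - η))⁻¹ • opC ξ η (ξ a) := by simp [sovFactor]
  rw [h1, h2, mul_one, Matrix.mul_smul, Matrix.vecMul_smul, smul_smul,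
    mul_inv_cancel₀ (funD_ne_zero hη hξ a), one_smul, Matrix.vecMul_vecMul]
  congr 2
  refine Finset.noncommProd_congr rfl (fun b hb => ?_) _
  simp [sovFactor, Function.update_of_ne (Finset.ne_of_mem_erase hb)]

/-- Induction on the configuration: setting h_a to 1 applies C(ξ_a), which moves the zero ξ_a of the
eigenvalue to ξ_a - η. -/
theorem sovBra_opD (hη : η ≠ 0)
    (hξ : ∀ a b, a ≠ b → ξ a ≠ ξ b ∧ ξ a ≠ ξ b + η ∧ ξ a ≠ ξ b - η) (h : Config N) (l : ℂ) :
    sovBra hη ξ h ᵥ* opD ξ η l = funDh ξ η h l • sovBra hη ξ h := by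
  induction h using Config.induction generalizing l with
  | h0 =>
    rw [sovBra_zero, upBra_opD]
    simp [funD, funDh, xiShift]
  | hs h a ha ih =>
    have hx : xiShift ξ η h a = ξ a := by simp [xiShift, ha]
    have h1 := vecMul_opC_vecMul_opD (μ := ξ a)
      (g := fun l => ∏ b ∈ Finset.univ.erase a, (l - xiShift ξ η h b)) (by fun_prop)
      (fun l => by rw [ih l, funDh_eq_mul h a, hx]) l
    rw [sovBra_update hη hξ ha, Matrix.smul_vecMul, smul_comm] at h1
    rw [smul_right_injective _ (funD_ne_zero hη hξ a) h1, funDh_eq_mul _ a,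
      prod_erase_xiShift_update h a 1 fun x => l - x]
    congr 2
    simp [xiShift]
    ring

/-- In C(ξ_a) B(ξ_a - η) the term with D(ξ_a) vanishes on this covector; only the scalar -d(ξ_a - η)
a(ξ_a) of the quantum determinant survives. -/
theorem sovBra_update_opB (hη : η ≠ 0)
    (hξ : ∀ a b, a ≠ b → ξ a ≠ ξ b ∧ ξ a ≠ ξ b + η ∧ ξ a ≠ ξ b - η) {h : Config N} {a : Fin N}
    (ha : h a = 0) : sovBra hη ξ (Function.update h a 1) ᵥ* opB ξ η (ξ a - η) =
      -(funA ξ η (ξ a) • sovBra hη ξ h) := by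
  have h1 := congrArg (sovBra hη ξ h ᵥ* ·) (opC_mul_opB ξ η (ξ a - η))
  have h0 : funDh ξ η h (ξ a) = 0 :=
    Finset.prod_eq_zero (Finset.mem_univ a) (by simp [xiShift, ha])
  simp only [sub_add_cancel, ← Matrix.vecMul_vecMul, Matrix.vecMul_sub, sovBra_opD hη hξ, h0,
    zero_smul, Matrix.zero_vecMul, zero_sub, Matrix.vecMul_smul, Matrix.vecMul_one,
    sovBra_update hη hξ ha, Matrix.smul_vecMul, mul_smul, ← smul_neg] at h1
  rw [smul_right_injective _ (funD_ne_zero hη hξ a) h1, smul_neg]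

/-- B recovers the previous covector up to the nonzero factor -a(ξ_a), so nonvanishing propagates
from the reference covector. -/
theorem sovBra_ne_zero (hη : η ≠ 0)
    (hξ : ∀ a b, a ≠ b → ξ a ≠ ξ b ∧ ξ a ≠ ξ b + η ∧ ξ a ≠ ξ b - η) (h : Config N) :
    sovBra hη ξ h ≠ 0 := by
  induction h using Config.induction with
  | h0 =>
    rw [sovBra_zero]
    intro h
    simpa [upBra] using congrFun h 0
  | hs h a ha ih =>
    intro h0
    have h1 := sovBra_update_opB hη hξ ha
    rw [h0, Matrix.zero_vecMul, eq_comm, neg_eq_zero, smul_eq_zero] at h1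
    exact h1.elim (funA_ne_zero hη hξ a) ih

theorem xiShift_ne (hη : η ≠ 0)
    (hξ : ∀ a b, a ≠ b → ξ a ≠ ξ b ∧ ξ a ≠ ξ b + η ∧ ξ a ≠ ξ b - η) {h h' : Config N} {a b : Fin N}
    (hab : a ≠ b ∨ h a ≠ h' b) : xiShift ξ η h a ≠ xiShift ξ η h' b := by
  by_cases hne : a = b
  · subst hne
    intro he
    simp only [xiShift, sub_right_inj, mul_eq_mul_right_iff, hη, or_false, Nat.cast_inj] at he
    exact hab.elim (fun h => h rfl) fun h => h (Fin.ext he)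
  · obtain ⟨h1, h2, h3⟩ := hξ a b hne
    have hcases : ∀ (h : Config N) n, h n = 0 ∨ h n = 1 := fun h n => by omega
    rcases hcases h a with ha | ha <;> rcases hcases h' b with hb | hb <;>
      simp only [xiShift, ha, hb] <;> intro he
    · exact h1 (by simpa using he)
    · exact h3 (by simpa using he)
    · exact h2 (by simpa [sub_eq_iff_eq_add] using he)
    · exact h1 (by simpa using he)

theorem vecMul_prod_opD {v : Bra N} {f : ℂ → ℂ} (hv : ∀ l, v ᵥ* opD ξ η l = f l • v)
    (L : List ℂ) : v ᵥ* (L.map (opD ξ η)).prod = (L.map f).prod • v := by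
  induction L with
  | nil => simp
  | cons l L ih =>
    rw [List.map_cons, List.prod_cons, ← Matrix.vecMul_vecMul, hv, Matrix.smul_vecMul, ih,
      List.map_cons, List.prod_cons, smul_smul]

theorem linearIndependent_sovBra (hη : η ≠ 0)
    (hξ : ∀ a b, a ≠ b → ξ a ≠ ξ b ∧ ξ a ≠ ξ b + η ∧ ξ a ≠ ξ b - η) :
    LinearIndependent ℂ (sovBra hη ξ) := by
  rw [Fintype.linearIndependent_iff]
  intro c hc h₀
  -- The product of D over the points complementary to h₀ annihilates every covector that differs
  -- from h₀ at some site, and multiplies that of h₀ by a nonzero number.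
  set L : List ℂ := (List.finRange N).map (xiShift ξ η fun a => 1 - h₀ a)
  have hL : ∀ h, (L.map (funDh ξ η h)).prod =
      ∏ a, funDh ξ η h (xiShift ξ η (fun a => 1 - h₀ a) a) := fun h => by
    rw [List.map_map, Fin.prod_univ_def]
    rfl
  have hne : ∀ b, 1 - h₀ b ≠ h₀ b := fun b => by
    have : ∀ x : Fin 2, 1 - x ≠ x := by decide
    exact this _
  have h1 := congrArg (· ᵥ* (L.map (opD ξ η)).prod) hc
  simp only [Matrix.sum_vecMul, Matrix.smul_vecMul, Matrix.zero_vecMul,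
    vecMul_prod_opD (sovBra_opD hη hξ _)] at h1
  rw [Finset.sum_eq_single h₀] at h1
  · rw [smul_smul, smul_eq_zero, mul_eq_zero, or_iff_left (sovBra_ne_zero hη hξ h₀)] at h1
    refine h1.resolve_right ?_
    rw [hL]
    refine Finset.prod_ne_zero_iff.2 fun a _ => Finset.prod_ne_zero_iff.2 fun b _ =>
      sub_ne_zero.2 (xiShift_ne hη hξ ?_)
    by_cases hab : a = b
    · subst hab
      exact Or.inr (hne a)
    · exact Or.inl hab
  · intro h _ hh
    obtain ⟨a, ha⟩ := Function.ne_iff.1 hh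
    rw [hL, Finset.prod_eq_zero (Finset.mem_univ a), zero_smul, smul_zero]
    refine Finset.prod_eq_zero (Finset.mem_univ a) (sub_eq_zero.2 ?_)
    have : ∀ x y : Fin 2, x ≠ y → 1 - y = x := by decide
    simp only [xiShift, this _ _ ha]
  · simp

/-- The basis of the SoV covectors. -/
def sovBasis (hη : η ≠ 0)
    (hξ : ∀ a b, a ≠ b → ξ a ≠ ξ b ∧ ξ a ≠ ξ b + η ∧ ξ a ≠ ξ b - η) :
    Module.Basis (Config N) ℂ (Bra N) :=
  basisOfLinearIndependentOfCardEqFinrank (linearIndependent_sovBra hη hξ)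
    (by rw [Module.finrank_fintype_fun_eq_card])

theorem sovBasis_apply (hη : η ≠ 0)
    (hξ : ∀ a b, a ≠ b → ξ a ≠ ξ b ∧ ξ a ≠ ξ b + η ∧ ξ a ≠ ξ b - η) (h : Config N) :
    sovBasis hη hξ h = sovBra hη ξ h := by
  simp [sovBasis]

/-- A joint eigencovector of `D` with an eigenvalue that is not in the spectrum vanishes. -/
theorem eq_zero_of_vecMul_opD (hη : η ≠ 0)
    (hξ : ∀ a b, a ≠ b → ξ a ≠ ξ b ∧ ξ a ≠ ξ b + η ∧ ξ a ≠ ξ b - η) {w : Bra N} {f : ℂ → ℂ}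
    (hw : ∀ l, w ᵥ* opD ξ η l = f l • w) (a : Fin N) (h0 : f (ξ a) ≠ 0)
    (h1 : f (ξ a - η) ≠ 0) : w = 0 := by
  -- Every d_𝐡 vanishes at ξ_a or at ξ_a - η, so D(ξ_a) D(ξ_a - η) is zero on the whole basis.
  have hop : ∀ v : Bra N, v ᵥ* ([ξ a, ξ a - η].map (opD ξ η)).prod = 0 := by
    intro v
    rw [← (sovBasis hη hξ).sum_repr v, Matrix.sum_vecMul]
    refine Finset.sum_eq_zero fun h _ => ?_
    rw [sovBasis_apply, Matrix.smul_vecMul, vecMul_prod_opD (sovBra_opD hη hξ h)]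
    have hz : ([ξ a, ξ a - η].map (funDh ξ η h)).prod = 0 := by
      have hcases : h a = 0 ∨ h a = 1 := by omega
      rcases hcases with ha | ha
      · have : funDh ξ η h (ξ a) = 0 :=
          Finset.prod_eq_zero (Finset.mem_univ a) (by simp [xiShift, ha])
        simp [this]
      · have : funDh ξ η h (ξ a - η) = 0 :=
          Finset.prod_eq_zero (Finset.mem_univ a) (by simp [xiShift, ha])
        simp [this]
    rw [hz, zero_smul, smul_zero]
  have := hop w
  rw [vecMul_prod_opD hw, smul_eq_zero] at this
  refine this.resolve_left ?_
  simp [h0, h1]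

theorem prod_erase_ne_zero (hη : η ≠ 0)
    (hξ : ∀ a b, a ≠ b → ξ a ≠ ξ b ∧ ξ a ≠ ξ b + η ∧ ξ a ≠ ξ b - η) (h h' : Config N)
    (a : Fin N) :
    ∏ b ∈ Finset.univ.erase a, (xiShift ξ η h' a - xiShift ξ η h b) ≠ 0 :=
  Finset.prod_ne_zero_iff.2 fun _ hb =>
    sub_ne_zero.2 (xiShift_ne hη hξ (Or.inl (Finset.ne_of_mem_erase hb).symm))

/-- The result would be an eigencovector of D whose zero at site a is lowered to ξ_a - 2η; no such
eigenvalue occurs. -/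
theorem sovBra_opC_eq_zero (hη : η ≠ 0)
    (hξ : ∀ a b, a ≠ b → ξ a ≠ ξ b ∧ ξ a ≠ ξ b + η ∧ ξ a ≠ ξ b - η) {h : Config N} {a : Fin N}
    (ha : h a = 1) : sovBra hη ξ h ᵥ* opC ξ η (ξ a - η) = 0 := by
  have hx : xiShift ξ η h a = ξ a - η := by simp [xiShift, ha]
  have h1 := vecMul_opC_vecMul_opD (μ := ξ a - η)
    (g := fun l => ∏ b ∈ Finset.univ.erase a, (l - xiShift ξ η h b)) (by fun_prop)
    (fun l => by rw [sovBra_opD hη hξ, funDh_eq_mul h a, hx])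
  have p0 := prod_erase_ne_zero hη hξ h (fun _ => 0) a
  have p1 := prod_erase_ne_zero hη hξ h (fun _ => 1) a
  simp only [xiShift, Fin.val_zero, Fin.val_one, Nat.cast_zero, Nat.cast_one, zero_mul, one_mul,
    sub_zero] at p0 p1
  refine eq_zero_of_vecMul_opD hη hξ h1 a (mul_ne_zero ?_ p0) (mul_ne_zero ?_ p1)
  · rw [show ξ a - (ξ a - η) + η = 2 * η by ring]
    simpa using hη
  · simpa using hη

/-- Here the zero at site a would be raised to ξ_a + η, again outside the spectrum. -/
theorem sovBra_opB_eq_zero (hη : η ≠ 0)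
    (hξ : ∀ a b, a ≠ b → ξ a ≠ ξ b ∧ ξ a ≠ ξ b + η ∧ ξ a ≠ ξ b - η) {h : Config N} {a : Fin N}
    (ha : h a = 0) : sovBra hη ξ h ᵥ* opB ξ η (ξ a) = 0 := by
  have hx : xiShift ξ η h a = ξ a := by simp [xiShift, ha]
  have h1 := vecMul_opB_vecMul_opD (μ := ξ a)
    (g := fun l => ∏ b ∈ Finset.univ.erase a, (l - xiShift ξ η h b)) (by fun_prop)
    (fun l => by rw [sovBra_opD hη hξ, funDh_eq_mul h a, hx])
  have p0 := prod_erase_ne_zero hη hξ h (fun _ => 0) a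
  have p1 := prod_erase_ne_zero hη hξ h (fun _ => 1) a
  simp only [xiShift, Fin.val_zero, Fin.val_one, Nat.cast_zero, Nat.cast_one, zero_mul, one_mul,
    sub_zero] at p0 p1
  refine eq_zero_of_vecMul_opD hη hξ h1 a (mul_ne_zero ?_ p0) (mul_ne_zero ?_ p1)
  · simpa using hη
  · rw [show ξ a - η - ξ a - η = -(2 * η) by ring]
    simpa using hη

/-- The components of the images under B and C are polynomials of degree less than N, so they are
interpolated from the points ξ_a^{(h_a)}. There the operator either changes h_a or gives zero. -/
theorem isLeftSoVBasis_sovBasis (hη : η ≠ 0)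
    (hξ : ∀ a b, a ≠ b → ξ a ≠ ξ b ∧ ξ a ≠ ξ b + η ∧ ξ a ≠ ξ b - η) :
    IsLeftSoVBasis ξ η (sovBasis hη hξ) where
  D_left h l := by rw [sovBasis_apply, sovBra_opD hη hξ]
  C_left h l := by
    simp only [sovBasis_apply]
    funext t
    rw [IsPolyLT.eq_sum (isPolyLT_vecMul (isPolyLT_opC ξ η) (sovBra hη ξ h) t)
      (xiShift_injective hξ h) l, Finset.sum_apply]
    refine Finset.sum_congr rfl fun a _ => ?_
    split_ifs with ha
    · have hx : xiShift ξ η h a = ξ a := by simp [xiShift, ha]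
      conv_lhs => rw [hx, sovBra_update hη hξ ha]
      simp only [Pi.smul_apply, smul_eq_mul, hx]
      ring
    · have ha1 := fin_two_eq_one ha
      have hx : xiShift ξ η h a = ξ a - η := by simp [xiShift, ha1]
      rw [hx, sovBra_opC_eq_zero hη hξ ha1]
      simp
  B_left h l := by
    simp only [sovBasis_apply]
    funext t
    rw [IsPolyLT.eq_sum (isPolyLT_vecMul (isPolyLT_opB ξ η) (sovBra hη ξ h) t)
      (xiShift_injective hξ h) l, Pi.neg_apply, Finset.sum_apply, ← Finset.sum_neg_distrib]
    refine Finset.sum_congr rfl fun a _ => ?_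
    split_ifs with ha
    · have hx : xiShift ξ η h a = ξ a - η := by simp [xiShift, ha]
      have hu := sovBra_update_opB hη hξ (h := Function.update h a 0) (a := a) (by simp)
      rw [Function.update_idem, ← ha, Function.update_eq_self] at hu
      conv_lhs => rw [hx, hu]
      simp only [Pi.smul_apply, Pi.neg_apply, smul_eq_mul, hx]
      ring
    · have ha0 : h a = 0 := by omega
      have hx : xiShift ξ η h a = ξ a := by simp [xiShift, ha0]
      rw [hx, sovBra_opB_eq_zero hη hξ ha0]
      simp

end SoVBasis

end

end XXXChain

namespace XXXChain

noncomputable section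

open Matrix

/-! ### Action on states in the SoV basis -/

theorem prod_prod_eq_mul_erase {ι : Type*} [Fintype ι] [DecidableEq ι] (g : ι → ι → ℂ) (a : ι)
    (ha : g a a = 1) : ∏ i, ∏ j, g i j = (∏ b ∈ Finset.univ.erase a, g a b * g b a) *
      ∏ i ∈ Finset.univ.erase a, ∏ j ∈ Finset.univ.erase a, g i j := by
  have h : ∀ i, ∏ j, g i j = g i a * ∏ j ∈ Finset.univ.erase a, g i j := fun i =>
    (Finset.mul_prod_erase _ _ (Finset.mem_univ a)).symm
  rw [← Finset.mul_prod_erase _ _ (Finset.mem_univ a), h a, ha, one_mul,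
    Finset.prod_congr rfl fun i _ => h i, Finset.prod_mul_distrib, Finset.prod_mul_distrib,
    mul_assoc]

/-- As a function of its entry at a, the Vandermonde product is a constant K times ∏_b (y - x_b);
both sides compare its values at x_a and at y. -/
theorem vdm_update {N : ℕ} (x : Fin N → ℂ) (a : Fin N) (y : ℂ) :
    vdm (Function.update x a y) * ∏ b ∈ Finset.univ.erase a, (x a - x b) =
      vdm x * ∏ b ∈ Finset.univ.erase a, (y - x b) := by
  have key : ∃ K, ∀ y, vdm (Function.update x a y) =
      K * ∏ b ∈ Finset.univ.erase a, (y - x b) := by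
    -- The signs account for the pairs a < b, which contribute x_b - y; the second product collects
    -- the pairs that avoid a.
    refine ⟨(∏ b ∈ Finset.univ.erase a, if a < b then (-1 : ℂ) else 1) *
      ∏ i ∈ Finset.univ.erase a, ∏ j ∈ Finset.univ.erase a, if i < j then x j - x i else 1,
      fun y => ?_⟩
    have h1 : vdm (Function.update x a y) = ∏ i, ∏ j,
        if i < j then Function.update x a y j - Function.update x a y i else 1 := by
      refine Finset.prod_congr rfl fun i _ => ?_
      rw [← Finset.prod_filter]
      refine Finset.prod_congr ?_ fun _ _ => rfl
      ext j
      simp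
    rw [h1, prod_prod_eq_mul_erase _ a (if_neg (lt_irrefl a)), mul_right_comm]
    conv_rhs => rw [← Finset.prod_mul_distrib]
    congr 1
    · refine Finset.prod_congr rfl fun b hb => ?_
      have hb := Finset.ne_of_mem_erase hb
      rw [Function.update_self, Function.update_of_ne hb]
      rcases lt_or_gt_of_ne hb with h | h
      · rw [if_neg h.not_gt, if_pos h, if_neg h.not_gt]
      · rw [if_pos h, if_neg h.not_gt, if_pos h]
        ring
    · refine Finset.prod_congr rfl fun i hi => Finset.prod_congr rfl fun j hj => ?_
      rw [Function.update_of_ne (Finset.ne_of_mem_erase hi),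
        Function.update_of_ne (Finset.ne_of_mem_erase hj)]
  obtain ⟨K, hK⟩ := key
  have h2 := hK (x a)
  rw [Function.update_eq_self] at h2
  rw [hK y, h2]
  ring

section Action

variable {N R : ℕ} {ξ : Fin N → ℂ} {η : ℂ} {bra : Module.Basis (Config N) ℂ (Bra N)}

/-- The state with coefficients `φ(𝐡) V(ξ^{(𝐡)})` in a given basis. -/
def stateOf (ξ : Fin N → ℂ) (η : ℂ) (bra : Module.Basis (Config N) ℂ (Bra N))
    (φ : Config N → ℂ) : Bra N :=
  ∑ h, (φ h * vdm (xiShift ξ η h)) • bra h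

theorem xiShift_update (h : Config N) (a : Fin N) (e : Fin 2) :
    xiShift ξ η (Function.update h a e) =
      Function.update (xiShift ξ η h) a (ξ a - ((e : ℕ) : ℂ) * η) := by
  funext b
  by_cases hb : b = a
  · subst hb
    simp [xiShift]
  · rw [xiShift_update_of_ne h hb, Function.update_of_ne hb]

theorem sum_config_update {M : Type*} [AddCommMonoid M] (a : Fin N) (e e' : Fin 2)
    (G : Config N → M) :
    ∑ h : Config N, (if h a = e' then G h else 0) =
      ∑ h : Config N, if h a = e then G (Function.update h a e') else 0 := by
  rw [← Finset.sum_filter, ← Finset.sum_filter]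
  refine Finset.sum_nbij' (fun h => Function.update h a e) (fun h => Function.update h a e')
    ?_ ?_ ?_ ?_ ?_
  · intro h _
    simp
  · intro h _
    simp
  · intro h hh
    rw [Finset.mem_filter] at hh
    rw [Function.update_idem, ← hh.2, Function.update_eq_self]
  · intro h hh
    rw [Finset.mem_filter] at hh
    rw [Function.update_idem, ← hh.2, Function.update_eq_self]
  · intro h hh
    rw [Finset.mem_filter] at hh
    rw [Function.update_idem, ← hh.2, Function.update_eq_self]

/-- The action of an operator that changes the value of one `h_a` from `e'` to `e`. -/
theorem stateOf_vecMul_of_shift (hη : η ≠ 0)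
    (hξ : ∀ a b, a ≠ b → ξ a ≠ ξ b ∧ ξ a ≠ ξ b + η ∧ ξ a ≠ ξ b - η) {T : Op N} {e e' : Fin 2}
    {l : ℂ} {w : Fin N → ℂ} (hT : ∀ h, bra h ᵥ* T = ∑ a, if h a = e' then
      (w a * ∏ b ∈ Finset.univ.erase a,
        (l - xiShift ξ η h b) / (xiShift ξ η h a - xiShift ξ η h b)) •
        bra (Function.update h a e) else 0) (φ : Config N → ℂ) :
    stateOf ξ η bra φ ᵥ* T = stateOf ξ η bra fun h => ∑ a, if h a = e then
      w a * (∏ b ∈ Finset.univ.erase a, (l - xiShift ξ η h b)) *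
        (∏ b ∈ Finset.univ.erase a, (xiShift ξ η h a - xiShift ξ η h b))⁻¹ *
        φ (Function.update h a e') else 0 := by
  unfold stateOf
  simp only [Matrix.sum_vecMul, Matrix.smul_vecMul, hT, Finset.smul_sum, Finset.sum_mul,
    Finset.sum_smul, smul_ite, smul_zero]
  rw [Finset.sum_comm]
  conv_rhs => rw [Finset.sum_comm]
  refine Finset.sum_congr rfl fun a _ => ?_
  rw [sum_config_update a e e']
  refine Finset.sum_congr rfl fun h _ => ?_
  split_ifs with ha
  · rw [Function.update_idem, ← ha, Function.update_eq_self, smul_smul]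
    congr 1
    -- The Lagrange denominators belong to the configuration before the change. The Vandermonde
    -- ratio exchanges them for those of 𝐡, that is, for the residue weight of 1/d_𝐡.
    have hv := vdm_update (xiShift ξ η h) a (xiShift ξ η (Function.update h a e') a)
    have h1 := prod_erase_ne_zero hη hξ h h a
    have h2 := prod_erase_ne_zero hη hξ h (Function.update h a e') a
    have hupd : Function.update (xiShift ξ η h) a (xiShift ξ η (Function.update h a e') a) =
        xiShift ξ η (Function.update h a e') := by
      rw [xiShift_update, Function.update_self]
    rw [hupd] at hv
    rw [Finset.prod_div_distrib, prod_erase_xiShift_update h a e' fun x => l - x,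
      prod_erase_xiShift_update h a e' fun x => xiShift ξ η (Function.update h a e') a - x]
    generalize ∏ b ∈ Finset.univ.erase a, (xiShift ξ η h a - xiShift ξ η h b) = p₁ at h1 hv ⊢
    generalize ∏ b ∈ Finset.univ.erase a,
      (xiShift ξ η (Function.update h a e') a - xiShift ξ η h b) = p₂ at h2 hv ⊢
    field_simp
    linear_combination φ (Function.update h a e') * w a *
      (∏ b ∈ Finset.univ.erase a, (l - xiShift ξ η h b)) * hv
  · simp

theorem stateOf_congr {φ ψ : Config N → ℂ} (h : ∀ h, φ h = ψ h) :
    stateOf ξ η bra φ = stateOf ξ η bra ψ := by rw [funext h]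

theorem stateOf_opD (hbra : IsLeftSoVBasis ξ η bra) (φ : Config N → ℂ) (l : ℂ) :
    stateOf ξ η bra φ ᵥ* opD ξ η l = stateOf ξ η bra fun h => funDh ξ η h l * φ h := by
  unfold stateOf
  rw [Matrix.sum_vecMul]
  refine Finset.sum_congr rfl fun h _ => ?_
  rw [Matrix.smul_vecMul, hbra.D_left, smul_smul]
  congr 1
  ring

/-- D is diagonal with nonzero eigenvalues in the given basis, hence invertible, and the matrix
inverse is a genuine one. -/
theorem stateOf_opD_inv (hbra : IsLeftSoVBasis ξ η bra) (φ : Config N → ℂ) {l : ℂ}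
    (hl : ∀ h : Config N, funDh ξ η h l ≠ 0) :
    stateOf ξ η bra φ ᵥ* (opD ξ η l)⁻¹ = stateOf ξ η bra fun h => (funDh ξ η h l)⁻¹ * φ h := by
  have hunit : IsUnit (opD ξ η l) := by
    rw [← Matrix.vecMul_injective_iff_isUnit]
    intro v w hvw
    have hvw : v ᵥ* opD ξ η l = w ᵥ* opD ξ η l := hvw
    refine bra.repr.injective (Finsupp.ext fun h => ?_)
    have hrepr : ∀ v : Bra N, bra.repr (v ᵥ* opD ξ η l) h = bra.repr v h * funDh ξ η h l := by
      intro v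
      conv_lhs => rw [← bra.sum_repr v]
      simp only [Matrix.sum_vecMul, Matrix.smul_vecMul, hbra.D_left, smul_smul]
      rw [bra.repr_sum_self]
    have := hrepr v
    rw [hvw, hrepr w] at this
    exact (mul_right_cancel₀ (hl h) this).symm
  have h1 : stateOf ξ η bra φ =
      stateOf ξ η bra (fun h => (funDh ξ η h l)⁻¹ * φ h) ᵥ* opD ξ η l := by
    rw [stateOf_opD hbra]
    exact stateOf_congr fun h => (mul_inv_cancel_left₀ (hl h) _).symm
  rw [h1, Matrix.vecMul_vecMul, Matrix.mul_nonsing_inv _ ((Matrix.isUnit_iff_isUnit_det _).1 hunit),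
    Matrix.vecMul_one]

theorem stateOf_opB (hη : η ≠ 0)
    (hξ : ∀ a b, a ≠ b → ξ a ≠ ξ b ∧ ξ a ≠ ξ b + η ∧ ξ a ≠ ξ b - η)
    (hbra : IsLeftSoVBasis ξ η bra) (φ : Config N → ℂ) {l : ℂ}
    (hl : ∀ (h : Config N) a, l - xiShift ξ η h a ≠ 0) :
    stateOf ξ η bra φ ᵥ* opB ξ η l = stateOf ξ η bra fun h =>
      -(funDh ξ η h l * ∑ a, if h a = 0 then (l - xiShift ξ η h a)⁻¹ * funA ξ η (ξ a) *
        (∏ b ∈ Finset.univ.erase a, (xiShift ξ η h a - xiShift ξ η h b))⁻¹ *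
        φ (Function.update h a 1) else 0) := by
  have h1 := stateOf_vecMul_of_shift (bra := bra) hη hξ (T := opB ξ η l) (e := 0) (e' := 1)
    (l := l) (w := fun a => -funA ξ η (ξ a)) (fun h => by
      rw [hbra.B_left, ← Finset.sum_neg_distrib]
      refine Finset.sum_congr rfl fun a _ => ?_
      split_ifs
      · rw [neg_mul, neg_smul]
      · exact neg_zero) φ
  rw [h1]
  refine stateOf_congr fun h => ?_
  rw [Finset.mul_sum, ← Finset.sum_neg_distrib]
  refine Finset.sum_congr rfl fun a _ => ?_
  split_ifs
  · rw [funDh_eq_mul h a]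
    have := hl h a
    field_simp
  · ring

theorem stateOf_opC (hη : η ≠ 0)
    (hξ : ∀ a b, a ≠ b → ξ a ≠ ξ b ∧ ξ a ≠ ξ b + η ∧ ξ a ≠ ξ b - η)
    (hbra : IsLeftSoVBasis ξ η bra) (φ : Config N → ℂ) {l : ℂ}
    (hl : ∀ (h : Config N) a, l - xiShift ξ η h a ≠ 0) :
    stateOf ξ η bra φ ᵥ* opC ξ η l = stateOf ξ η bra fun h =>
      funDh ξ η h l * ∑ a, if h a = 1 then (l - xiShift ξ η h a)⁻¹ * funD ξ (ξ a - η) *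
        (∏ b ∈ Finset.univ.erase a, (xiShift ξ η h a - xiShift ξ η h b))⁻¹ *
        φ (Function.update h a 0) else 0 := by
  rw [stateOf_vecMul_of_shift hη hξ (e := 1) (fun h => hbra.C_left h l) φ]
  refine stateOf_congr fun h => ?_
  rw [Finset.mul_sum]
  refine Finset.sum_congr rfl fun a _ => ?_
  split_ifs
  · rw [funDh_eq_mul h a]
    have := hl h a
    field_simp
  · ring

/-- The eigenvalue of D⁻¹ belongs to the configuration before the action of C. Its mismatch with
d_𝐡(l + η) from C is a single quotient, which turns the pole at l + η = ξ_a^{(h_a)} into one at l =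
ξ_a^{(h_a)}; no global factor d_𝐡 remains. -/
theorem stateOf_opD_inv_opC (hη : η ≠ 0)
    (hξ : ∀ a b, a ≠ b → ξ a ≠ ξ b ∧ ξ a ≠ ξ b + η ∧ ξ a ≠ ξ b - η)
    (hbra : IsLeftSoVBasis ξ η bra) (φ : Config N → ℂ) {l : ℂ}
    (hl : ∀ (h : Config N) a, l + η - xiShift ξ η h a ≠ 0) :
    stateOf ξ η bra φ ᵥ* (opD ξ η (l + η))⁻¹ ᵥ* opC ξ η (l + η) = stateOf ξ η bra fun h =>
      ∑ a, if h a = 1 then (l - xiShift ξ η h a)⁻¹ * funD ξ (ξ a - η) *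
        (∏ b ∈ Finset.univ.erase a, (xiShift ξ η h a - xiShift ξ η h b))⁻¹ *
        φ (Function.update h a 0) else 0 := by
  have hd : ∀ h : Config N, funDh ξ η h (l + η) ≠ 0 := fun h =>
    Finset.prod_ne_zero_iff.2 fun a _ => hl h a
  rw [stateOf_opD_inv hbra φ hd, stateOf_opC hη hξ hbra _ hl]
  refine stateOf_congr fun h => ?_
  rw [Finset.mul_sum]
  refine Finset.sum_congr rfl fun a _ => ?_
  split_ifs with ha
  · have h1 : l + η - xiShift ξ η (Function.update h a 0) a = l - xiShift ξ η h a := by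
      simp [xiShift, ha]
      ring
    have h2 := hl h a
    have h3 := hl (Function.update h a 0) a
    have h4 : ∏ b ∈ Finset.univ.erase a, (l + η - xiShift ξ η h b) ≠ 0 :=
      Finset.prod_ne_zero_iff.2 fun b _ => hl h b
    rw [funDh_eq_mul h a, funDh_eq_mul (Function.update h a 0) a,
      prod_erase_xiShift_update h a 0 fun x => l + η - x, h1]
    rw [h1] at h3
    field_simp
  · ring

end Action

end

end XXXChain

namespace XXXChain

noncomputable section

open Matrix

/-! ### The recursion for the coefficients -/

section Coefficients

variable {N R : ℕ} {ξ : Fin N → ℂ} {η : ℂ} {q : Fin R → ℂ} {lam : ℕ → ℂ} {m : ℕ}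
  {ε : ℕ → Fin 2} {U : Set ℂ} {ρ : ℝ} {bra : Module.Basis (Config N) ℂ (Bra N)}

/-- The indices `ε`, with the variables `z_k`, `M < k ≤ 2m`, removed. -/
def cutIndices (m : ℕ) (ε : ℕ → Fin 2) (M : ℕ) (k : ℕ) : Fin 2 :=
  if M < k ∧ k ≤ 2 * m then 1 else ε k

theorem cutIndices_two_mul : cutIndices m ε (2 * m) = ε := by
  funext k
  exact if_neg (by omega)

theorem cutIndices_succ_of_absent {M : ℕ} (h0 : ε (M + 1) ≠ 0) :
    cutIndices m ε (M + 1) = cutIndices m ε M := by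
  funext k
  unfold cutIndices
  by_cases hk : k = M + 1
  · subst hk
    rw [if_neg (by omega)]
    split_ifs
    · exact fin_two_eq_one h0
    · rfl
  · exact if_congr (by omega) rfl rfl

theorem update_cutIndices_succ {M : ℕ} (hM : M + 1 ≤ 2 * m) :
    Function.update (cutIndices m ε (M + 1)) (M + 1) 1 = cutIndices m ε M := by
  funext k
  by_cases hk : k = M + 1
  · subst hk
    rw [Function.update_self]
    exact (if_pos (by omega)).symm
  · rw [Function.update_of_ne hk]
    exact if_congr (by omega) rfl rfl

theorem cutIndices_ne_zero {M k : ℕ} (hk : k ∈ Finset.Ioc M (2 * m)) : cutIndices m ε M k ≠ 0 := by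
  unfold cutIndices
  rw [if_pos (Finset.mem_Ioc.1 hk)]
  exact one_ne_zero

/-- The iterated integral over the variables `z_1, …, z_M` that are present, along circles. -/
def cutIntegral (ξ : Fin N → ℂ) (η : ℂ) (q : Fin R → ℂ) (lam : ℕ → ℂ) (m : ℕ) (ε : ℕ → Fin 2)
    (ρ : ℝ) (M : ℕ) (h : Config N) : ℂ :=
  iteratedIntegral (cutIndices m ε M) (fun i _ => circleContour ξ η ρ i)
    (innerIntegrand ξ η q lam m (cutIndices m ε M) h (2 * m)) (2 * m) 0

theorem cutIntegral_zero (h : Config N) : cutIntegral ξ η q lam m ε ρ 0 h = 1 := by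
  unfold cutIntegral
  rw [iteratedIntegral_innerIntegrand_of_forall_absent _ h (Nat.zero_le _)
    fun l hl => cutIndices_ne_zero hl]
  simp [iteratedIntegral, innerIntegrand]

theorem cutIntegral_succ_of_absent {M : ℕ} (h0 : ε (M + 1) ≠ 0) :
    cutIntegral ξ η q lam m ε ρ (M + 1) = cutIntegral ξ η q lam m ε ρ M := by
  unfold cutIntegral
  rw [cutIndices_succ_of_absent h0]

theorem cutIntegral_succ (hU : IsRegion ξ η q lam m U)
    (hξ : ∀ a b, a ≠ b → ξ a ≠ ξ b ∧ ξ a ≠ ξ b + η ∧ ξ a ≠ ξ b - η) (hρ : 0 < ρ)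
    (hsep : ∀ a b, a ≠ b → 2 * ρ ≤ dist (ξ a) (ξ b)) (hball : ∀ n, Metric.ball (ξ n) ρ ⊆ U)
    {M : ℕ} (hM : M + 1 ≤ 2 * m) (h0 : ε (M + 1) = 0) (h : Config N) :
    cutIntegral ξ η q lam m ε ρ (M + 1) h =
      ∑ a, if h a = (if Even (M + 1) then 0 else 1) then
        2 * (Real.pi : ℂ) * Complex.I * restFactor η q lam (M + 1) (xiShift ξ η h a) *
          numFactor ξ η (M + 1) (xiShift ξ η h a) *
          (∏ b ∈ Finset.univ.erase a, (xiShift ξ η h a - xiShift ξ η h b))⁻¹ *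
          cutIntegral ξ η q lam m ε ρ M (flip (M + 1) h a)
      else 0 := by
  have hcut : cutIndices m ε (M + 1) (M + 1) = 0 := by
    unfold cutIndices
    rwa [if_neg (by omega)]
  unfold cutIntegral
  rw [iteratedIntegral_eq_sum_flip hU hξ hρ hsep hball hM hcut
    (fun k hk => cutIndices_ne_zero hk) h, update_cutIndices_succ hM]

/-- The factor `∏_{k ≤ j} d_𝐡(λ_k) ∏ₙ Q(ξ_n^{(h_n)})`. -/
def weight (ξ : Fin N → ℂ) (η : ℂ) (q : Fin R → ℂ) (lam : ℕ → ℂ) (j : ℕ) (h : Config N) : ℂ :=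
  (∏ k ∈ Finset.Icc 1 j, funDh ξ η h (lam k)) * ∏ n, funQ q (xiShift ξ η h n)

theorem weight_succ (j : ℕ) (h : Config N) :
    weight ξ η q lam (j + 1) h = funDh ξ η h (lam (j + 1)) * weight ξ η q lam j h := by
  unfold weight
  rw [Finset.prod_Icc_succ_top (by omega)]
  ring

/-- Only the factors at site a change. For a genuine flip their ratios are the quotients of Q and
the products over λ_k in the integrand, at the residue point; k runs up to j because the next
operator has index j + 1. -/
theorem weight_update {j : ℕ} {h : Config N} {a : Fin N} (e : Fin 2)
    (hQ : funQ q (xiShift ξ η h a) ≠ 0)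
    (hl : ∀ k ∈ Finset.Ico 1 (j + 1), xiShift ξ η h a - lam k ≠ 0) :
    weight ξ η q lam j (Function.update h a e) = weight ξ η q lam j h *
      (funQ q (xiShift ξ η (Function.update h a e) a) / funQ q (xiShift ξ η h a)) *
      ∏ k ∈ Finset.Ico 1 (j + 1), (xiShift ξ η (Function.update h a e) a - lam k) /
        (xiShift ξ η h a - lam k) := by
  have hIcc : Finset.Icc 1 j = Finset.Ico 1 (j + 1) := by
    ext k
    simp only [Finset.mem_Icc, Finset.mem_Ico]
    omega
  have h1 : ∏ k ∈ Finset.Icc 1 j, funDh ξ η (Function.update h a e) (lam k) =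
      (∏ k ∈ Finset.Icc 1 j, funDh ξ η h (lam k)) *
      ∏ k ∈ Finset.Ico 1 (j + 1), (xiShift ξ η (Function.update h a e) a - lam k) /
        (xiShift ξ η h a - lam k) := by
    rw [hIcc, ← Finset.prod_mul_distrib]
    refine Finset.prod_congr rfl fun k hk => ?_
    rw [funDh_eq_mul h a, funDh_eq_mul (Function.update h a e) a,
      prod_erase_xiShift_update h a e fun x => lam k - x]
    have := hl k hk
    field_simp
    ring
  have h2 : ∏ n, funQ q (xiShift ξ η (Function.update h a e) n) =
      (∏ n, funQ q (xiShift ξ η h n)) *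
      (funQ q (xiShift ξ η (Function.update h a e) a) / funQ q (xiShift ξ η h a)) := by
    rw [← Finset.mul_prod_erase _ _ (Finset.mem_univ a),
      ← Finset.mul_prod_erase (a := a) _ (fun n => funQ q (xiShift ξ η h n)) (Finset.mem_univ a),
      prod_erase_xiShift_update h a e fun x => funQ q x]
    field_simp
  unfold weight
  rw [h1, h2]
  ring

/-- The residues of the odd variable reproduce the action of D(λ + η)⁻¹ C(λ + η), or that of C(λ)
without its factor d_𝐡(λ), where λ = λ_{j+1}. -/
theorem weight_mul_cutIntegral_odd (hU : IsRegion ξ η q lam m U)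
    (hξ : ∀ a b, a ≠ b → ξ a ≠ ξ b ∧ ξ a ≠ ξ b + η ∧ ξ a ≠ ξ b - η) (hρ : 0 < ρ)
    (hsep : ∀ a b, a ≠ b → 2 * ρ ≤ dist (ξ a) (ξ b)) (hball : ∀ n, Metric.ball (ξ n) ρ ⊆ U)
    (hQ : ∀ (h : Config N) a, funQ q (xiShift ξ η h a) ≠ 0)
    (hl : ∀ k ∈ Finset.Icc 1 m, ∀ (h : Config N) a, lam k - xiShift ξ η h a ≠ 0)
    {j : ℕ} (hj : j < m) (h0 : ε (2 * j + 1) = 0) (h : Config N) :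
    weight ξ η q lam j h * cutIntegral ξ η q lam m ε ρ (2 * j + 1) h =
      ∑ a, if h a = 1 then (lam (j + 1) - xiShift ξ η h a)⁻¹ * funD ξ (ξ a - η) *
        (∏ b ∈ Finset.univ.erase a, (xiShift ξ η h a - xiShift ξ η h b))⁻¹ *
        (weight ξ η q lam j (Function.update h a 0) *
          cutIntegral ξ η q lam m ε ρ (2 * j) (Function.update h a 0)) else 0 := by
  have hodd : ¬ Even (2 * j + 1) := by simp
  have hdiv : (2 * j + 1 + 1) / 2 = j + 1 := by omega
  rw [cutIntegral_succ hU hξ hρ hsep hball (by omega) h0, Finset.mul_sum]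
  simp only [restFactor, numFactor, flip, if_neg hodd, hdiv]
  refine Finset.sum_congr rfl fun a _ => ?_
  split_ifs with ha
  · have hx : xiShift ξ η h a = ξ a - η := by simp [xiShift, ha]
    have hx' : xiShift ξ η (Function.update h a 0) a = xiShift ξ η h a + η := by
      simp [xiShift, ha]
    rw [weight_update 0 (hQ h a) fun k hk => by
      have := hl k (by simp only [Finset.mem_Icc, Finset.mem_Ico] at hk ⊢; omega) h a
      rwa [← neg_sub, neg_ne_zero], hx', ← hx]
    have hprod : ∏ k ∈ Finset.Ico 1 (j + 1), (xiShift ξ η h a - lam k + η) /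
        (xiShift ξ η h a - lam k) = ∏ k ∈ Finset.Ico 1 (j + 1),
        (xiShift ξ η h a + η - lam k) / (xiShift ξ η h a - lam k) :=
      Finset.prod_congr rfl fun k _ => by rw [sub_add_eq_add_sub]
    rw [hprod, one_div, mul_inv]
    have hpi : 2 * (Real.pi : ℂ) * Complex.I * (2 * (Real.pi : ℂ) * Complex.I)⁻¹ = 1 :=
      mul_inv_cancel₀ Complex.two_pi_I_ne_zero
    generalize ∏ k ∈ Finset.Ico 1 (j + 1), (xiShift ξ η h a + η - lam k) /
      (xiShift ξ η h a - lam k) = p₁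
    generalize (∏ b ∈ Finset.univ.erase a, (xiShift ξ η h a - xiShift ξ η h b))⁻¹ = p₂
    linear_combination weight ξ η q lam j h * (lam (j + 1) - xiShift ξ η h a)⁻¹ *
      (funQ q (xiShift ξ η h a + η) / funQ q (xiShift ξ η h a)) * p₁ *
      funD ξ (xiShift ξ η h a) * p₂ *
      cutIntegral ξ η q lam m ε ρ (2 * j) (Function.update h a 0) * hpi
  · exact mul_zero _

/-- The residues of the even variable reproduce the action of B(λ_{j+1}) without its factor
d_𝐡(λ_{j+1}); the minus sign is that of `evenFactor` and of the action of B. -/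
theorem weight_mul_cutIntegral_even (hU : IsRegion ξ η q lam m U)
    (hξ : ∀ a b, a ≠ b → ξ a ≠ ξ b ∧ ξ a ≠ ξ b + η ∧ ξ a ≠ ξ b - η) (hρ : 0 < ρ)
    (hsep : ∀ a b, a ≠ b → 2 * ρ ≤ dist (ξ a) (ξ b)) (hball : ∀ n, Metric.ball (ξ n) ρ ⊆ U)
    (hQ : ∀ (h : Config N) a, funQ q (xiShift ξ η h a) ≠ 0)
    (hl : ∀ k ∈ Finset.Icc 1 m, ∀ (h : Config N) a, lam k - xiShift ξ η h a ≠ 0)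
    {j : ℕ} (hj : j < m) (h0 : ε (2 * j + 2) = 0) (h : Config N) :
    weight ξ η q lam j h * cutIntegral ξ η q lam m ε ρ (2 * j + 2) h =
      -∑ a, if h a = 0 then (lam (j + 1) - xiShift ξ η h a)⁻¹ * funA ξ η (ξ a) *
        (∏ b ∈ Finset.univ.erase a, (xiShift ξ η h a - xiShift ξ η h b))⁻¹ *
        (weight ξ η q lam j (Function.update h a 1) *
          cutIntegral ξ η q lam m ε ρ (2 * j + 1) (Function.update h a 1)) else 0 := by
  have heven : Even (2 * j + 1 + 1) := ⟨j + 1, by ring⟩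
  have hdiv : (2 * j + 1 + 1) / 2 = j + 1 := by omega
  rw [cutIntegral_succ hU hξ hρ hsep hball (by omega) h0, Finset.mul_sum,
    ← Finset.sum_neg_distrib]
  simp only [restFactor, numFactor, flip, if_pos heven, hdiv]
  refine Finset.sum_congr rfl fun a _ => ?_
  split_ifs with ha
  · have hx : xiShift ξ η h a = ξ a := by simp [xiShift, ha]
    have hx' : xiShift ξ η (Function.update h a 1) a = xiShift ξ η h a - η := by
      simp [xiShift, ha]
    rw [weight_update 1 (hQ h a) fun k hk => by
      have := hl k (by simp only [Finset.mem_Icc, Finset.mem_Ico] at hk ⊢; omega) h a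
      rwa [← neg_sub, neg_ne_zero], hx', ← hx]
    have hprod : ∏ k ∈ Finset.Ico 1 (j + 1), (xiShift ξ η h a - lam k - η) /
        (xiShift ξ η h a - lam k) = ∏ k ∈ Finset.Ico 1 (j + 1),
        (xiShift ξ η h a - η - lam k) / (xiShift ξ η h a - lam k) :=
      Finset.prod_congr rfl fun k _ => by rw [sub_right_comm]
    rw [hprod, one_div, mul_inv]
    have hpi : 2 * (Real.pi : ℂ) * Complex.I * (2 * (Real.pi : ℂ) * Complex.I)⁻¹ = 1 :=
      mul_inv_cancel₀ Complex.two_pi_I_ne_zero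
    generalize ∏ k ∈ Finset.Ico 1 (j + 1), (xiShift ξ η h a - η - lam k) /
      (xiShift ξ η h a - lam k) = p₁
    generalize (∏ b ∈ Finset.univ.erase a, (xiShift ξ η h a - xiShift ξ η h b))⁻¹ = p₂
    linear_combination -weight ξ η q lam j h * (lam (j + 1) - xiShift ξ η h a)⁻¹ *
      (funQ q (xiShift ξ η h a - η) / funQ q (xiShift ξ η h a)) * p₁ *
      funA ξ η (xiShift ξ η h a) * p₂ *
      cutIntegral ξ η q lam m ε ρ (2 * j + 1) (Function.update h a 1) * hpi
  · simp

/-- The action of the first `j` operators on the separate state. -/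
theorem separateState_vecMul_opBarProd (hη : η ≠ 0) (hU : IsRegion ξ η q lam m U)
    (hξ : ∀ a b, a ≠ b → ξ a ≠ ξ b ∧ ξ a ≠ ξ b + η ∧ ξ a ≠ ξ b - η) (hρ : 0 < ρ)
    (hsep : ∀ a b, a ≠ b → 2 * ρ ≤ dist (ξ a) (ξ b)) (hball : ∀ n, Metric.ball (ξ n) ρ ⊆ U)
    (hQ : ∀ (h : Config N) a, funQ q (xiShift ξ η h a) ≠ 0)
    (hl : ∀ k ∈ Finset.Icc 1 m, ∀ (h : Config N) a, lam k - xiShift ξ η h a ≠ 0)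
    (hl' : ∀ k ∈ Finset.Icc 1 m, ∀ (h : Config N) a, lam k + η - xiShift ξ η h a ≠ 0)
    (hbra : IsLeftSoVBasis ξ η bra) {j : ℕ} (hj : j ≤ m) :
    separateState ξ η q bra ᵥ* opBarProd ξ η j ε lam = stateOf ξ η bra fun h =>
      weight ξ η q lam j h * cutIntegral ξ η q lam m ε ρ (2 * j) h := by
  induction j with
  | zero =>
    simp [opBarProd, separateState, stateOf, weight, cutIntegral_zero]
  | succ j ih =>
    have hmem : j + 1 ∈ Finset.Icc 1 m := Finset.mem_Icc.2 ⟨by omega, hj⟩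
    have hsucc : opBarProd ξ η (j + 1) ε lam =
        opBarProd ξ η j ε lam * opBar ξ η (ε (2 * j + 2)) (ε (2 * j + 1)) (lam (j + 1)) := by
      unfold opBarProd
      rw [List.range_succ, List.map_append, List.prod_append]
      simp [mul_add]
    rw [hsucc, ← Matrix.vecMul_vecMul, ih (by omega), show 2 * (j + 1) = 2 * j + 2 by ring]
    simp only [weight_succ, mul_assoc]
    have hodd := weight_mul_cutIntegral_odd (ε := ε) hU hξ hρ hsep hball hQ hl (j := j) (by omega)
    have heven := weight_mul_cutIntegral_even (ε := ε) hU hξ hρ hsep hball hQ hl (j := j) (by omega)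
    by_cases h2 : ε (2 * j + 2) = 0
    · by_cases h1 : ε (2 * j + 1) = 0
      -- D⁻¹C acts first and accounts for the odd variable, then B for the even one. Only B brings a
      -- factor d_𝐡(λ_{j+1}), so it occurs once, as required.
      · rw [opBar, if_pos ⟨h2, h1⟩, ← Matrix.vecMul_vecMul, ← Matrix.vecMul_vecMul,
          stateOf_opD_inv_opC hη hξ hbra _ (hl' _ hmem), stateOf_opB hη hξ hbra _ (hl _ hmem)]
        refine stateOf_congr fun h => ?_
        rw [heven h2, mul_neg]
        simp only [← hodd h1]
      · have hT : opBar ξ η (ε (2 * j + 2)) (ε (2 * j + 1)) (lam (j + 1)) =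
            opB ξ η (lam (j + 1)) := by
          rw [opBar, if_neg fun h => h1 h.2, h2, fin_two_eq_one h1]
          rfl
        rw [hT, stateOf_opB hη hξ hbra _ (hl _ hmem)]
        refine stateOf_congr fun h => ?_
        rw [heven h2, mul_neg, cutIntegral_succ_of_absent h1]
    · rw [cutIntegral_succ_of_absent h2]
      by_cases h1 : ε (2 * j + 1) = 0
      · have hT : opBar ξ η (ε (2 * j + 2)) (ε (2 * j + 1)) (lam (j + 1)) =
            opC ξ η (lam (j + 1)) := by
          rw [opBar, if_neg fun h => h2 h.1, h1, fin_two_eq_one h2]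
          rfl
        rw [hT, stateOf_opC hη hξ hbra _ (hl _ hmem)]
        refine stateOf_congr fun h => ?_
        rw [hodd h1]
      · have hT : opBar ξ η (ε (2 * j + 2)) (ε (2 * j + 1)) (lam (j + 1)) =
            opD ξ η (lam (j + 1)) := by
          rw [opBar, if_neg fun h => h2 h.1, fin_two_eq_one h1, fin_two_eq_one h2]
          rfl
        rw [hT, stateOf_opD hbra, cutIntegral_succ_of_absent h1]

end Coefficients

end

end XXXChain

namespace XXXChain

noncomputable section

open Filter Topology

/-! ### Arbitrary contours -/

section Contours

variable {N R : ℕ} {ξ : Fin N → ℂ} {η : ℂ} {q : Fin R → ℂ} {lam : ℕ → ℂ} {m : ℕ}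
  {ε : ℕ → Fin 2} {U : Set ℂ} {Γ : ℕ → (ℕ → ℂ) → Contour}

theorem Surrounds.mem_nhds {i : ℕ} {z : ℕ → ℂ} {C : Contour} (hC : Surrounds ξ η m ε U i z C)
    (n : Fin N) : U ∈ 𝓝 (ξ n) := by
  unfold Surrounds at hC
  split_ifs at hC with hi
  · exact (hC.1 n).mem_nhds hC.2.2
  · have h := (hC.1 n).mem_nhds (W := {p | p + η ∈ U}) hC.2.2
    have hcont : Tendsto (fun p : ℂ => p - η) (𝓝 (ξ n)) (𝓝 (ξ n - η)) :=
      (continuous_id.sub continuous_const).tendsto _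
    filter_upwards [hcont h] with p hp
    simpa using hp

/-- The outermost variable that is present has a contour of index 1 about each ξ_n, or ξ_n - η, and
of index 0 off its region, which forces U to be a neighbourhood. -/
theorem NestedSurrounds.mem_nhds_or_absent {i : ℕ} {z : ℕ → ℂ}
    (h : NestedSurrounds ξ η m ε U Γ i z) :
    (∀ n, U ∈ 𝓝 (ξ n)) ∨ ∀ k ∈ Finset.Icc 1 i, ε k ≠ 0 := by
  induction i with
  | zero => exact .inr (by simp)
  | succ i ih =>
    unfold NestedSurrounds at h
    split_ifs at h with h0
    · exact .inl h.1.mem_nhds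
    · refine (ih h).imp_right fun hk k hk' => ?_
      rcases (Finset.mem_Icc.1 hk').2.eq_or_lt with rfl | hlt
      · exact h0
      · exact hk k (Finset.mem_Icc.2 ⟨(Finset.mem_Icc.1 hk').1, by omega⟩)

theorem nestedSurrounds_of_absent {i : ℕ} (h0 : ∀ k ∈ Finset.Icc 1 i, ε k ≠ 0) (z : ℕ → ℂ) :
    NestedSurrounds ξ η m ε U Γ i z := by
  induction i with
  | zero => trivial
  | succ i ih =>
    unfold NestedSurrounds
    rw [if_neg (h0 _ (Finset.mem_Icc.2 ⟨by omega, le_rfl⟩))]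
    exact ih fun k hk => h0 k (Finset.Icc_subset_Icc_right (by omega) hk)

theorem IsContourSystem.isRegion (h : IsContourSystem ξ η q lam m ε U Γ) :
    IsRegion ξ η q lam m U :=
  ⟨h.xi_mem, h.disjoint_shift, h.lam_notMem, h.q_notMem⟩

/-- The region of a contour system may be taken to be a neighbourhood of the points `ξ_n`. -/
theorem IsContourSystem.exists_region (hη : η ≠ 0)
    (hξ : ∀ a b, a ≠ b → ξ a ≠ ξ b ∧ ξ a ≠ ξ b + η ∧ ξ a ≠ ξ b - η)
    (hq : ∀ k n, q k ≠ ξ n ∧ q k ≠ ξ n - η)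
    (hlam : ∀ j ∈ Finset.Icc 1 m, ∀ n,
      lam j ≠ ξ n ∧ lam j ≠ ξ n - η ∧ lam j ≠ ξ n - 2 * η)
    (h : IsContourSystem ξ η q lam m ε U Γ) :
    ∃ V, IsRegion ξ η q lam m V ∧ (∀ n, V ∈ 𝓝 (ξ n)) ∧
      NestedSurrounds ξ η m ε V Γ (2 * m) 0 := by
  rcases h.surrounds.mem_nhds_or_absent with hU | habs
  · exact ⟨U, h.isRegion, hU, h.surrounds⟩
  -- With no variable present the contours are unconstrained, and U may fail to be a neighbourhood
  -- of the ξ_n; it is replaced by a union of discs.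
  · obtain ⟨V, hV, hn⟩ := exists_isRegion hη hξ hq hlam
    exact ⟨V, hV, hn, nestedSurrounds_of_absent habs 0⟩

theorem nestedSurrounds_circleContour_zero {ρ : ℝ} (hρ : 0 < ρ)
    (hsep : ∀ a b, a ≠ b → 2 * ρ ≤ dist (ξ a) (ξ b)) (hball : ∀ n, Metric.ball (ξ n) ρ ⊆ U) :
    NestedSurrounds ξ η m ε U (fun i _ => circleContour ξ η ρ i) (2 * m) 0 :=
  nestedSurrounds_circleContour hρ hsep hball (2 * m) 0 (by simp)

/-- Both sides are the value of one function that is determined by the region alone. -/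
theorem iteratedIntegral_eq_of_nestedSurrounds {Γ' : ℕ → (ℕ → ℂ) → Contour}
    (hU : IsRegion ξ η q lam m U) (h : Config N)
    (hΓ : NestedSurrounds ξ η m ε U Γ (2 * m) 0) (hΓ' : NestedSurrounds ξ η m ε U Γ' (2 * m) 0) :
    iteratedIntegral ε Γ (innerIntegrand ξ η q lam m ε h (2 * m)) (2 * m) 0 =
      iteratedIntegral ε Γ' (innerIntegrand ξ η q lam m ε h (2 * m)) (2 * m) 0 := by
  obtain ⟨F, -, hF⟩ := exists_regularOn_iteratedIntegral (ε := ε) hU h (le_refl (2 * m))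
  have h0 : (0 : ℕ → ℂ) ∈ outerDomain η m ε U (2 * m) := by simp [outerDomain]
  rw [hF 0 h0 Γ hΓ, hF 0 h0 Γ' hΓ']

theorem injective_of_separated
    (hξ : ∀ a b, a ≠ b → ξ a ≠ ξ b ∧ ξ a ≠ ξ b + η ∧ ξ a ≠ ξ b - η) : Function.Injective ξ :=
  fun a b hab => by_contra fun hne => (hξ a b hne).1 hab

theorem exists_isContourSystem (hη : η ≠ 0)
    (hξ : ∀ a b, a ≠ b → ξ a ≠ ξ b ∧ ξ a ≠ ξ b + η ∧ ξ a ≠ ξ b - η)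
    (hq : ∀ k n, q k ≠ ξ n ∧ q k ≠ ξ n - η)
    (hlam : ∀ j ∈ Finset.Icc 1 m, ∀ n,
      lam j ≠ ξ n ∧ lam j ≠ ξ n - η ∧ lam j ≠ ξ n - 2 * η) :
    ∃ U Γ, IsContourSystem ξ η q lam m ε U Γ := by
  obtain ⟨U, hU, hn⟩ := exists_isRegion hη hξ hq hlam
  obtain ⟨ρ, hρ, hsep, hball⟩ := exists_radius (injective_of_separated hξ) hn
  exact ⟨U, fun i _ => circleContour ξ η ρ i, hU.xi_mem, hU.disjoint_shift, hU.lam_notMem,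
    hU.q_notMem, nestedSurrounds_circleContour_zero hρ hsep hball⟩

theorem sub_xiShift_ne_zero {l : ℂ} (h1 : ∀ n, l ≠ ξ n) (h2 : ∀ n, l ≠ ξ n - η) (h : Config N)
    (n : Fin N) : l - xiShift ξ η h n ≠ 0 := by
  unfold xiShift
  rw [sub_ne_zero]
  by_cases hn : h n = 0
  · simpa [hn] using h1 n
  · simpa [fin_two_eq_one hn] using h2 n

theorem funQ_xiShift_ne_zero (hq : ∀ k n, q k ≠ ξ n ∧ q k ≠ ξ n - η) (h : Config N)
    (n : Fin N) : funQ q (xiShift ξ η h n) ≠ 0 := by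
  refine Finset.prod_ne_zero_iff.2 fun k _ => ?_
  rw [← neg_sub, neg_ne_zero]
  exact sub_xiShift_ne_zero (fun n => (hq k n).1) (fun n => (hq k n).2) h n

/-- The action of the product of operators on a separate state, for arbitrary contours. -/
theorem separateState_vecMul_opBarProd_eq_sum (hη : η ≠ 0)
    (hξ : ∀ a b, a ≠ b → ξ a ≠ ξ b ∧ ξ a ≠ ξ b + η ∧ ξ a ≠ ξ b - η)
    (hq : ∀ k n, q k ≠ ξ n ∧ q k ≠ ξ n - η)
    (hlam : ∀ j ∈ Finset.Icc 1 m, ∀ n,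
      lam j ≠ ξ n ∧ lam j ≠ ξ n - η ∧ lam j ≠ ξ n - 2 * η)
    {bra : Module.Basis (Config N) ℂ (Bra N)} (hbra : IsLeftSoVBasis ξ η bra)
    (hΓ : IsContourSystem ξ η q lam m ε U Γ) :
    Matrix.vecMul (separateState ξ η q bra) (opBarProd ξ η m ε lam) =
      ∑ h, actionCoeff ξ η q lam m ε Γ h • bra h := by
  obtain ⟨V, hV, hn, hVΓ⟩ := hΓ.exists_region hη hξ hq hlam
  obtain ⟨ρ, hρ, hsep, hball⟩ := exists_radius (injective_of_separated hξ) hn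
  have hl : ∀ k ∈ Finset.Icc 1 m, ∀ (h : Config N) a, lam k - xiShift ξ η h a ≠ 0 :=
    fun k hk => sub_xiShift_ne_zero (fun n => (hlam k hk n).1) fun n => (hlam k hk n).2.1
  -- Invertibility of D(λ_k + η); this is where λ_k ≠ ξ_n - 2η enters.
  have hl' : ∀ k ∈ Finset.Icc 1 m, ∀ (h : Config N) a, lam k + η - xiShift ξ η h a ≠ 0 := by
    refine fun k hk => sub_xiShift_ne_zero (fun n hkn => ?_) fun n hkn => ?_
    · exact (hlam k hk n).2.1 (eq_sub_of_add_eq hkn)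
    · exact (hlam k hk n).2.2 (by linear_combination hkn)
  rw [separateState_vecMul_opBarProd hη hV hξ hρ hsep hball (funQ_xiShift_ne_zero hq) hl hl' hbra
    le_rfl]
  refine Finset.sum_congr rfl fun h _ => ?_
  rw [actionCoeff, integrand_eq_innerIntegrand, iteratedIntegral_eq_of_nestedSurrounds hV h hVΓ
    (nestedSurrounds_circleContour_zero hρ hsep hball)]
  simp only [weight, cutIntegral, cutIndices_two_mul]

end Contours

end

end XXXChain

/-! ### The main theorem -/

theorem mainTheorem5 {N R : ℕ} (ξ : Fin N → ℂ) (η : ℂ) (hη : η ≠ 0)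
    (hξ : ∀ a b, a ≠ b → ξ a ≠ ξ b ∧ ξ a ≠ ξ b + η ∧ ξ a ≠ ξ b - η)
    (q : Fin R → ℂ) (hq : ∀ k n, q k ≠ ξ n ∧ q k ≠ ξ n - η)
    (m : ℕ) (ε : ℕ → Fin 2) (lam : ℕ → ℂ)
    (hlam : ∀ j ∈ Finset.Icc 1 m, ∀ n,
      lam j ≠ ξ n ∧ lam j ≠ ξ n - η ∧ lam j ≠ ξ n - 2 * η) :
    (∃ bra, XXXChain.IsLeftSoVBasis ξ η bra) ∧
    (∃ U Γ, XXXChain.IsContourSystem ξ η q lam m ε U Γ) ∧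
    ∀ bra, XXXChain.IsLeftSoVBasis ξ η bra →
      ∀ U Γ, XXXChain.IsContourSystem ξ η q lam m ε U Γ →
        Matrix.vecMul (XXXChain.separateState ξ η q bra) (XXXChain.opBarProd ξ η m ε lam) =
          ∑ h, XXXChain.actionCoeff ξ η q lam m ε Γ h • bra h := by
  exact ⟨⟨_, XXXChain.isLeftSoVBasis_sovBasis hη hξ⟩,
    XXXChain.exists_isContourSystem hη hξ hq hlam, fun _ hbra _ _ hΓ =>
      XXXChain.separateState_vecMul_opBarProd_eq_sum hη hξ hq hlam hbra hΓ⟩
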